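/- Let $X$ be a compact complex manifold, let $U$ be a connected complex manifold (Hausdorff and second countable) on which every holomorphic vector bundle is trivial, and let $0\in U$ be a base point. Let $E\to X\times U$ be a holomorphic vector bundle of rank $r$; for $t\in U$ write $E_t$ for the restriction of $E$ to $X\times\{t\}$, regarded as a holomorphic vector bundle on $X$. Let $g^0$ be a $C^\infty$ hermitian metric on $E_0$. A $C^\infty$ hermitian metric $g$ on $E$ is said to extend (or deform) $g^0$ if $g|_{E_0}=g^0$. It is called curvature preserving, or Ricci-flat, if $\Theta^t=\Theta^0$ for all $t\in U$, where $\Theta^t=\partial_X\bar\partial_X\log\det (g|_{E_t})$, the determinant being taken in local holomorphic frames of $E_t$. Two metrics on $E$ are conformally equivalent if they differ by a positive $C^\infty$ function on $X\times U$. The inclusions $\mathbb Z\subset\mathbb R\overset{i}{\subset}\mathcal O_X$ induce maps from $H^1(X,\mathbb Z)$ and $H^1(X,\mathbb R)$ to $H^1(X,\mathcal O_X)$; let $\mathrm{Pic}^0(X)=H^1(X,\mathcal O_X)/H^1(X,\mathbb Z)$ be the quotient by the image of $H^1(X,\mathbb Z)$, let $i_*H^1(X,\mathbb R)/H^1(X,\mathbb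 Z)\subset \mathrm{Pic}^0(X)$ be the image of $i_*H^1(X,\mathbb R)$, and let $\mathrm{Pic}^0(X)\to\mathrm{Pic}(X)=H^1(X,\mathcal O_X^*)$ be the map induced by $f\mapsto e^{2\pi i f}$. Then there is exactly one map $\eta:U\to \mathrm{Pic}^0(X)$ such that, for all $t\in U$, the image of $\eta(t)$ in $\mathrm{Pic}(X)$ is the class of $\det E_t\otimes(\det E_0)^\vee$, and the following hold. 1. There is a Ricci-flat $C^\infty$ hermitian metric $g$ on $E$ extending $g^0$ if and only if $\eta(t)\in i_*H^1(X,\mathbb R)/H^1(X,\mathbb Z)$ for all $t\in U$. 2. If $\eta(t)\in i_*H^1(X,\mathbb R)/H^1(X,\mathbb Z)$ for all $t\in U$, then every $C^\infty$ hermitian metric on $E$ extending $g^0$ is conformally equivalent to a Ricci-flat $C^\infty$ hermitian metric on $E$ extending $g^0$. -/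

import Mathlib

open Bundle Set Filter Topology TopologicalSpace
open scoped Manifold ContDiff Bundle

noncomputable section

namespace RicciFlatDeformation

/-! ### First Čech cohomology of sheaves of functions -/

/-- A sheaf of `A`-valued functions on `M`, given by the condition `IsSectionAt f x` that `f` is a
section near `x`.  The sections over an open set `V` are the functions on `V` which satisfy the
condition at all points of `V`. -/
structure FunctionSheaf (M : Type*) [TopologicalSpace M] (A : Type*) [AddCommGroup A] where
  IsSectionAt : (M → A) → M → Prop
  congr : ∀ {f g : M → A} {x : M}, f =ᶠ[𝓝 x] g → IsSectionAt f x → IsSectionAt g x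
  zero : ∀ x : M, IsSectionAt 0 x
  add : ∀ {f g : M → A} {x : M}, IsSectionAt f x → IsSectionAt g x → IsSectionAt (f + g) x
  neg : ∀ {f : M → A} {x : M}, IsSectionAt f x → IsSectionAt (-f) x

namespace FunctionSheaf

variable {M : Type*} [TopologicalSpace M]
  {A : Type*} [AddCommGroup A] {B : Type*} [AddCommGroup B]

/-- Čech `1`-cocycles.  Every open cover of `M` is refined by a cover of the form `(V a)_{a ∈ M}`
with `a ∈ V a`, so that only these covers are used.  The component with indices `a`, `b` matters
only on `V a ∩ V b`, and is extended arbitrarily to all of `M`. -/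
def cocycles (F : FunctionSheaf M A) : AddSubgroup (M → M → M → A) where
  carrier := {f | ∃ V : M → Opens M, (∀ a, a ∈ V a) ∧
    (∀ a b, ∀ x ∈ V a ⊓ V b, F.IsSectionAt (f a b) x) ∧
    (∀ a b c, ∀ x ∈ V a ⊓ V b ⊓ V c, f a b x + f b c x = f a c x)}
  zero_mem' := ⟨fun _ => ⊤, fun _ => trivial, fun _ _ x _ => F.zero x, fun _ _ _ _ _ => by simp⟩
  add_mem' := by
    rintro f g ⟨V, hV, hf, hf'⟩ ⟨W, hW, hg, hg'⟩
    refine ⟨fun a => V a ⊓ W a, fun a => ⟨hV a, hW a⟩, ?_, ?_⟩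
    · rintro a b x ⟨⟨h1, h2⟩, h3, h4⟩
      exact F.add (hf a b x ⟨h1, h3⟩) (hg a b x ⟨h2, h4⟩)
    · rintro a b c x ⟨⟨⟨h1, h2⟩, h3, h4⟩, h5, h6⟩
      have e1 := hf' a b c x ⟨⟨h1, h3⟩, h5⟩
      have e2 := hg' a b c x ⟨⟨h2, h4⟩, h6⟩
      simp only [Pi.add_apply]
      rw [← e1, ← e2]
      abel
  neg_mem' := by
    rintro f ⟨V, hV, hf, hf'⟩
    refine ⟨V, hV, fun a b x hx => F.neg (hf a b x hx), fun a b c x hx => ?_⟩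
    simp only [Pi.neg_apply]
    rw [← hf' a b c x hx]
    abel

/-- Čech `1`-coboundaries, including the families which vanish on the overlaps of some cover. -/
def coboundaries (F : FunctionSheaf M A) : AddSubgroup (M → M → M → A) where
  carrier := {f | ∃ (V : M → Opens M) (h : M → M → A), (∀ a, a ∈ V a) ∧
    (∀ a, ∀ x ∈ V a, F.IsSectionAt (h a) x) ∧
    (∀ a b, ∀ x ∈ V a ⊓ V b, f a b x = h b x - h a x)}
  zero_mem' := ⟨fun _ => ⊤, 0, fun _ => trivial, fun _ x _ => F.zero x, fun _ _ _ _ => by simp⟩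
  add_mem' := by
    rintro f g ⟨V, h, hV, hh, hf⟩ ⟨W, k, hW, hk, hg⟩
    refine ⟨fun a => V a ⊓ W a, h + k, fun a => ⟨hV a, hW a⟩,
      fun a x hx => F.add (hh a x hx.1) (hk a x hx.2), ?_⟩
    rintro a b x ⟨⟨h1, h2⟩, h3, h4⟩
    have e1 := hf a b x ⟨h1, h3⟩
    have e2 := hg a b x ⟨h2, h4⟩
    simp only [Pi.add_apply]
    rw [e1, e2]
    abel
  neg_mem' := by
    rintro f ⟨V, h, hV, hh, hf⟩
    refine ⟨V, -h, hV, fun a x hx => F.neg (hh a x hx), fun a b x hx => ?_⟩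
    simp only [Pi.neg_apply]
    rw [hf a b x hx]
    abel

/-- The first Čech cohomology group `H¹(M, F)`, the direct limit over all open covers of `M`
of the groups of cocycles modulo coboundaries. -/
abbrev H1 (F : FunctionSheaf M A) : Type _ :=
  F.cocycles ⧸ F.coboundaries.addSubgroupOf F.cocycles

/-- The class of a cocycle. -/
def H1.mk (F : FunctionSheaf M A) (f : M → M → M → A) (hf : f ∈ F.cocycles) : F.H1 :=
  QuotientAddGroup.mk ⟨f, hf⟩

/-- A homomorphism `φ` of the groups of values induces a homomorphism of sheaves `F → G`. -/
def MapsSections (F : FunctionSheaf M A) (G : FunctionSheaf M B) (φ : A →+ B) : Prop :=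
  ∀ (f : M → A) (x : M), F.IsSectionAt f x → G.IsSectionAt (fun y => φ (f y)) x

/-- The map on cocycles induced by a homomorphism of sheaves. -/
def cocyclesMap {F : FunctionSheaf M A} {G : FunctionSheaf M B} (φ : A →+ B)
    (hφ : MapsSections F G φ) : F.cocycles →+ G.cocycles where
  toFun f := ⟨fun a b x => φ (f.1 a b x), by
    obtain ⟨f, V, hV, hf, hf'⟩ := f
    refine ⟨V, hV, fun a b x hx => hφ _ x (hf a b x hx), fun a b c x hx => ?_⟩
    rw [← map_add]
    exact congrArg φ (hf' a b c x hx)⟩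
  map_zero' := by ext; simp
  map_add' f g := by ext; simp

/-- The homomorphism `H¹(M, F) → H¹(M, G)` induced by a homomorphism of sheaves `F → G`. -/
def H1.map {F : FunctionSheaf M A} {G : FunctionSheaf M B} (φ : A →+ B)
    (hφ : MapsSections F G φ) : F.H1 →+ G.H1 :=
  QuotientAddGroup.map _ _ (cocyclesMap φ hφ) (by
    rintro ⟨f, hf⟩ ⟨V, h, hV, hh, hfh⟩
    refine ⟨V, fun a x => φ (h a x), hV, fun a x hx => hφ _ x (hh a x hx), fun a b x hx => ?_⟩
    change φ (f a b x) = φ (h b x) - φ (h a x)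
    rw [← map_sub]
    exact congrArg φ (hfh a b x hx))

end FunctionSheaf

open FunctionSheaf

/-- The constant sheaf with values in `A`, that is, the sheaf of locally constant functions. -/
def constSheaf (M : Type*) [TopologicalSpace M] (A : Type*) [AddCommGroup A] :
    FunctionSheaf M A where
  IsSectionAt f x := ∀ᶠ y in 𝓝 x, f y = f x
  congr := by
    intro f g x h hf
    filter_upwards [h, hf] with y h1 h2
    rw [← h1, h2, h.eq_of_nhds]
  zero x := by simp
  add := by
    intro f g x hf hg
    filter_upwards [hf, hg] with y h1 h2
    simp [h1, h2]
  neg := by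
    intro f x hf
    filter_upwards [hf] with y h1
    simp [h1]

section Complex

variable {V : Type*} [NormedAddCommGroup V] [NormedSpace ℂ V] {H : Type*} [TopologicalSpace H]
  (I : ModelWithCorners ℂ V H) (M : Type*) [TopologicalSpace M] [ChartedSpace H M]

/-- The sheaf `𝒪` of holomorphic functions (complex analytic functions). -/
def holoSheaf : FunctionSheaf M ℂ where
  IsSectionAt f x := ContMDiffAt I 𝓘(ℂ, ℂ) ω f x
  congr h hf := hf.congr_of_eventuallyEq h.symm
  zero _ := contMDiffAt_const
  add hf hg := hf.add hg
  neg hf := by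
    exact (contDiff_neg (𝕜 := ℂ) (F := ℂ) (n := ω)).contMDiff.contMDiffAt.comp _ hf

/-- The sheaf `𝒪*` of nowhere vanishing holomorphic functions, under multiplication. -/
def holoUnitsSheaf : FunctionSheaf M (Additive ℂˣ) where
  IsSectionAt f x := ContMDiffAt I 𝓘(ℂ, ℂ) ω (fun y => ((f y).toMul : ℂ)) x
  congr h hf := hf.congr_of_eventuallyEq (h.symm.mono fun y hy => by simp [hy])
  zero _ := contMDiffAt_const
  add hf hg := by
    exact (contDiff_mul (𝕜 := ℂ) (𝔸 := ℂ) (n := ω)).contMDiff.contMDiffAt.comp _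
      (hf.prodMk_space hg)
  neg {f x} hf := by
    have h := (contDiffAt_inv ℂ (n := ω) (f x).toMul.ne_zero).contMDiffAt.comp x hf
    refine h.congr_of_eventuallyEq (Eventually.of_forall fun y => ?_)
    simp

/-- The Picard group of isomorphism classes of holomorphic line bundles, `H¹(M, 𝒪*)`. -/
abbrev Pic : Type _ := (holoUnitsSheaf I M).H1

variable {M} in
theorem holoSheaf_of_eventuallyConst {f : M → ℂ} {x : M} (h : ∀ᶠ y in 𝓝 x, f y = f x) :
    (holoSheaf I M).IsSectionAt f x :=
  (contMDiffAt_const (c := f x)).congr_of_eventuallyEq h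

/-- The map `H¹(M, ℤ) → H¹(M, 𝒪)` induced by the inclusion. -/
def intToHolo : (constSheaf M ℤ).H1 →+ (holoSheaf I M).H1 :=
  H1.map (Int.castAddHom ℂ) fun f x hf =>
    holoSheaf_of_eventuallyConst I (hf.mono fun y hy => by simp only [hy])

/-- The map `i_* : H¹(M, ℝ) → H¹(M, 𝒪)` induced by the inclusion `i : ℝ → 𝒪`. -/
def realToHolo : (constSheaf M ℝ).H1 →+ (holoSheaf I M).H1 :=
  H1.map Complex.ofRealHom.toAddMonoidHom fun f x hf =>
    holoSheaf_of_eventuallyConst I (hf.mono fun y hy => by simp only [hy])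

/-- The group `Pic⁰(M) = H¹(M, 𝒪) / H¹(M, ℤ)`. -/
abbrev Pic0 : Type _ := (holoSheaf I M).H1 ⧸ (intToHolo I M).range

/-- The subgroup `i_* H¹(M, ℝ) / H¹(M, ℤ)` of `H¹(M, 𝒪) / H¹(M, ℤ)`. -/
def realPic0 : AddSubgroup (Pic0 I M) :=
  (realToHolo I M).range.map (QuotientAddGroup.mk' (intToHolo I M).range)

/-- The homomorphism `c ↦ exp (2πic)` from `ℂ` to `ℂ*`. -/
def expHom : ℂ →+ Additive ℂˣ where
  toFun c := Additive.ofMul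
    (Units.mk0 (Complex.exp (2 * Real.pi * Complex.I * c)) (Complex.exp_ne_zero _))
  map_zero' := by
    apply Additive.toMul.injective
    ext
    simp
  map_add' a b := by
    apply Additive.toMul.injective
    ext
    simp [mul_add, Complex.exp_add]

/-- The map `H¹(M, 𝒪) → H¹(M, 𝒪*)` induced by `f ↦ exp (2πif)`. -/
def expH1 : (holoSheaf I M).H1 →+ Pic I M :=
  H1.map expHom fun f x hf => by
    have h : ContDiff ℂ ω fun c : ℂ => Complex.exp (2 * Real.pi * Complex.I * c) :=
      (contDiff_const.mul contDiff_id).cexp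
    exact h.contMDiff.contMDiffAt.comp x hf

/-- The map `Pic⁰(M) = H¹(M, 𝒪) / H¹(M, ℤ) → Pic(M) = H¹(M, 𝒪*)` of the exponential sequence
`0 → ℤ → 𝒪 → 𝒪* → 0`. -/
def Pic0.toPic : Pic0 I M →+ Pic I M :=
  QuotientAddGroup.lift _ (expH1 I M) (by
    rintro _ ⟨c, rfl⟩
    induction c using QuotientAddGroup.induction_on with
    | H f =>
      obtain ⟨f, W, hW, hf, hf'⟩ := f
      refine (QuotientAddGroup.eq_zero_iff _).2 ?_
      refine ⟨W, 0, hW, fun a x _ => (holoUnitsSheaf I M).zero x, fun a b x _ => ?_⟩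
      apply Additive.toMul.injective
      ext
      have := Complex.exp_int_mul_two_pi_mul_I (f a b x)
      simpa [cocyclesMap, expHom, mul_comm, mul_left_comm, mul_assoc] using this)

end Complex

/-! ### Holomorphic vector bundles and their determinants -/

section Det

variable {V : Type*} [NormedAddCommGroup V] [NormedSpace ℂ V] {H : Type*} [TopologicalSpace H]
  (I : ModelWithCorners ℂ V H) {M : Type*} [TopologicalSpace M] [ChartedSpace H M]
  (r : ℕ) (E : M → Type*) [TopologicalSpace (TotalSpace (Fin r → ℂ) E)]
  [∀ p, TopologicalSpace (E p)] [∀ p, AddCommMonoid (E p)] [∀ p, Module ℂ (E p)]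
  [FiberBundle (Fin r → ℂ) E] [VectorBundle ℂ (Fin r → ℂ) E]

/-- The determinants `det (e_a ∘ e_b⁻¹)` of the transition functions of `E`, where `e_a` is the
preferred local trivialization at `a`. -/
def detTransition (a b x : M) : Additive ℂˣ :=
  Additive.ofMul (LinearEquiv.det
    ((trivializationAt (Fin r → ℂ) E b).coordChangeL ℂ
      (trivializationAt (Fin r → ℂ) E a) x).toLinearEquiv)

theorem contDiff_det (r : ℕ) : ContDiff ℂ ω
    (fun L : (Fin r → ℂ) →L[ℂ] (Fin r → ℂ) => LinearMap.det (L : (Fin r → ℂ) →ₗ[ℂ] Fin r → ℂ)) := by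
  have h : (fun L : (Fin r → ℂ) →L[ℂ] (Fin r → ℂ) =>
      LinearMap.det (L : (Fin r → ℂ) →ₗ[ℂ] Fin r → ℂ)) = fun L =>
      ∑ σ : Equiv.Perm (Fin r), ((Equiv.Perm.sign σ : ℤ) : ℂ) *
        ∏ i, L (Pi.single i 1) (σ i) := by
    funext L
    rw [← LinearMap.det_toMatrix', Matrix.det_apply']
    simp [LinearMap.toMatrix'_apply]
  rw [h]
  refine ContDiff.sum fun σ _ => contDiff_const.mul (contDiff_prod fun i _ => ?_)
  exact (contDiff_apply ℂ ℂ (σ i)).comp (contDiff_id.clm_apply contDiff_const)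

variable [ContMDiffVectorBundle ω (Fin r → ℂ) E I]

theorem detTransition_mem : detTransition r E ∈ (holoUnitsSheaf I M).cocycles := by
  refine ⟨fun a => ⟨(trivializationAt (Fin r → ℂ) E a).baseSet,
    (trivializationAt (Fin r → ℂ) E a).open_baseSet⟩,
    fun a => FiberBundle.mem_baseSet_trivializationAt' a, ?_, ?_⟩
  · rintro a b x ⟨ha, hb⟩
    have h := contMDiffAt_coordChangeL (n := ω) (IB := I)
      (e := trivializationAt (Fin r → ℂ) E b) (e' := trivializationAt (Fin r → ℂ) E a) hb ha
    have h2 := (contDiff_det r).contMDiff.contMDiffAt.comp x h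
    refine h2.congr_of_eventuallyEq (Eventually.of_forall fun y => ?_)
    exact LinearEquiv.coe_det _
  · rintro a b c x ⟨⟨ha, hb⟩, hc⟩
    have ha' : x ∈ (trivializationAt (Fin r → ℂ) E a).baseSet := ha
    have hb' : x ∈ (trivializationAt (Fin r → ℂ) E b).baseSet := hb
    have hc' : x ∈ (trivializationAt (Fin r → ℂ) E c).baseSet := hc
    unfold detTransition
    rw [← ofMul_mul, ← map_mul]
    congr 2
    ext1 v
    change (Trivialization.coordChangeL ℂ _ _ x) ((Trivialization.coordChangeL ℂ _ _ x) v) =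
      (Trivialization.coordChangeL ℂ _ _ x) v
    rw [Trivialization.coordChangeL_apply _ _ ⟨hb', ha'⟩,
      Trivialization.coordChangeL_apply _ _ ⟨hc', hb'⟩,
      Trivialization.coordChangeL_apply _ _ ⟨hc', ha'⟩]
    rw [Trivialization.symm_apply_apply_mk]
    exact hb'

/-- The class of the holomorphic line bundle `det E` in `Pic(M) = H¹(M, 𝒪*)`. -/
def detClass : Pic I M := H1.mk _ (detTransition r E) (detTransition_mem I r E)

end Det

/-- Every holomorphic vector bundle (of any finite rank) on the complex manifold `U`, with charts
in `W`, is trivial: it has a global holomorphic frame. -/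
def HolomorphicBundlesTrivial (W : Type*) [NormedAddCommGroup W] [NormedSpace ℂ W]
    (U : Type*) [TopologicalSpace U] [ChartedSpace W U] : Prop :=
  ∀ (k : ℕ) (L : U → Type) [TopologicalSpace (TotalSpace (Fin k → ℂ) L)]
    [∀ u, TopologicalSpace (L u)] [∀ u, AddCommGroup (L u)] [∀ u, Module ℂ (L u)]
    [FiberBundle (Fin k → ℂ) L] [VectorBundle ℂ (Fin k → ℂ) L]
    [ContMDiffVectorBundle ω (Fin k → ℂ) L 𝓘(ℂ, W)],
    ∃ s : Fin k → ∀ u, L u,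
      (∀ i, ContMDiff 𝓘(ℂ, W) (𝓘(ℂ, W).prod 𝓘(ℂ, Fin k → ℂ)) ω
        fun u => TotalSpace.mk' (Fin k → ℂ) u (s i u)) ∧
      ∀ u, LinearIndependent ℂ (fun i => s i u) ∧
        Submodule.span ℂ (range fun i => s i u) = ⊤

/-! ### Hermitian metrics and their Ricci curvature -/

section Metric

variable {V : Type*} [NormedAddCommGroup V] [NormedSpace ℝ V] {H : Type*} [TopologicalSpace H]
  (I : ModelWithCorners ℝ V H) {M : Type*} [TopologicalSpace M] [ChartedSpace H M]
  (r : ℕ) (E : M → Type*) [TopologicalSpace (TotalSpace (Fin r → ℂ) E)]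
  [∀ p, TopologicalSpace (E p)] [∀ p, AddCommMonoid (E p)] [∀ p, Module ℂ (E p)]
  [FiberBundle (Fin r → ℂ) E] [VectorBundle ℂ (Fin r → ℂ) E]

/-- A `C^∞` hermitian metric on the complex vector bundle `E` of rank `r`: a positive definite
hermitian form on every fibre (antilinear in the first variable), whose coefficients in the
local frames of the bundle are `C^∞`. -/
@[ext] structure HermitianMetric where
  form : ∀ p, E p →ₗ⋆[ℂ] E p →ₗ[ℂ] ℂ
  conj_symm : ∀ p v w, form p w v = starRingEnd ℂ (form p v w)
  pos : ∀ p v, v ≠ 0 → 0 < (form p v v).re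
  smooth : ∀ (e : Trivialization (Fin r → ℂ) (π (Fin r → ℂ) E)) [MemTrivializationAtlas e]
    (v w : Fin r → ℂ), ContMDiffOn I 𝓘(ℝ, ℂ) ∞
      (fun p => form p (e.symm p v) (e.symm p w)) e.baseSet

variable {I r E}

/-- Two metrics are conformally equivalent if they differ by a positive `C^∞` function. -/
def Conformal (g h : HermitianMetric I r E) : Prop :=
  ∃ ρ : M → ℝ, ContMDiff I 𝓘(ℝ, ℝ) ∞ ρ ∧ (∀ p, 0 < ρ p) ∧
    ∀ p v w, h.form p v w = (ρ p : ℂ) * g.form p v w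

/-- The determinant of the Gram matrix of the metric `g` at the point `p`, in the local frame
given by the local trivialization `e`. -/
def HermitianMetric.gramDet (g : HermitianMetric I r E)
    (e : Trivialization (Fin r → ℂ) (π (Fin r → ℂ) E)) (p : M) : ℂ :=
  (Matrix.of fun i j : Fin r =>
    g.form p (e.symm p (Pi.single i 1)) (e.symm p (Pi.single j 1))).det

end Metric

section Ddbar

variable {V : Type*} [NormedAddCommGroup V] [NormedSpace ℂ V]

/-- The `(0,1)`-form `∂̄f`, the antilinear part of the differential of `f`, at the point `u`. -/
def dbar (f : V → ℂ) (u v : V) : ℂ :=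
  (fderiv ℝ f u v + Complex.I * fderiv ℝ f u (Complex.I • v)) / 2

/-- The `2`-form `∂∂̄f = d(∂̄f)` at the point `u`, evaluated on the tangent vectors `v`, `w`. -/
def ddbar (f : V → ℂ) (u v w : V) : ℂ :=
  fderiv ℝ (fun y => dbar f y w) u v - fderiv ℝ (fun y => dbar f y v) u w

variable {M : Type*} [TopologicalSpace M] [ChartedSpace V M]

/-- The `2`-form `∂∂̄f` on a complex manifold, at the point `x`, computed in the preferred chart
at `x`, which also identifies the tangent space at `x` with the model space. -/
def mddbar (f : M → ℂ) (x : M) (v w : TangentSpace 𝓘(ℂ, V) x) : ℂ :=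
  ddbar (fun y => f ((chartAt V x).symm y)) (chartAt V x x) v w

variable {r : ℕ} {E : M → Type*} [TopologicalSpace (TotalSpace (Fin r → ℂ) E)]
  [∀ p, TopologicalSpace (E p)] [∀ p, AddCommMonoid (E p)] [∀ p, Module ℂ (E p)]
  [FiberBundle (Fin r → ℂ) E] [VectorBundle ℂ (Fin r → ℂ) E]

/-- The curvature form `Θ = ∂∂̄ log det g` of a metric on a holomorphic vector bundle; at `x`, the
determinant is taken in the preferred local holomorphic frame at `x`. -/
def HermitianMetric.curvature (g : HermitianMetric 𝓘(ℝ, V) r E) (x : M)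
    (v w : TangentSpace 𝓘(ℂ, V) x) : ℂ :=
  mddbar (fun y => ((Real.log (g.gramDet (trivializationAt (Fin r → ℂ) E x) y).re : ℝ) : ℂ)) x v w

end Ddbar

/-! ### Families of bundles over `X × U` -/

section Family

variable {VX : Type*} [NormedAddCommGroup VX] [NormedSpace ℂ VX]
  {VU : Type*} [NormedAddCommGroup VU] [NormedSpace ℂ VU]
  {X : Type*} [TopologicalSpace X] [ChartedSpace VX X]
  {U : Type*} [TopologicalSpace U] [ChartedSpace VU U]

variable (VX VU X) in
/-- The holomorphic inclusion `x ↦ (x, t)` of `X` into `X × U`. -/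
def slice (t : U) :
    ContMDiffMap 𝓘(ℂ, VX) (𝓘(ℂ, VX).prod 𝓘(ℂ, VU)) X (X × U) ω :=
  ⟨fun x => (x, t), contMDiff_id.prodMk contMDiff_const⟩

variable (VX VU) (r : ℕ) (E : X × U → Type*) [TopologicalSpace (TotalSpace (Fin r → ℂ) E)]
  [∀ p, TopologicalSpace (E p)] [∀ p, AddCommGroup (E p)] [∀ p, Module ℂ (E p)]
  [FiberBundle (Fin r → ℂ) E] [VectorBundle ℂ (Fin r → ℂ) E]

/-- The bundle `E_t` on `X`, the restriction of `E` to `X × {t}`. -/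
abbrev Fibre (t : U) : X → Type _ := (slice VX VU X t) *ᵖ E

variable {VX VU r E} in
/-- The restriction of a metric on `E` to `E_t`. -/
def HermitianMetric.restrict
    (g : HermitianMetric (𝓘(ℝ, VX).prod 𝓘(ℝ, VU)) r E) (t : U) :
    HermitianMetric 𝓘(ℝ, VX) r (Fibre VX VU E t) where
  form x := g.form (x, t)
  conj_symm x := g.conj_symm (x, t)
  pos x := g.pos (x, t)
  smooth := by
    rintro _ ⟨e, he, rfl⟩ v w
    have hs : ContMDiff 𝓘(ℝ, VX) (𝓘(ℝ, VX).prod 𝓘(ℝ, VU)) ∞ fun x : X => (x, t) :=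
      contMDiff_id.prodMk contMDiff_const
    refine ((g.smooth e v w).comp (t := e.baseSet) (s := {x | (x, t) ∈ e.baseSet})
      hs.contMDiffOn fun x hx => hx).congr fun x hx => ?_
    have key : ∀ u : Fin r → ℂ, (e.pullback (slice VX VU X t)).symm x u = e.symm (x, t) u := by
      intro u
      have h := (e.pullback (slice VX VU X t)).symm_apply_apply_mk hx (e.symm (x, t) u)
      have h' : ((e.pullback (slice VX VU X t)) ⟨x, e.symm (x, t) u⟩).2 = u :=
        congrArg Prod.snd (e.apply_mk_symm hx u)
      rw [h'] at h
      exact h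
    simp only [key, Function.comp]
    rfl

variable {VX VU r E} in
/-- The metric `g` is Ricci-flat with respect to the central point `o`, i.e. it preserves the
curvature of the central fibre: `Θ^t = Θ^o` for all `t`. -/
def RicciFlat (g : HermitianMetric (𝓘(ℝ, VX).prod 𝓘(ℝ, VU)) r E) (o : U) : Prop :=
  ∀ (t : U) (x : X) (v w : TangentSpace 𝓘(ℂ, VX) x),
    (g.restrict t).curvature x v w = (g.restrict o).curvature x v w

/-- `η : U → Pic⁰(X) = H¹(X, 𝒪) / H¹(X, ℤ)` is the determinant map of the family `E` with the
central point `o`: for all `t`, the class `η t` is that of `det E_t ⊗ (det E_o)^∨`. -/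
def IsDetMap [ContMDiffVectorBundle ω (Fin r → ℂ) E (𝓘(ℂ, VX).prod 𝓘(ℂ, VU))]
    (o : U) (η : U → Pic0 𝓘(ℂ, VX) X) : Prop :=
  ∀ t, Pic0.toPic 𝓘(ℂ, VX) X (η t) =
    detClass 𝓘(ℂ, VX) r (Fibre VX VU E t) - detClass 𝓘(ℂ, VX) r (Fibre VX VU E o)

end Family

end RicciFlatDeformation

end

/-! Call a real function pluriharmonic if it is locally the real part of a holomorphic function.
Changing a holomorphic frame changes the logarithm of the Gram determinant by `2 log |det|` of a
holomorphic transition matrix, which is pluriharmonic. Hence two metrics have equal curvature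
exactly when their log-determinants differ by pluriharmonic functions (`curvature_eq_iff`), and the
problem becomes a family of scalar ones: find `u_t` on `X` with `log det g_t + u_t - log det g_o`
pluriharmonic (`IsFlattening`). The Gram determinants split the absolute value of the transition
cocycle of `det E_t ⊗ (det E_o)^∨`. Comparing imaginary parts of a logarithm of this cocycle shows
that `u_t` exists if and only if `η t` is a real class (`mem_realPic0_iff`). This settles necessity,
and sufficiency on each fibre.

The map `η` exists because, for nearby parameters, the quotient of the determinant cocycles takes
values in the right half plane and so has a logarithm; connectedness of `U` does the rest. It is
unique because the kernel of `H¹(𝒪) → H¹(𝒪*)` is the image of `H¹(ℤ)` (`toPic_injective`).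

The analytic core is to choose `u_t` smoothly in `t`. On the compact `X` a solution is determined
once its value is prescribed at one point of each component. A Harnack inequality for functions with
the mean value property on complex discs, chained along components, bounds solutions by the data
(`exists_estimate`). It makes normalized solutions continuous in `t`. Averaging over a disc in the
parameter gives a solution of the same normalized problem, so the local expressions `R a + u` also
have the mean value property in `t`; continuous functions with this property in both variables are
smooth by convolution (`contDiffOn_of_separately_MVOn`). The condition on `u_t` is affine, so local
solutions are glued by a partition of unity on `U`.

For `r ≠ 0`, multiplication of a metric by `exp (u / r)` multiplies `det g` by `exp u`. Normalizing
`u` to vanish on the central fibre preserves the given metric there. Some extension of that metric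
is also produced by a partition of unity (`exists_metric_restrict_eq`). -/

noncomputable section

namespace RicciFlatDeformation

set_option linter.unusedSectionVars false

/-! ### The mean value property on complex discs. -/

section MeanValue

open MeasureTheory Metric

variable {V : Type*} [NormedAddCommGroup V] [NormedSpace ℂ V]

/-- Continuous functions on `B` with the mean value property on the complex discs in `B`. -/
def MVOn (v : V → ℝ) (B : Set V) : Prop :=
  ContinuousOn v B ∧ ∀ x ξ, (∀ ζ : ℂ, ‖ζ‖ ≤ 1 → x + ζ • ξ ∈ B) →
    Real.circleAverage (fun ζ => v (x + ζ • ξ)) 0 1 = v x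

theorem continuousOn_disc {v : V → ℝ} {B : Set V} (hv : ContinuousOn v B) {x ξ : V}
    (h : ∀ ζ : ℂ, ‖ζ‖ ≤ 1 → x + ζ • ξ ∈ B) :
    ContinuousOn (fun ζ : ℂ => v (x + ζ • ξ)) (closedBall 0 1) :=
  hv.comp (by fun_prop) fun ζ hζ => h ζ (by simpa using hζ)

theorem circleIntegrable_disc {v : V → ℝ} {B : Set V} (hv : ContinuousOn v B) {x ξ : V}
    (h : ∀ ζ : ℂ, ‖ζ‖ ≤ 1 → x + ζ • ξ ∈ B) :
    CircleIntegrable (fun ζ : ℂ => v (x + ζ • ξ)) 0 1 :=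
  ((continuousOn_disc hv h).mono sphere_subset_closedBall).circleIntegrable zero_le_one

theorem MVOn.add {v w : V → ℝ} {B : Set V} (hv : MVOn v B) (hw : MVOn w B) :
    MVOn (fun x => v x + w x) B := by
  refine ⟨hv.1.add hw.1, fun x ξ h => ?_⟩
  have := Real.circleAverage_add (circleIntegrable_disc hv.1 h) (circleIntegrable_disc hw.1 h)
  rw [hv.2 x ξ h, hw.2 x ξ h] at this
  exact this

theorem MVOn.const_mul {v : V → ℝ} {B : Set V} (hv : MVOn v B) (c : ℝ) :
    MVOn (fun x => c * v x) B := by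
  refine ⟨hv.1.const_smul c, fun x ξ h => ?_⟩
  have := Real.circleAverage_smul (a := c) (f := fun ζ : ℂ => v (x + ζ • ξ)) (c := 0) (R := 1)
  rw [hv.2 x ξ h] at this
  exact this

theorem MVOn.neg {v : V → ℝ} {B : Set V} (hv : MVOn v B) : MVOn (fun x => -v x) B := by
  simpa using hv.const_mul (-1)

theorem MVOn.sub {v w : V → ℝ} {B : Set V} (hv : MVOn v B) (hw : MVOn w B) :
    MVOn (fun x => v x - w x) B := by
  simpa [sub_eq_add_neg] using hv.add hw.neg

theorem MVOn.const (c : ℝ) (B : Set V) : MVOn (fun _ : V => c) B :=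
  ⟨continuousOn_const, fun _ _ _ => Real.circleAverage_const c 0 1⟩

theorem MVOn.congr {v w : V → ℝ} {B : Set V} (hv : MVOn v B) (h : EqOn w v B) : MVOn w B := by
  refine ⟨hv.1.congr h, fun x ξ hx => ?_⟩
  rw [h (by simpa using hx 0 (by simp)), ← hv.2 x ξ hx]
  refine Real.circleAverage_congr_sphere fun ζ hζ => h (hx ζ ?_)
  simpa using (by simpa using hζ : ‖ζ‖ = 1).le

theorem MVOn.mono {v : V → ℝ} {B B' : Set V} (hv : MVOn v B) (h : B' ⊆ B) : MVOn v B' :=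
  ⟨hv.1.mono h, fun x ξ hx => hv.2 x ξ fun ζ hζ => h (hx ζ hζ)⟩

/-- A function which is harmonic on all complex lines has the mean value property. -/
theorem MVOn.of_harmonicAt {v : V → ℝ} {B : Set V} (hc : ContinuousOn v B)
    (h : ∀ x ξ : V, ∀ ζ : ℂ, x + ζ • ξ ∈ B →
      InnerProductSpace.HarmonicAt (fun ζ : ℂ => v (x + ζ • ξ)) ζ) : MVOn v B := by
  refine ⟨hc, fun x ξ hx => ?_⟩
  have := InnerProductSpace.HarmonicOnNhd.circleAverage_eq (f := fun ζ : ℂ => v (x + ζ • ξ))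
    (c := 0) (R := 1) fun ζ hζ => h x ξ ζ (hx ζ (by simpa using hζ))
  simpa using this

variable [FiniteDimensional ℂ V] [MeasurableSpace V] [BorelSpace V]
  (μ : Measure V) [μ.IsAddHaarMeasure]

/-- A real linear map scales Haar measure by a constant factor. Multiplication by a complex unit
preserves the unit ball, whose measure is positive and finite, so the factor is one. -/
theorem integral_comp_unit_smul {ζ : ℂ} (hζ : ‖ζ‖ = 1) (f : V → ℝ) :
    ∫ ξ, f (ζ • ξ) ∂μ = ∫ ξ, f ξ ∂μ := by
  have : FiniteDimensional ℝ V := FiniteDimensional.complexToReal V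
  have hζ0 : ζ ≠ 0 := fun h => by simp [h] at hζ
  have hm : MeasurePreserving (fun ξ : V => ζ • ξ) μ μ := by
    refine ⟨(continuous_const_smul ζ).measurable, ?_⟩
    let L : V →ₗ[ℝ] V := LinearMap.restrictScalars ℝ (LinearMap.lsmul ℂ V ζ)
    have hL : LinearMap.det L ≠ 0 := by
      have : IsUnit L.det := by
        refine LinearMap.isUnit_det L ?_
        refine (Module.End.isUnit_iff L).2 ?_
        exact (Homeomorph.smulOfNeZero (α := V) ζ hζ0).bijective
      exact this.ne_zero
    have h1 := Measure.map_linearMap_addHaar_eq_smul_addHaar μ hL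
    have h2 : Measure.map L μ (ball 0 1) = μ (ball 0 1) := by
      rw [Measure.map_apply (by exact (continuous_const_smul ζ).measurable) measurableSet_ball]
      congr 1
      ext ξ
      simp [L, norm_smul, hζ]
    have h3 : Measure.map L μ = μ := by
      rw [h1] at h2 ⊢
      have hb : μ (ball 0 1) ≠ 0 := (measure_ball_pos μ 0 one_pos).ne'
      have hb' : μ (ball 0 1) ≠ ⊤ := measure_ball_lt_top.ne
      have h4 : ENNReal.ofReal |(LinearMap.det L)⁻¹| = 1 := by
        rw [Measure.smul_apply, smul_eq_mul] at h2
        exact (ENNReal.mul_eq_right hb hb').1 h2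
      rw [h4, one_smul]
    exact h3
  exact hm.integral_comp (Homeomorph.smulOfNeZero ζ hζ0).measurableEmbedding f

/-- Rotating `ξ` by a complex unit does not change the integral, so it equals its average over all
rotations. By Fubini the average can be taken first, over the disc through `ξ` centred at `x`, where
it is `v x`. -/
theorem MVOn.integral_mul {v : V → ℝ} {B : Set V} (hv : MVOn v B) (hB : IsOpen B)
    {χ : V → ℝ} (hχ : Continuous χ) (hinv : ∀ (ζ : ℂ) ξ, ‖ζ‖ = 1 → χ (ζ • ξ) = χ ξ)
    {r : ℝ} (hr : ∀ ξ, r ≤ ‖ξ‖ → χ ξ = 0) {x : V} (hx : closedBall x r ⊆ B) :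
    ∫ ξ, χ ξ * v (x + ξ) ∂μ = v x * ∫ ξ, χ ξ ∂μ := by
  have : FiniteDimensional ℝ V := FiniteDimensional.complexToReal V
  have : ProperSpace V := FiniteDimensional.proper ℂ V
  let e : ℝ → ℂ := fun θ => circleMap 0 1 θ
  have he : ∀ θ, ‖e θ‖ = 1 := fun θ => by simp [e]
  have hec : Continuous e := continuous_circleMap 0 1
  let G : ℝ → V → ℝ := fun θ ξ => χ ξ * v (x + e θ • ξ)
  have hmem : ∀ ξ : V, ‖ξ‖ ≤ r → ∀ ζ : ℂ, ‖ζ‖ ≤ 1 → x + ζ • ξ ∈ B := by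
    intro ξ hξ ζ hζ
    apply hx
    rw [mem_closedBall, dist_eq_norm, add_sub_cancel_left, norm_smul]
    exact (mul_le_of_le_one_left (norm_nonneg _) hζ).trans hξ
  -- Nothing is known of `v` outside `B`; continuity there comes from the vanishing of `χ` beyond
  -- radius `r`.
  have hG : Continuous (Function.uncurry G) := by
    rw [continuous_iff_continuousAt]
    rintro ⟨θ, ξ⟩
    rcases le_or_gt ‖ξ‖ r with h | h
    · have h1 : ContinuousAt v (x + e θ • ξ) :=
        hv.1.continuousAt (hB.mem_nhds (hmem ξ h _ (he θ).le))
      have h2 : ContinuousAt (fun p : ℝ × V => x + e p.1 • p.2) (θ, ξ) := by fun_prop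
      exact (hχ.comp continuous_snd).continuousAt.mul
        (ContinuousAt.comp (f := fun p : ℝ × V => x + e p.1 • p.2) h1 h2)
    · have h3 : (fun _ => 0) =ᶠ[𝓝 (θ, ξ)] Function.uncurry G := by
        have : ∀ᶠ p : ℝ × V in 𝓝 (θ, ξ), r < ‖p.2‖ :=
          (continuous_norm.comp continuous_snd).continuousAt.eventually (lt_mem_nhds h)
        filter_upwards [this] with p hp
        simp [Function.uncurry, G, hr p.2 hp.le]
      exact continuousAt_const.congr h3
  have hset : ∀ θ, ∫ ξ in closedBall 0 r, G θ ξ ∂μ = ∫ ξ, G θ ξ ∂μ := fun θ =>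
    setIntegral_eq_integral_of_forall_compl_eq_zero fun ξ hξ => by
      simp [G, hr ξ (not_le.1 (by simpa using hξ)).le]
  have hrot : ∀ θ, ∫ ξ, G θ ξ ∂μ = ∫ ξ, χ ξ * v (x + ξ) ∂μ := fun θ => by
    rw [← integral_comp_unit_smul μ (he θ) (fun ξ => χ ξ * v (x + ξ))]
    simp only [G, hinv _ _ (he θ)]
  have hint : Integrable (Function.uncurry G)
      ((volume.restrict (Ioc 0 (2 * Real.pi))).prod (μ.restrict (closedBall 0 r))) := by
    rw [Measure.prod_restrict]
    refine IntegrableOn.mono_set ?_ (prod_mono_left Ioc_subset_Icc_self)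
    exact hG.continuousOn.integrableOn_compact (isCompact_Icc.prod (isCompact_closedBall 0 r))
  have hswap := integral_integral_swap hint
  simp only [hset, hrot] at hswap
  have hav : ∀ ξ, ∫ θ in Ioc 0 (2 * Real.pi), G θ ξ = 2 * Real.pi * (χ ξ * v x) := by
    intro ξ
    rcases le_or_gt r ‖ξ‖ with h | h
    · simp [G, hr ξ h]
    · have := hv.2 x ξ (hmem ξ h.le)
      rw [Real.circleAverage_def, smul_eq_mul,
        intervalIntegral.integral_of_le Real.two_pi_pos.le] at this
      rw [← this]
      simp only [G, integral_const_mul, e]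
      field_simp
  simp only [hav, integral_const_mul] at hswap
  have h5 : ∫ ξ in closedBall 0 r, χ ξ * v x ∂μ = v x * ∫ ξ, χ ξ ∂μ := by
    rw [setIntegral_eq_integral_of_forall_compl_eq_zero, integral_mul_const, mul_comm]
    intro ξ hξ
    simp [hr ξ (not_le.1 (by simpa using hξ)).le]
  rw [h5] at hswap
  simp only [integral_const, measureReal_restrict_apply_univ, Real.volume_real_Ioc,
    smul_eq_mul, sub_zero, max_eq_left Real.two_pi_pos.le] at hswap
  exact mul_left_cancel₀ Real.two_pi_pos.ne' hswap

end MeanValue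

/-! ### Harnack inequality and smoothness by convolution. -/

section MeanValueRegularity

open MeasureTheory Metric

variable {V : Type*} [NormedAddCommGroup V] [NormedSpace ℂ V] [FiniteDimensional ℂ V]

theorem integrable_mul_of_continuousOn_closedBall [MeasurableSpace V] [BorelSpace V]
    (μ : Measure V) [μ.IsAddHaarMeasure] {v : V → ℝ} {x : V} {r : ℝ}
    (hv : ContinuousOn v (closedBall x r)) {χ : V → ℝ} (hχ : Continuous χ)
    (hr : ∀ ξ, r ≤ ‖ξ‖ → χ ξ = 0) : Integrable (fun ξ => χ ξ * v (x + ξ)) μ := by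
  have : ProperSpace V := FiniteDimensional.proper ℂ V
  rw [← integrableOn_iff_integrable_of_support_subset (s := closedBall 0 r)]
  · refine ContinuousOn.integrableOn_compact (isCompact_closedBall 0 r) ?_
    refine hχ.continuousOn.mul (hv.comp (by fun_prop) fun ξ hξ => ?_)
    simpa [dist_eq_norm] using hξ
  · intro ξ hξ
    by_contra h
    exact hξ (by simp [hr ξ (not_le.1 (by simpa using h)).le])

/-- The Harnack inequality for functions with the mean value property on complex discs. -/
theorem exists_harnack (V : Type*) [NormedAddCommGroup V] [NormedSpace ℂ V]
    [FiniteDimensional ℂ V] {r : ℝ} (hr : 0 < r) :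
    ∃ K : ℝ, 1 ≤ K ∧ ∀ (B : Set V) (v : V → ℝ), IsOpen B → MVOn v B → (∀ x ∈ B, 0 ≤ v x) →
      ∀ x y, closedBall x (3 * r) ⊆ B → dist y x ≤ r → v y ≤ K * v x := by
  let _ : MeasurableSpace V := borel V
  have : BorelSpace V := ⟨rfl⟩
  have : FiniteDimensional ℝ V := FiniteDimensional.complexToReal V
  have : ProperSpace V := FiniteDimensional.proper ℂ V
  let μ : Measure V := Measure.addHaar
  -- A tent supported in radius `r` and a plateau equal to one up to radius `2r` and supported in
  -- radius `3r`. A translate of the tent by at most `r` lies below the plateau, so `v y * ∫ χ ≤ v x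
  -- * ∫ χ'`; the constant is the ratio of the two integrals.
  let χ : V → ℝ := fun ξ => max 0 (1 - ‖ξ‖ / r)
  let χ' : V → ℝ := fun ξ => max 0 (min 1 (3 - ‖ξ‖ / r))
  have hχ : Continuous χ := by fun_prop
  have hχ' : Continuous χ' := by fun_prop
  have hs : ∀ ξ, r ≤ ‖ξ‖ → χ ξ = 0 := fun ξ h => by
    have : 1 ≤ ‖ξ‖ / r := by rwa [one_le_div hr]
    simp [χ, this]
  have hs' : ∀ ξ, 3 * r ≤ ‖ξ‖ → χ' ξ = 0 := fun ξ h => by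
    have : 3 ≤ ‖ξ‖ / r := by rwa [le_div_iff₀ hr]
    simp only [χ']
    rw [max_eq_left]
    exact (min_le_right _ _).trans (by linarith)
  have hle : ∀ ξ η : V, ‖η - ξ‖ ≤ r → χ ξ ≤ χ' η := fun ξ η h => by
    simp only [χ, χ']
    refine max_le_max le_rfl (le_min ?_ ?_)
    · have : 0 ≤ ‖ξ‖ / r := by positivity
      linarith
    · have h1 : ‖η‖ ≤ ‖ξ‖ + r := by
        have := norm_add_le (η - ξ) ξ
        rw [sub_add_cancel] at this
        linarith
      have h2 : ‖η‖ / r ≤ ‖ξ‖ / r + 1 := by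
        rw [div_add_one hr.ne']
        gcongr
      linarith
  have hi : ∀ (ζ : ℂ) ξ, ‖ζ‖ = 1 → χ (ζ • ξ) = χ ξ := fun ζ ξ h => by simp [χ, norm_smul, h]
  have hi' : ∀ (ζ : ℂ) ξ, ‖ζ‖ = 1 → χ' (ζ • ξ) = χ' ξ := fun ζ ξ h => by simp [χ', norm_smul, h]
  have hc : 0 < ∫ ξ, χ ξ ∂μ := by
    refine hχ.integral_pos_of_hasCompactSupport_nonneg_nonzero (x := 0) ?_ ?_ ?_
    · refine HasCompactSupport.intro (isCompact_closedBall (0 : V) r) fun ξ hξ => hs ξ ?_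
      exact (not_le.1 (by simpa using hξ)).le
    · exact fun ξ => le_max_left _ _
    · simp [χ]
  have hcc : ∫ ξ, χ ξ ∂μ ≤ ∫ ξ, χ' ξ ∂μ := by
    have h1 := integrable_mul_of_continuousOn_closedBall μ (v := fun _ => 1) (x := 0) (r := r)
      continuousOn_const hχ hs
    have h2 := integrable_mul_of_continuousOn_closedBall μ (v := fun _ => 1) (x := 0) (r := 3 * r)
      continuousOn_const hχ' hs'
    simp only [mul_one] at h1 h2
    exact integral_mono h1 h2 fun ξ => hle ξ ξ (by simpa using hr.le)
  refine ⟨(∫ ξ, χ' ξ ∂μ) / ∫ ξ, χ ξ ∂μ, (one_le_div hc).2 hcc, ?_⟩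
  intro B v hB hv hpos x y hx hy
  have hyB : closedBall y r ⊆ closedBall x (3 * r) :=
    closedBall_subset_closedBall' (by linarith)
  have e1 := hv.integral_mul μ hB hχ hi hs (hyB.trans hx)
  have e2 := hv.integral_mul μ hB hχ' hi' hs' hx
  have e3 : ∫ ξ, χ ξ * v (y + ξ) ∂μ = ∫ ξ, χ (ξ - (y - x)) * v (x + ξ) ∂μ := by
    rw [← integral_sub_right_eq_self (fun ξ => χ ξ * v (y + ξ)) (y - x)]
    refine integral_congr_ae (Eventually.of_forall fun ξ => ?_)
    simp only
    congr 2
    abel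
  have e4 : ∫ ξ, χ (ξ - (y - x)) * v (x + ξ) ∂μ ≤ ∫ ξ, χ' ξ * v (x + ξ) ∂μ := by
    refine integral_mono_of_nonneg (Eventually.of_forall fun ξ => ?_)
      (integrable_mul_of_continuousOn_closedBall μ (hv.1.mono hx) hχ' hs')
      (Eventually.of_forall fun ξ => ?_)
    · rcases le_or_gt r ‖ξ - (y - x)‖ with h | h
      · simp [hs _ h]
      · refine mul_nonneg (le_max_left _ _) (hpos _ (hx (hyB ?_)))
        rw [mem_closedBall, dist_eq_norm]
        rw [show x + ξ - y = ξ - (y - x) by abel]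
        exact h.le
    · have hle' := hle (ξ - (y - x)) ξ (by rw [sub_sub_cancel, ← dist_eq_norm]; exact hy)
      rcases le_or_gt (3 * r) ‖ξ‖ with h | h
      · have h0 : χ (ξ - (y - x)) = 0 := le_antisymm (hle'.trans (hs' ξ h).le) (le_max_left _ _)
        simp [hs' _ h, h0]
      · refine mul_le_mul_of_nonneg_right hle' (hpos _ (hx ?_))
        simpa [dist_eq_norm] using h.le
  rw [← e3, e1, e2] at e4
  rw [div_mul_eq_mul_div, le_div_iff₀ hc]
  linarith

/-- A smooth bump function which is invariant under multiplication by complex units. -/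
theorem exists_invariant_bump [MeasurableSpace V] [BorelSpace V]
    (μ : Measure V) [μ.IsAddHaarMeasure] {r : ℝ} (hr : 0 < r) :
    ∃ χ : V → ℝ, ContDiff ℝ ∞ χ ∧ (∀ (ζ : ℂ) ξ, ‖ζ‖ = 1 → χ (ζ • ξ) = χ ξ) ∧
      (∀ ξ, r ≤ ‖ξ‖ → χ ξ = 0) ∧ 0 < ∫ ξ, χ ξ ∂μ := by
  have : ProperSpace V := FiniteDimensional.proper ℂ V
  -- The given norm need not be smooth, but the square of a Euclidean norm is, and it is still
  -- invariant under complex units. The constant `K` compares the norms so that the support stays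
  -- within radius `r`.
  let φ : V ≃L[ℂ] EuclideanSpace ℂ (Fin (Module.finrank ℂ V)) :=
    ContinuousLinearEquiv.ofFinrankEq (by simp)
  obtain ⟨K, hK, hφ⟩ : ∃ K > 0, ∀ ξ, ‖ξ‖ ≤ K * ‖φ ξ‖ := by
    obtain ⟨K, hK, h⟩ := (φ.symm : EuclideanSpace ℂ (Fin (Module.finrank ℂ V)) →L[ℂ] V).bound
    exact ⟨K, hK, fun ξ => by simpa using h (φ ξ)⟩
  have hsm : ContDiff ℝ ∞ fun ξ => Real.smoothTransition (1 - (K / r) ^ 2 * ‖φ ξ‖ ^ 2) := by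
    have h1 : ContDiff ℝ ∞ φ := (φ.contDiff (n := ∞)).restrict_scalars ℝ
    exact Real.smoothTransition.contDiff.comp
      (contDiff_const.sub (contDiff_const.mul ((contDiff_norm_sq ℂ).comp h1)))
  have hs : ∀ ξ, r ≤ ‖ξ‖ → Real.smoothTransition (1 - (K / r) ^ 2 * ‖φ ξ‖ ^ 2) = 0 := by
    intro ξ h
    apply Real.smoothTransition.zero_of_nonpos
    have h2 : 1 ≤ K / r * ‖φ ξ‖ := by
      rw [div_mul_eq_mul_div, le_div_iff₀ hr]
      linarith [hφ ξ]
    nlinarith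
  refine ⟨_, hsm, fun ζ ξ h => by simp [norm_smul, h], hs, ?_⟩
  refine hsm.continuous.integral_pos_of_hasCompactSupport_nonneg_nonzero (x := 0) ?_ ?_ ?_
  · refine HasCompactSupport.intro (isCompact_closedBall (0 : V) r) fun ξ hξ => hs ξ ?_
    exact (not_le.1 (by simpa using hξ)).le
  · exact fun ξ => Real.smoothTransition.nonneg _
  · simp

variable {W : Type*} [NormedAddCommGroup W] [NormedSpace ℂ W] [FiniteDimensional ℂ W]

/-- Continuous functions with the mean value property in each of two variables are smooth. -/
theorem contDiffOn_of_separately_MVOn {v : V × W → ℝ} {B : Set V} {N : Set W}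
    (hB : IsOpen B) (hN : IsOpen N) (hc : ContinuousOn v (B ×ˢ N))
    (h1 : ∀ s ∈ N, MVOn (fun x => v (x, s)) B) (h2 : ∀ x ∈ B, MVOn (fun s => v (x, s)) N) :
    ContDiffOn ℝ ∞ v (B ×ˢ N) := by
  let _ : MeasurableSpace V := borel V
  have : BorelSpace V := ⟨rfl⟩
  let _ : MeasurableSpace W := borel W
  have : BorelSpace W := ⟨rfl⟩
  have : FiniteDimensional ℝ V := FiniteDimensional.complexToReal V
  have : FiniteDimensional ℝ W := FiniteDimensional.complexToReal W
  have : ProperSpace V := FiniteDimensional.proper ℂ V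
  have : ProperSpace W := FiniteDimensional.proper ℂ W
  let μ : Measure V := Measure.addHaar
  let ν : Measure W := Measure.addHaar
  rintro ⟨x₀, s₀⟩ ⟨hx₀, hs₀⟩
  refine ContDiffAt.contDiffWithinAt ?_
  obtain ⟨ρ, hρ, hρB, hρN⟩ : ∃ ρ > 0, closedBall x₀ (2 * ρ) ⊆ B ∧ closedBall s₀ (2 * ρ) ⊆ N := by
    obtain ⟨a, ha, ha'⟩ := nhds_basis_closedBall.mem_iff.1 (hB.mem_nhds hx₀)
    obtain ⟨b, hb, hb'⟩ := nhds_basis_closedBall.mem_iff.1 (hN.mem_nhds hs₀)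
    refine ⟨min a b / 2, by positivity, ?_, ?_⟩
    · exact (closedBall_subset_closedBall (by linarith [min_le_left a b])).trans ha'
    · exact (closedBall_subset_closedBall (by linarith [min_le_right a b])).trans hb'
  obtain ⟨χ, hχ, hχi, hχs, hχp⟩ := exists_invariant_bump μ hρ
  obtain ⟨ψ, hψ, hψi, hψs, hψp⟩ := exists_invariant_bump ν hρ
  let k : V × W → ℝ := fun z => χ z.1 * ψ z.2
  have hk : ContDiff ℝ ∞ k := (hχ.comp contDiff_fst).mul (hψ.comp contDiff_snd)
  have hks : HasCompactSupport k := by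
    refine HasCompactSupport.intro
      ((isCompact_closedBall (0 : V) ρ).prod (isCompact_closedBall (0 : W) ρ)) ?_
    rintro ⟨ξ, τ⟩ h
    by_cases hξ : ξ ∈ closedBall 0 ρ
    · have hτ : τ ∉ closedBall 0 ρ := fun h' => h ⟨hξ, h'⟩
      simp [k, hψs τ (not_le.1 (by simpa using hτ)).le]
    · simp [k, hχs ξ (not_le.1 (by simpa using hξ)).le]
  let Q : Set (V × W) := closedBall x₀ (2 * ρ) ×ˢ closedBall s₀ (2 * ρ)
  have hQ : IsCompact Q := (isCompact_closedBall _ _).prod (isCompact_closedBall _ _)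
  -- Truncation makes `v` globally integrable; for `(x, s)` near the centre the kernel only sees
  -- points of `Q`.
  let g : V × W → ℝ := Q.indicator v
  have hg : LocallyIntegrable g (μ.prod ν) := by
    refine Integrable.locallyIntegrable ((integrable_indicator_iff hQ.measurableSet).2 ?_)
    exact (hc.mono (prod_mono hρB hρN)).integrableOn_compact hQ
  have hconv := hks.contDiff_convolution_right (ContinuousLinearMap.mul ℝ ℝ) hg hk
  have hconv2 := hconv.contDiffAt.mul
    (contDiffAt_const (x := (x₀, s₀)) (c := ((∫ ξ, χ ξ ∂μ) * ∫ τ, ψ τ ∂ν)⁻¹))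
  refine hconv2.congr_of_eventuallyEq ?_
  have hnb : ball x₀ ρ ×ˢ ball s₀ ρ ∈ 𝓝 (x₀, s₀) :=
    prod_mem_nhds (ball_mem_nhds _ hρ) (ball_mem_nhds _ hρ)
  filter_upwards [hnb]
  rintro ⟨x, s⟩ ⟨hx, hs⟩
  have hxb : closedBall x ρ ⊆ closedBall x₀ (2 * ρ) :=
    closedBall_subset_closedBall' (by linarith [mem_ball.1 hx])
  have hsb : closedBall s ρ ⊆ closedBall s₀ (2 * ρ) :=
    closedBall_subset_closedBall' (by linarith [mem_ball.1 hs])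
  have hxB : x ∈ B := hρB (hxb (mem_closedBall_self hρ.le))
  -- The kernel is a product of invariant bumps, so Fubini reduces the convolution to the mean value
  -- identity in `s`, then in `x`.
  have key : convolution g k (ContinuousLinearMap.mul ℝ ℝ) (μ.prod ν) (x, s) =
      v (x, s) * ((∫ ξ, χ ξ ∂μ) * ∫ τ, ψ τ ∂ν) := by
    have hneg : ∀ ξ, χ (-ξ) = χ ξ := fun ξ => by simpa using hχi (-1) ξ (by simp)
    have hneg' : ∀ τ, ψ (-τ) = ψ τ := fun τ => by simpa using hψi (-1) τ (by simp)
    rw [convolution_eq_swap]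
    rw [← integral_neg_eq_self]
    have e1 : ∀ z : V × W, (ContinuousLinearMap.mul ℝ ℝ) (g ((x, s) - -z)) (k (-z)) =
        χ z.1 * (ψ z.2 * v (x + z.1, s + z.2)) := by
      rintro ⟨ξ, τ⟩
      simp only [ContinuousLinearMap.mul_apply', k, Prod.fst_neg, Prod.snd_neg, hneg, hneg',
        sub_neg_eq_add, Prod.mk_add_mk]
      rcases le_or_gt ρ ‖ξ‖ with h | h
      · simp [hχs ξ h]
      rcases le_or_gt ρ ‖τ‖ with h' | h'
      · simp [hψs τ h']
      have : (x + ξ, s + τ) ∈ Q :=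
        ⟨hxb (by simpa [dist_eq_norm] using h.le), hsb (by simpa [dist_eq_norm] using h'.le)⟩
      simp only [g, indicator_of_mem this]
      ring
    simp only [e1]
    have hint : Integrable (fun z : V × W => χ z.1 * (ψ z.2 * v (x + z.1, s + z.2)))
        (μ.prod ν) := by
      rw [← integrableOn_iff_integrable_of_support_subset
        (s := closedBall 0 ρ ×ˢ closedBall 0 ρ)]
      · refine ContinuousOn.integrableOn_compact
          ((isCompact_closedBall _ _).prod (isCompact_closedBall _ _)) ?_
        refine (hχ.continuous.comp continuous_fst).continuousOn.mul
          ((hψ.continuous.comp continuous_snd).continuousOn.mul (hc.comp (by fun_prop) ?_))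
        rintro ⟨ξ, τ⟩ ⟨h, h'⟩
        exact ⟨hρB (hxb (by simpa [dist_eq_norm] using h)),
          hρN (hsb (by simpa [dist_eq_norm] using h'))⟩
      · rintro ⟨ξ, τ⟩ h
        by_contra hn
        apply h
        by_cases hξ : ξ ∈ closedBall 0 ρ
        · have hτ : τ ∉ closedBall 0 ρ := fun h' => hn ⟨hξ, h'⟩
          simp [hψs τ (not_le.1 (by simpa using hτ)).le]
        · simp [hχs ξ (not_le.1 (by simpa using hξ)).le]
    rw [integral_prod _ hint]
    have e2 : ∀ ξ, ∫ τ, χ ξ * (ψ τ * v (x + ξ, s + τ)) ∂ν =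
        (χ ξ * v (x + ξ, s)) * ∫ τ, ψ τ ∂ν := by
      intro ξ
      rcases le_or_gt ρ ‖ξ‖ with h | h
      · simp [hχs ξ h]
      have hξB : x + ξ ∈ B := hρB (hxb (by simpa [dist_eq_norm] using h.le))
      rw [integral_const_mul, (h2 _ hξB).integral_mul ν hN hψ.continuous hψi hψs (hsb.trans hρN),
        mul_assoc]
    simp only [e2, integral_mul_const]
    rw [(h1 s (hρN (hsb (mem_closedBall_self hρ.le)))).integral_mul μ hB hχ.continuous hχi hχs
      (hxb.trans hρB), mul_assoc]
  rw [key, mul_inv_cancel_right₀ (mul_pos hχp hψp).ne']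

end MeanValueRegularity

/-! ### Analyticity of continuously differentiable functions of several complex variables. -/

section Osgood

open MeasureTheory Metric

universe v

/-- Pointwise application of a bilinear map to a function with values in the first factor. -/
def mapBilin (P : Type*) [TopologicalSpace P] [CompactSpace P] {A E F : Type*}
    [NormedAddCommGroup A] [NormedSpace ℂ A]
    [NormedAddCommGroup E] [NormedSpace ℂ E] [NormedAddCommGroup F] [NormedSpace ℂ F]
    (B : A →L[ℂ] E →L[ℂ] F) : C(P, A) →L[ℂ] E →L[ℂ] C(P, F) :=
  LinearMap.mkContinuous₂
    (LinearMap.mk₂ ℂ (fun (T : C(P, A)) (v : E) => (⟨fun p => B (T p) v, by fun_prop⟩ : C(P, F)))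
      (fun _ _ _ => by ext; simp) (fun _ _ _ => by ext; simp)
      (fun _ _ _ => by ext; simp) (fun _ _ _ => by ext; simp)) ‖B‖ fun T v => by
    rw [ContinuousMap.norm_le _ (by positivity)]
    intro p
    exact (B.le_opNorm₂ (T p) v).trans (by gcongr; exact T.norm_coe_le_norm p)

/-- The pointwise evaluation of a family of linear maps, as a linear map into the functions. -/
def flipCurry (P : Type*) [TopologicalSpace P] [CompactSpace P] (E F : Type*)
    [NormedAddCommGroup E] [NormedSpace ℂ E] [NormedAddCommGroup F] [NormedSpace ℂ F] :
    C(P, E →L[ℂ] F) →L[ℂ] E →L[ℂ] C(P, F) :=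
  mapBilin P (ContinuousLinearMap.id ℂ (E →L[ℂ] F))

@[simp] theorem flipCurry_apply {P : Type*} [TopologicalSpace P] [CompactSpace P] {E F : Type*}
    [NormedAddCommGroup E] [NormedSpace ℂ E] [NormedAddCommGroup F] [NormedSpace ℂ F]
    (T : C(P, E →L[ℂ] F)) (v : E) (p : P) : flipCurry P E F T v p = T p v := rfl

/-- Pointwise multiplication of functions on a compact space. -/
def smulCurry (P : Type*) [TopologicalSpace P] [CompactSpace P] (F : Type*)
    [NormedAddCommGroup F] [NormedSpace ℂ F] : C(P, ℂ) →L[ℂ] C(P, F) →L[ℂ] C(P, F) :=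
  LinearMap.mkContinuous₂
    (LinearMap.mk₂ ℂ (fun (T : C(P, ℂ)) (v : C(P, F)) => (⟨fun p => T p • v p, by fun_prop⟩ : C(P, F)))
      (fun _ _ _ => by ext; simp [add_smul]) (fun _ _ _ => by ext; simp [mul_smul])
      (fun _ _ _ => by ext; simp) (fun c _ _ => by ext; simp [smul_comm c])) 1 fun T v => by
    rw [one_mul, ContinuousMap.norm_le _ (by positivity)]
    intro p
    refine (norm_smul_le _ _).trans ?_
    exact mul_le_mul (T.norm_coe_le_norm p) (v.norm_coe_le_norm p) (by positivity) (by positivity)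

@[simp] theorem smulCurry_apply {P : Type*} [TopologicalSpace P] [CompactSpace P] {F : Type*}
    [NormedAddCommGroup F] [NormedSpace ℂ F]
    (T : C(P, ℂ)) (v : C(P, F)) (p : P) : smulCurry P F T v p = T p • v p := rfl

-- Continuity of `T` is in the supremum norm, so the mean value inequality bounds the remainder
-- uniformly in `p`, which is differentiability in `C(P, F)`.
set_option synthInstance.maxHeartbeats 200000 in
theorem hasFDerivAt_curry {P : Type*} [TopologicalSpace P] [CompactSpace P] {E F : Type*}
    [NormedAddCommGroup E] [NormedSpace ℂ E] [NormedAddCommGroup F] [NormedSpace ℂ F]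
    {G : E → C(P, F)} {T : E → C(P, E →L[ℂ] F)} {s : Set E} (hs : IsOpen s)
    (hT : ContinuousOn T s) (hG : ∀ x ∈ s, ∀ p, HasFDerivAt (fun x => G x p) (T x p) x)
    {x : E} (hx : x ∈ s) : HasFDerivAt G (flipCurry P E F (T x)) x := by
  rw [hasFDerivAt_iff_isLittleO, Asymptotics.isLittleO_iff]
  intro ε hε
  have h1 : ∀ᶠ y in 𝓝 x, y ∈ s ∧ ‖T y - T x‖ ≤ ε := by
    refine Filter.Eventually.and (hs.mem_nhds hx) ?_
    have := (hT.continuousAt (hs.mem_nhds hx)).eventually_mem (closedBall_mem_nhds (T x) hε)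
    filter_upwards [this] with y hy
    exact (dist_eq_norm (T y) (T x)).symm.trans_le hy
  obtain ⟨δ, hδ, hδ'⟩ := Metric.eventually_nhds_iff_ball.1 h1
  filter_upwards [ball_mem_nhds x hδ] with y hy
  rw [ContinuousMap.norm_le _ (by positivity)]
  intro p
  have := (convex_ball x δ).norm_image_sub_le_of_norm_hasFDerivWithin_le' (𝕜 := ℂ)
    (f := fun x => G x p) (f' := fun y => T y p) (φ := T x p) (C := ε)
    (fun z hz => (hG z (hδ' z hz).1 p).hasFDerivWithinAt)
    (fun z hz => ((T z - T x).norm_coe_le_norm p).trans (hδ' z hz).2) (mem_ball_self hδ) hy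
  exact this

/-- Continuously differentiable functions of several complex variables are analytic. -/
def AnalyticOfC1 (E : Type*) [NormedAddCommGroup E] [NormedSpace ℂ E] : Prop :=
  ∀ (F : Type v) [NormedAddCommGroup F] [NormedSpace ℂ F] [CompleteSpace F] (f : E → F) (s : Set E),
    IsOpen s → ContDiffOn ℂ 1 f s → ∀ x ∈ s, AnalyticAt ℂ f x

/-- Cauchy's formula in the first variable writes `f (z, x)` as a continuous linear functional of
the product of the kernel `c z` and the function `G x = f (·, x)` on a circle. The hypothesis on
`E`, applied with values in the Banach space `C(P, F)`, makes `G` analytic; this is why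
`AnalyticOfC1` quantifies over all complete target spaces. -/
theorem AnalyticOfC1.prod {E : Type*} [NormedAddCommGroup E] [NormedSpace ℂ E]
    (hE : AnalyticOfC1.{v} E) : AnalyticOfC1.{v} (ℂ × E) := by
  intro F _ _ _ f s hs hf ⟨z₀, x₀⟩ hx
  obtain ⟨R, hR, hRs⟩ := nhds_basis_closedBall.mem_iff.1 (hs.mem_nhds hx)
  rw [← closedBall_prod_same] at hRs
  have hfd : ∀ p ∈ s, DifferentiableAt ℂ f p := fun p hp =>
    (hf.differentiableOn one_ne_zero).differentiableAt (hs.mem_nhds hp)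
  have hfc : ContinuousOn (fderiv ℂ f) s := hf.continuousOn_fderiv_of_isOpen hs le_rfl
  let P := sphere z₀ R
  have hmem : ∀ (p : P) (x : E), x ∈ ball x₀ R → ((p : ℂ), x) ∈ s := fun p x hx =>
    hRs ⟨sphere_subset_closedBall p.2, ball_subset_closedBall hx⟩
  let f' : ball x₀ R × P → F := fun q => f (q.2, q.1)
  have hf' : Continuous f' := by
    have := hf.continuousOn.comp_continuous (f := fun q : ball x₀ R × P => ((q.2 : ℂ), (q.1 : E)))
      (by fun_prop) fun q => hmem _ _ q.1.2
    exact this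
  let D' : ball x₀ R × P → E →L[ℂ] F := fun q =>
    (fderiv ℂ f (q.2, q.1)).comp (ContinuousLinearMap.inr ℂ ℂ E)
  have hD' : Continuous D' := by
    have := hfc.comp_continuous (f := fun q : ball x₀ R × P => ((q.2 : ℂ), (q.1 : E)))
      (by fun_prop) fun q => hmem _ _ q.1.2
    exact this.clm_comp continuous_const
  classical
  let G : E → C(P, F) := fun x => if h : x ∈ ball x₀ R then
    (ContinuousMap.curry ⟨f', hf'⟩) ⟨x, h⟩ else 0
  let T : E → C(P, E →L[ℂ] F) := fun x => if h : x ∈ ball x₀ R then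
    (ContinuousMap.curry ⟨D', hD'⟩) ⟨x, h⟩ else 0
  have hG : ∀ x ∈ ball x₀ R, ∀ p, G x p = f (p, x) := fun x hx p => by
    simp [G, f', mem_ball.1 hx]
  have hT : ∀ x ∈ ball x₀ R, ∀ p : P, T x p =
      (fderiv ℂ f (p, x)).comp (ContinuousLinearMap.inr ℂ ℂ E) := fun x hx p => by
    simp [T, D', mem_ball.1 hx]
  have hTc : ContinuousOn T (ball x₀ R) := by
    rw [continuousOn_iff_continuous_domRestrict]
    refine (ContinuousMap.curry ⟨D', hD'⟩).continuous.congr fun x => ?_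
    simp [T, mem_ball.1 x.2]
  have hGd : ∀ x ∈ ball x₀ R, HasFDerivAt G (flipCurry P E F (T x)) x := fun x hx => by
    refine hasFDerivAt_curry isOpen_ball hTc (fun y hy p => ?_) hx
    have h1 : HasFDerivAt (fun y : E => ((p : ℂ), y)) (ContinuousLinearMap.inr ℂ ℂ E) y :=
      hasFDerivAt_prodMk_right _ _
    have h2 := (hfd _ (hmem p y hy)).hasFDerivAt.comp y h1
    rw [hT y hy]
    refine h2.congr_of_eventuallyEq ?_
    filter_upwards [isOpen_ball.mem_nhds hy] with z hz
    exact hG z hz p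
  have hG1 : ContDiffOn ℂ 1 G (ball x₀ R) := by
    rw [show (1 : ℕ∞ω) = 0 + 1 from (zero_add 1).symm,
      contDiffOn_succ_iff_fderiv_of_isOpen isOpen_ball]
    refine ⟨fun x hx => (hGd x hx).differentiableAt.differentiableWithinAt, by simp, ?_⟩
    rw [contDiffOn_zero]
    exact ((flipCurry P E F).continuous.comp_continuousOn hTc).congr
      fun x hx => (hGd x hx).fderiv
  have hGa : AnalyticAt ℂ G x₀ := hE C(P, F) G _ isOpen_ball hG1 x₀ (mem_ball_self hR)
  let ι : C(P, ℂ) := ⟨fun p => p, continuous_subtype_val⟩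
  -- As an inverse in the Banach algebra `C(P, ℂ)`, the Cauchy kernel is analytic in `z` because
  -- inversion is analytic at units.
  let c : ℂ → C(P, ℂ) := fun z => Ring.inverse (ι - z • (1 : C(P, ℂ)))
  have hne : ∀ z ∈ ball z₀ R, ∀ p : P, (p : ℂ) - z ≠ 0 := fun z hz p h => by
    have := p.2
    rw [sub_eq_zero.1 h] at this
    exact (mem_ball.1 hz).ne (mem_sphere.1 this)
  have hcu : ∀ z (hz : z ∈ ball z₀ R), ∃ u : C(P, ℂ)ˣ, (u : C(P, ℂ)) = ι - z • 1 ∧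
      ∀ p, (↑u⁻¹ : C(P, ℂ)) p = ((p : ℂ) - z)⁻¹ := fun z hz => by
    refine ⟨⟨ι - z • 1, ⟨fun p => ((p : ℂ) - z)⁻¹,
      (continuous_subtype_val.sub continuous_const).inv₀ (hne z hz)⟩, ?_, ?_⟩, rfl, fun p => rfl⟩
    · ext p
      simpa [ι] using mul_inv_cancel₀ (hne z hz p)
    · ext p
      simpa [ι] using inv_mul_cancel₀ (hne z hz p)
  have hc : ∀ z ∈ ball z₀ R, ∀ p, c z p = ((p : ℂ) - z)⁻¹ := fun z hz p => by
    obtain ⟨u, hu, hu'⟩ := hcu z hz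
    simp only [c]
    rw [← hu, Ring.inverse_unit, hu']
  have hca : AnalyticAt ℂ c z₀ := by
    obtain ⟨u, hu, -⟩ := hcu z₀ (mem_ball_self hR)
    have h1 : AnalyticAt ℂ (fun z : ℂ => ι - z • (1 : C(P, ℂ))) z₀ :=
      analyticAt_const.sub (analyticAt_id.smul analyticAt_const)
    have h2 : AnalyticAt ℂ Ring.inverse (ι - z₀ • (1 : C(P, ℂ))) := by
      rw [← hu]
      exact analyticAt_inverse u
    exact h2.comp (g := Ring.inverse) (f := fun z : ℂ => ι - z • (1 : C(P, ℂ))) h1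
  let p : ℝ → P := fun θ => ⟨circleMap z₀ R θ, circleMap_mem_sphere z₀ hR.le θ⟩
  have hp : Continuous p := (continuous_circleMap z₀ R).subtype_mk _
  have hd : Continuous (deriv (circleMap z₀ R)) := by
    rw [show deriv (circleMap z₀ R) = fun θ => circleMap 0 R θ * Complex.I from
      funext fun θ => deriv_circleMap _ _ θ]
    fun_prop
  let L : C(P, F) →L[ℂ] F := LinearMap.mkContinuous
    { toFun := fun g => ∫ θ in 0..2 * Real.pi, deriv (circleMap z₀ R) θ • g (p θ)
      map_add' := fun g h => by
        simp only [ContinuousMap.add_apply, smul_add]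
        exact intervalIntegral.integral_add
          ((hd.smul (g.continuous.comp hp)).intervalIntegrable _ _)
          ((hd.smul (h.continuous.comp hp)).intervalIntegrable _ _)
      map_smul' := fun a g => by
        simp only [ContinuousMap.smul_apply, RingHom.id_apply]
        rw [← intervalIntegral.integral_smul]
        simp only [smul_comm a] } (R * |2 * Real.pi - 0|) fun g => by
      rw [mul_right_comm]
      refine intervalIntegral.norm_integral_le_of_norm_le_const fun θ _ => ?_
      rw [norm_smul]
      refine mul_le_mul (by simp [abs_of_pos hR]) (g.norm_coe_le_norm _) (by positivity) hR.le
  have hB : AnalyticAt ℂ (fun q : ℂ × E => (2 * Real.pi * Complex.I : ℂ)⁻¹ •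
      L (smulCurry P F (c q.1) (G q.2))) (z₀, x₀) := by
    have h1 : AnalyticAt ℂ (fun q : ℂ × E => (c q.1, G q.2)) (z₀, x₀) := by
      refine AnalyticAt.prod ?_ ?_
      · exact AnalyticAt.comp (g := c) (f := fun q : ℂ × E => q.1) hca analyticAt_fst
      · exact AnalyticAt.comp (g := G) (f := fun q : ℂ × E => q.2) hGa analyticAt_snd
    have h2 := ((smulCurry P F).analyticAt_bilinear (c z₀, G x₀)).comp
      (f := fun q : ℂ × E => (c q.1, G q.2)) h1
    exact analyticAt_const.smul ((L.analyticAt _).comp h2)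
  refine hB.congr ?_
  filter_upwards [prod_mem_nhds (ball_mem_nhds z₀ hR) (ball_mem_nhds x₀ hR)]
  rintro ⟨z, x⟩ ⟨hz, hx⟩
  have h1 : DifferentiableOn ℂ (fun ζ => f (ζ, x)) (closedBall z₀ R) := fun ζ hζ => by
    refine DifferentiableAt.differentiableWithinAt ?_
    exact DifferentiableAt.comp (g := f) (f := fun ζ : ℂ => (ζ, x)) ζ
      (hfd _ (hRs ⟨hζ, ball_subset_closedBall hx⟩)) (by fun_prop)
  have h2 := h1.circleIntegral_sub_inv_smul hz
  have h3 : L (smulCurry P F (c z) (G x)) = (2 * Real.pi * Complex.I : ℂ) • f (z, x) := by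
    rw [← h2]
    change ∫ θ in 0..2 * Real.pi, deriv (circleMap z₀ R) θ • (c z (p θ) • G x (p θ)) = _
    simp only [hc z hz, hG x hx]
    rfl
  simp only [h3]
  rw [inv_smul_smul₀ (by simp [Real.pi_ne_zero])]

theorem AnalyticOfC1.of_equiv {E E' : Type*} [NormedAddCommGroup E] [NormedSpace ℂ E]
    [NormedAddCommGroup E'] [NormedSpace ℂ E'] (φ : E' ≃L[ℂ] E) (hE : AnalyticOfC1.{v} E) :
    AnalyticOfC1.{v} E' := by
  intro F _ _ _ f s hs hf x hx
  have h1 := hE F (f ∘ φ.symm) (φ.symm ⁻¹' s) (hs.preimage φ.symm.continuous)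
    (hf.comp φ.symm.contDiff.contDiffOn fun y hy => hy) (φ x) (by simpa using hx)
  have h2 := h1.comp ((φ : E' →L[ℂ] E).analyticAt x)
  refine h2.congr (Eventually.of_forall fun y => ?_)
  simp

theorem analyticOfC1_fin (n : ℕ) : AnalyticOfC1.{v} (Fin n → ℂ) := by
  induction n with
  | zero =>
    intro F _ _ _ f s _ _ x _
    have : f = fun _ => f x := by
      funext y
      rw [Subsingleton.elim y x]
    rw [this]
    exact analyticAt_const
  | succ n ih =>
    exact ih.prod.of_equiv (Fin.consEquivL ℂ fun _ : Fin (n + 1) => ℂ).symm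

/-- **Osgood's lemma**: continuously differentiable functions are analytic. -/
theorem analyticAt_of_contDiffOn_one {E : Type*} [NormedAddCommGroup E] [NormedSpace ℂ E]
    [FiniteDimensional ℂ E] {f : E → ℂ} {s : Set E} (hs : IsOpen s) (hf : ContDiffOn ℂ 1 f s)
    {x : E} (hx : x ∈ s) : AnalyticAt ℂ f x :=
  (analyticOfC1_fin (Module.finrank ℂ E)).of_equiv
    (ContinuousLinearEquiv.ofFinrankEq (by simp)) ℂ f s hs hf x hx

end Osgood

/-! ### The operator `∂∂̄` on vector spaces and its real solutions. -/

section DdbarCalculus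

open Metric Complex

variable {V : Type*} [NormedAddCommGroup V] [NormedSpace ℂ V]
  {V' : Type*} [NormedAddCommGroup V'] [NormedSpace ℂ V']

/-- The terms of `d(∂̄f)` without a factor `I` cancel by symmetry of the second derivative. -/
theorem ddbar_eq {f : V → ℂ} {u : V} (hf : ContDiffAt ℝ 2 f u) (v w : V) :
    ddbar f u v w = I / 2 * (fderiv ℝ (fderiv ℝ f) u v (I • w) -
      fderiv ℝ (fderiv ℝ f) u w (I • v)) := by
  have hd : HasFDerivAt (fderiv ℝ f) (fderiv ℝ (fderiv ℝ f) u) u :=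
    ((hf.fderiv_right (m := 1) (by norm_num)).differentiableAt one_ne_zero).hasFDerivAt
  have hsym : IsSymmSndFDerivAt ℝ f u := hf.isSymmSndFDerivAt (by simp)
  have key : ∀ a b : V, fderiv ℝ (fun y => dbar f y b) u a =
      (fderiv ℝ (fderiv ℝ f) u a b + I * fderiv ℝ (fderiv ℝ f) u a (I • b)) / 2 := by
    intro a b
    have h1 : ∀ c : V, HasFDerivAt (fun y => fderiv ℝ f y c)
        ((fderiv ℝ (fderiv ℝ f) u).flip c) u := fun c => by
      simpa using! hd.clm_apply (hasFDerivAt_const c u)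
    have h2 := ((h1 b).add ((h1 (I • b)).const_mul I)).mul_const (2 : ℂ)⁻¹
    have h3 : (fun y => dbar f y b) =
        fun y => (fderiv ℝ f y b + I * fderiv ℝ f y (I • b)) * (2 : ℂ)⁻¹ := by
      funext y
      rw [dbar, div_eq_mul_inv]
    rw [h3]
    refine (congrArg (fun L => L a) h2.fderiv).trans ?_
    simp [div_eq_mul_inv]
    ring
  rw [ddbar, key, key, hsym v w]
  ring

theorem ddbar_congr {f g : V → ℂ} {u : V} (h : f =ᶠ[𝓝 u] g) (v w : V) :
    ddbar f u v w = ddbar g u v w := by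
  have h1 : ∀ b : V, (fun y => dbar f y b) =ᶠ[𝓝 u] fun y => dbar g y b := fun b => by
    filter_upwards [h.fderiv (𝕜 := ℝ)] with y hy
    simp [dbar, hy]
  rw [ddbar, ddbar, (h1 v).fderiv_eq, (h1 w).fderiv_eq]

theorem ddbar_add {f g : V → ℂ} {u : V} (hf : ContDiffAt ℝ 2 f u) (hg : ContDiffAt ℝ 2 g u)
    (v w : V) : ddbar (fun y => f y + g y) u v w = ddbar f u v w + ddbar g u v w := by
  rw [ddbar_eq (hf.add hg), ddbar_eq hf, ddbar_eq hg]
  have h0 : fderiv ℝ (fun y => f y + g y) =ᶠ[𝓝 u] fun y => fderiv ℝ f y + fderiv ℝ g y := by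
    filter_upwards [hf.eventually (by simp), hg.eventually (by simp)] with y h1 h2
    exact fderiv_add (h1.differentiableAt two_ne_zero) (h2.differentiableAt two_ne_zero)
  have hd : ∀ {k : V → ℂ}, ContDiffAt ℝ 2 k u → DifferentiableAt ℝ (fderiv ℝ k) u := fun hk =>
    (hk.fderiv_right (m := 1) (by norm_num)).differentiableAt one_ne_zero
  rw [h0.fderiv_eq, fderiv_fun_add (hd hf) (hd hg)]
  simp only [add_apply]
  ring

/-- For holomorphic `h`, the form `∂̄ (Re h)` is half the conjugate of `dh`, which is closed. -/
theorem ddbar_re {h : V → ℂ} {u : V} (hh : ContDiffAt ℂ 2 h u) (v w : V) :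
    ddbar (fun y => ((h y).re : ℂ)) u v w = 0 := by
  have hd : DifferentiableAt ℝ (fderiv ℂ h) u :=
    ((hh.fderiv_right (m := 1) (by norm_num)).differentiableAt one_ne_zero).restrictScalars ℝ
  have hsym : IsSymmSndFDerivAt ℂ h u := hh.isSymmSndFDerivAt (by simp)
  have hsd : fderiv ℝ (fderiv ℂ h) u = (fderiv ℂ (fderiv ℂ h) u).restrictScalars ℝ :=
    ((hh.fderiv_right (m := 1) (by norm_num)).differentiableAt
      one_ne_zero).fderiv_restrictScalars ℝ
  have key : ∀ b : V, (fun y => dbar (fun y => ((h y).re : ℂ)) y b) =ᶠ[𝓝 u]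
      fun y => (starRingEnd ℂ) (fderiv ℂ h y b) * (2 : ℂ)⁻¹ := fun b => by
    filter_upwards [hh.eventually (by simp)] with y hy
    have h1 : HasFDerivAt h ((fderiv ℂ h y).restrictScalars ℝ) y :=
      (hy.differentiableAt two_ne_zero).hasFDerivAt.restrictScalars ℝ
    have h2 : HasFDerivAt (fun y => ((h y).re : ℂ))
        ((ofRealCLM.comp reCLM).comp ((fderiv ℂ h y).restrictScalars ℝ)) y :=
      (ofRealCLM.comp reCLM).hasFDerivAt.comp y h1
    rw [dbar, h2.fderiv, div_eq_mul_inv]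
    congr 1
    apply Complex.ext <;> simp
  have key2 : ∀ a b : V, fderiv ℝ (fun y => dbar (fun y => ((h y).re : ℂ)) y b) u a =
      (starRingEnd ℂ) (fderiv ℂ (fderiv ℂ h) u a b) * (2 : ℂ)⁻¹ := fun a b => by
    rw [(key b).fderiv_eq]
    have h1 : HasFDerivAt (fun y => fderiv ℂ h y b)
        (((ContinuousLinearMap.apply ℂ ℂ b).restrictScalars ℝ).comp (fderiv ℝ (fderiv ℂ h) u)) u :=
      ((ContinuousLinearMap.apply ℂ ℂ b).restrictScalars ℝ).hasFDerivAt.comp u hd.hasFDerivAt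
    have h2 : HasFDerivAt (fun y => (starRingEnd ℂ) (fderiv ℂ h y b)) _ u :=
      (conjCLE : ℂ →L[ℝ] ℂ).hasFDerivAt.comp u h1
    rw [(h2.mul_const (2 : ℂ)⁻¹).fderiv, hsd]
    simp
    ring
  rw [ddbar, key2, key2, hsym v w, sub_self]

/-- Holomorphic pull-backs preserve the solutions of `∂∂̄f = 0`. -/
theorem ddbar_comp_eq_zero {ψ : V → V'} {u : V} (hψ : ContDiffAt ℂ 2 ψ u) {f : V' → ℂ}
    (hf : ContDiffAt ℝ 2 f (ψ u)) (h0 : ∀ v w, ddbar f (ψ u) v w = 0) (v w : V) :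
    ddbar (fun y => f (ψ y)) u v w = 0 := by
  have hψr : ContDiffAt ℝ 2 ψ u := hψ.restrict_scalars ℝ
  rw [ddbar_eq (show ContDiffAt ℝ 2 (fun y => f (ψ y)) u from ContDiffAt.comp u hf hψr)]
  have hsym : IsSymmSndFDerivAt ℂ ψ u := hψ.isSymmSndFDerivAt (by simp)
  have hdf : HasFDerivAt (fderiv ℝ f) (fderiv ℝ (fderiv ℝ f) (ψ u)) (ψ u) :=
    ((hf.fderiv_right (m := 1) (by norm_num)).differentiableAt one_ne_zero).hasFDerivAt
  have hψ1 : HasFDerivAt ψ ((fderiv ℂ ψ u).restrictScalars ℝ) u :=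
    (hψ.differentiableAt two_ne_zero).hasFDerivAt.restrictScalars ℝ
  have hψ2 : HasFDerivAt (fderiv ℂ ψ) ((fderiv ℂ (fderiv ℂ ψ) u).restrictScalars ℝ) u :=
    ((hψ.fderiv_right (m := 1) (by norm_num)).differentiableAt
      one_ne_zero).hasFDerivAt.restrictScalars ℝ
  have h1 : fderiv ℝ (fun y => f (ψ y)) =ᶠ[𝓝 u]
      fun y => (fderiv ℝ f (ψ y)).comp ((fderiv ℂ ψ y).restrictScalars ℝ) := by
    filter_upwards [hψ.eventually (by simp),
      hψr.continuousAt.eventually (hf.eventually (by simp))] with y hy hy'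
    exact ((hy'.differentiableAt two_ne_zero).hasFDerivAt.comp y
      ((hy.differentiableAt two_ne_zero).hasFDerivAt.restrictScalars ℝ)).fderiv
  have key : ∀ a b : V, fderiv ℝ (fderiv ℝ (fun y => f (ψ y))) u a b =
      fderiv ℝ (fderiv ℝ f) (ψ u) (fderiv ℂ ψ u a) (fderiv ℂ ψ u b) +
        fderiv ℝ f (ψ u) (fderiv ℂ (fderiv ℂ ψ) u a b) := fun a b => by
    have h2 : fderiv ℝ (fderiv ℝ (fun y => f (ψ y))) u a b =
        fderiv ℝ (fun y => fderiv ℝ (fun y => f (ψ y)) y b) u a := by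
      have hd : HasFDerivAt (fderiv ℝ (fun y => f (ψ y))) _ u :=
        (((ContDiffAt.comp u hf hψr).fderiv_right (m := 1) (by norm_num)).differentiableAt
          one_ne_zero).hasFDerivAt
      rw [(hd.clm_apply (hasFDerivAt_const b u)).fderiv]
      simp
      rfl
    rw [h2]
    have h3 : (fun y => fderiv ℝ (fun y => f (ψ y)) y b) =ᶠ[𝓝 u]
        fun y => fderiv ℝ f (ψ y) (fderiv ℂ ψ y b) := by
      filter_upwards [h1] with y hy
      rw [hy]
      rfl
    have h4 : HasFDerivAt (fun y => fderiv ℂ ψ y b)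
        (((ContinuousLinearMap.apply ℂ V' b).restrictScalars ℝ).comp
          ((fderiv ℂ (fderiv ℂ ψ) u).restrictScalars ℝ)) u :=
      ((ContinuousLinearMap.apply ℂ V' b).restrictScalars ℝ).hasFDerivAt.comp u hψ2
    have h5 := (hdf.comp u hψ1).clm_apply h4
    rw [h3.fderiv_eq]
    have h6 := h5.fderiv
    simp only [Function.comp_apply] at h6
    rw [h6]
    simp [add_comm]
  have h0' := h0 (fderiv ℂ ψ u v) (fderiv ℂ ψ u w)
  rw [ddbar_eq hf] at h0'
  rw [← h0', key, key]
  -- The terms with the second derivative of `ψ` cancel: it is complex bilinear and symmetric, so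
  -- moving `I` between its two arguments has no effect.
  simp only [map_smul]
  rw [hsym v w]
  ring

/-- A real function with `∂∂̄f = 0` on a convex open set is the real part of a holomorphic
function. -/
theorem exists_holomorphic_of_ddbar_eq_zero [FiniteDimensional ℂ V] {f : V → ℝ} {B : Set V}
    (hB : IsOpen B) (hBc : Convex ℝ B) (hf : ContDiffOn ℝ 2 f B)
    (h0 : ∀ u ∈ B, ∀ v w, ddbar (fun y => (f y : ℂ)) u v w = 0) :
    ∃ h : V → ℂ, AnalyticOnNhd ℂ h B ∧ ∀ x ∈ B, (h x).re = f x := by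
  have : FiniteDimensional ℝ V := FiniteDimensional.complexToReal V
  -- The complex linear functional with real part `l` is `l x - I * l (I x)`. Applied to the
  -- differential of `f` it gives the only possible differential of the holomorphic function sought.
  let J : (V →L[ℝ] ℝ) →ₗ[ℝ] (V →L[ℂ] ℂ) := (StrongDual.extendRCLikeₗ (𝕜 := ℂ) (F := V)).toLinearMap
  let J' : (V →L[ℝ] ℝ) →L[ℝ] (V →L[ℂ] ℂ) := LinearMap.toContinuousLinearMap J
  have hJ : ∀ (l : V →L[ℝ] ℝ) x, J' l x = (l x : ℂ) - I * (l (I • x) : ℂ) := fun l x => by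
    exact StrongDual.extendRCLike_apply (𝕜 := ℂ) l x
  have hfa : ∀ u ∈ B, ContDiffAt ℝ 2 f u := fun u hu => hf.contDiffAt (hB.mem_nhds hu)
  have hd1 : ∀ u ∈ B, DifferentiableAt ℝ (fderiv ℝ f) u := fun u hu =>
    ((hfa u hu).fderiv_right (m := 1) (by norm_num)).differentiableAt one_ne_zero
  let η : V → V →L[ℂ] ℂ := fun x => J' (fderiv ℝ f x)
  have hη : ∀ u ∈ B, HasFDerivAt η (J'.comp (fderiv ℝ (fderiv ℝ f) u)) u := fun u hu =>
    J'.hasFDerivAt.comp u (hd1 u hu).hasFDerivAt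
  have hsymm : ∀ u ∈ B, ∀ v w, fderiv ℝ (fderiv ℝ f) u v (I • w) =
      fderiv ℝ (fderiv ℝ f) u w (I • v) := fun u hu v w => by
    have hfc : ContDiffAt ℝ 2 (fun y => (f y : ℂ)) u := ofRealCLM.contDiff.contDiffAt.comp u (hfa u hu)
    have h1 := h0 u hu v w
    rw [ddbar_eq hfc] at h1
    have h2 : fderiv ℝ (fun y => (f y : ℂ)) =ᶠ[𝓝 u] fun y => ofRealCLM.comp (fderiv ℝ f y) := by
      filter_upwards [hB.mem_nhds hu] with y hy
      exact (ofRealCLM.hasFDerivAt.comp y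
        ((hfa y hy).differentiableAt two_ne_zero).hasFDerivAt).fderiv
    have h3 : HasFDerivAt (fun y => ofRealCLM.comp (fderiv ℝ f y))
        ((ContinuousLinearMap.compL ℝ V ℝ ℂ ofRealCLM).comp (fderiv ℝ (fderiv ℝ f) u)) u :=
      (ContinuousLinearMap.compL ℝ V ℝ ℂ ofRealCLM).hasFDerivAt.comp u (hd1 u hu).hasFDerivAt
    rw [h2.fderiv_eq, h3.fderiv] at h1
    simp only [ContinuousLinearMap.comp_apply, ContinuousLinearMap.compL_apply,
      ofRealCLM_apply, mul_eq_zero, div_eq_zero_iff, I_ne_zero, false_or, OfNat.ofNat_ne_zero,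
      sub_eq_zero, ofReal_inj] at h1
    exact h1
  -- Poincaré lemma: the real part of `η` is closed because second derivatives are symmetric, the
  -- imaginary part because `∂∂̄f = 0`.
  obtain ⟨H, hH⟩ : ∃ H : V → ℂ, ∀ a ∈ B, HasFDerivAt H (η a) a := hBc.exists_forall_hasFDerivAt_of_fderiv_symmetric (𝕜 := ℂ) hB
    (fun u hu => (hη u hu).differentiableAt.differentiableWithinAt) fun u hu v w => by
      have hs : IsSymmSndFDerivAt ℝ f u := (hfa u hu).isSymmSndFDerivAt (by simp)
      rw [(hη u hu).fderiv]
      simp only [ContinuousLinearMap.comp_apply, hJ]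
      rw [hs v w, hsymm u hu v w]
  have hC1 : ContDiffOn ℂ 1 H B := by
    rw [show (1 : ℕ∞ω) = 0 + 1 from (zero_add 1).symm, contDiffOn_succ_iff_fderiv_of_isOpen hB]
    refine ⟨fun x hx => (hH x hx).differentiableAt.differentiableWithinAt, by simp, ?_⟩
    rw [contDiffOn_zero]
    refine ContinuousOn.congr (f := η) (fun x hx => ?_) fun x hx => (hH x hx).fderiv
    exact (hη x hx).continuousAt.continuousWithinAt
  rcases B.eq_empty_or_nonempty with rfl | ⟨x₀, hx₀⟩
  · exact ⟨0, fun x hx => hx.elim, fun x hx => hx.elim⟩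
  have hconst : ∀ x ∈ B, (H x).re - f x = (H x₀).re - f x₀ := by
    intro x hx
    have hd : ∀ y ∈ B, HasFDerivWithinAt (fun y => (H y).re - f y) (0 : V →L[ℝ] ℝ) B y := by
      intro y hy
      have h1 := (reCLM.hasFDerivAt.comp y ((hH y hy).restrictScalars ℝ)).sub
        ((hfa y hy).differentiableAt two_ne_zero).hasFDerivAt
      refine (h1.congr_fderiv ?_).hasFDerivWithinAt
      ext v
      simp [η, hJ]
    have := hBc.norm_image_sub_le_of_norm_hasFDerivWithin_le hd (C := 0) (by simp) hx₀ hx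
    simpa [sub_eq_zero] using this
  refine ⟨fun x => H x - (((H x₀).re - f x₀ : ℝ) : ℂ), fun x hx => ?_, fun x hx => ?_⟩
  · exact (analyticAt_of_contDiffOn_one hB hC1 hx).sub analyticAt_const
  · rw [sub_re, ofReal_re, ← hconst x hx]
    ring

end DdbarCalculus

/-! ### Complex manifolds as real manifolds. -/

section RealStructure

variable {V : Type*} [NormedAddCommGroup V] [NormedSpace ℂ V]
  {W : Type*} [NormedAddCommGroup W] [NormedSpace ℂ W]
  {F : Type*} [NormedAddCommGroup F] [NormedSpace ℂ F]
  {X : Type*} [TopologicalSpace X] [ChartedSpace V X]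
  {U : Type*} [TopologicalSpace U] [ChartedSpace W U]

theorem isManifold_real [IsManifold 𝓘(ℂ, V) ω X] : IsManifold 𝓘(ℝ, V) ω X := by
  refine isManifold_of_contDiffOn _ _ _ fun e e' he he' => ?_
  have h := (contDiffGroupoid ω 𝓘(ℂ, V)).compatible he he'
  rw [contDiffGroupoid, mem_groupoid_of_pregroupoid] at h
  exact h.1.restrict_scalars ℝ

theorem contMDiffAt_real {n : ℕ∞ω} {f : X → F} {x : X} (h : ContMDiffAt 𝓘(ℂ, V) 𝓘(ℂ, F) n f x) :
    ContMDiffAt 𝓘(ℝ, V) 𝓘(ℝ, F) n f x := by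
  rw [contMDiffAt_iff] at h ⊢
  exact ⟨h.1, h.2.restrict_scalars ℝ⟩

theorem contMDiffAt_real_prod {n : ℕ∞ω} {f : X × U → F} {x : X × U}
    (h : ContMDiffAt (𝓘(ℂ, V).prod 𝓘(ℂ, W)) 𝓘(ℂ, F) n f x) :
    ContMDiffAt (𝓘(ℝ, V).prod 𝓘(ℝ, W)) 𝓘(ℝ, F) n f x := by
  rw [contMDiffAt_iff] at h ⊢
  exact ⟨h.1, h.2.restrict_scalars ℝ⟩

end RealStructure

/-! ### Functions and coordinate changes read in charts. -/

section Charts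

variable {𝕜 : Type*} [NontriviallyNormedField 𝕜]
  {V : Type*} [NormedAddCommGroup V] [NormedSpace 𝕜 V]
  {F : Type*} [NormedAddCommGroup F] [NormedSpace 𝕜 F]
  {X : Type*} [TopologicalSpace X] [ChartedSpace V X]

theorem contDiffAt_comp_chart_symm {n : ℕ∞ω} [IsManifold 𝓘(𝕜, V) n X] {f : X → F} {a : X} {u : V}
    (hu : u ∈ (chartAt V a).target)
    (h : ContMDiffAt 𝓘(𝕜, V) 𝓘(𝕜, F) n f ((chartAt V a).symm u)) :
    ContDiffAt 𝕜 n (fun y => f ((chartAt V a).symm y)) u := by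
  rw [← contMDiffAt_iff_contDiffAt]
  exact h.comp u (contMDiffAt_symm_of_mem_maximalAtlas (IsManifold.chart_mem_maximalAtlas a) hu)

theorem contMDiffAt_comp_chart {n : ℕ∞ω} [IsManifold 𝓘(𝕜, V) n X] {f : V → F} {a x : X}
    (hx : x ∈ (chartAt V a).source) (h : ContDiffAt 𝕜 n f (chartAt V a x)) :
    ContMDiffAt 𝓘(𝕜, V) 𝓘(𝕜, F) n (fun y => f (chartAt V a y)) x :=
  h.contMDiffAt.comp x (contMDiffAt_of_mem_maximalAtlas (IsManifold.chart_mem_maximalAtlas a) hx)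

theorem contDiffAt_chart_change {n : ℕ∞ω} [IsManifold 𝓘(𝕜, V) n X] {a b : X} {u : V}
    (hu : u ∈ (chartAt V a).target) (hb : (chartAt V a).symm u ∈ (chartAt V b).source) :
    ContDiffAt 𝕜 n (fun y => chartAt V b ((chartAt V a).symm y)) u :=
  contDiffAt_comp_chart_symm hu
    (contMDiffAt_of_mem_maximalAtlas (IsManifold.chart_mem_maximalAtlas b) hb)

end Charts

/-! ### Pluriharmonic functions on a complex manifold. -/

section ReHolomorphic

variable (V : Type*) [NormedAddCommGroup V] [NormedSpace ℂ V]
  {X : Type*} [TopologicalSpace X] [ChartedSpace V X]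

/-- The real function `F` is near `x` the real part of a holomorphic function. -/
def IsReHolomorphicAt (F : X → ℝ) (x : X) : Prop :=
  ∃ h : X → ℂ, ContMDiffAt 𝓘(ℂ, V) 𝓘(ℂ, ℂ) ω h x ∧ ∀ᶠ y in 𝓝 x, F y = (h y).re

variable {V}

namespace IsReHolomorphicAt

variable {F G : X → ℝ} {x : X}

theorem congr (hF : IsReHolomorphicAt V F x) (h : ∀ᶠ y in 𝓝 x, G y = F y) :
    IsReHolomorphicAt V G x := by
  obtain ⟨f, hf, hf'⟩ := hF
  refine ⟨f, hf, ?_⟩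
  filter_upwards [h, hf'] with y h1 h2
  rw [h1, h2]

theorem const (c : ℝ) (x : X) : IsReHolomorphicAt V (fun _ => c) x :=
  ⟨fun _ => c, contMDiffAt_const, by simp⟩

theorem add (hF : IsReHolomorphicAt V F x) (hG : IsReHolomorphicAt V G x) :
    IsReHolomorphicAt V (fun y => F y + G y) x := by
  obtain ⟨f, hf, hf'⟩ := hF
  obtain ⟨g, hg, hg'⟩ := hG
  refine ⟨fun y => f y + g y, hf.add hg, ?_⟩
  filter_upwards [hf', hg'] with y h1 h2
  simp [h1, h2]

theorem const_mul (hF : IsReHolomorphicAt V F x) (c : ℝ) :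
    IsReHolomorphicAt V (fun y => c * F y) x := by
  obtain ⟨f, hf, hf'⟩ := hF
  refine ⟨fun y => (c : ℂ) * f y, ?_, ?_⟩
  · exact (contDiff_const.mul contDiff_id).contMDiff.contMDiffAt.comp
      (g := fun z : ℂ => (c : ℂ) * z) x hf
  · filter_upwards [hf'] with y h1
    simp [h1]

theorem neg (hF : IsReHolomorphicAt V F x) : IsReHolomorphicAt V (fun y => -F y) x := by
  simpa using hF.const_mul (-1)

theorem sub (hF : IsReHolomorphicAt V F x) (hG : IsReHolomorphicAt V G x) :
    IsReHolomorphicAt V (fun y => F y - G y) x := by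
  simpa [sub_eq_add_neg] using hF.add hG.neg

theorem sum {ι : Type*} (s : Finset ι) {F : ι → X → ℝ}
    (hF : ∀ i ∈ s, IsReHolomorphicAt V (F i) x) :
    IsReHolomorphicAt V (fun y => ∑ i ∈ s, F i y) x := by
  classical
  induction s using Finset.induction_on with
  | empty => simpa using const 0 x
  | insert i s hi ih =>
    simp only [Finset.sum_insert hi]
    exact (hF i (by simp)).add (ih fun j hj => hF j (by simp [hj]))

theorem contMDiffAt_real (hF : IsReHolomorphicAt V F x) :
    ContMDiffAt 𝓘(ℝ, V) 𝓘(ℝ, ℝ) ω F x := by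
  obtain ⟨f, hf, hf'⟩ := hF
  have h1 := RicciFlatDeformation.contMDiffAt_real hf
  have h2 : ContMDiffAt 𝓘(ℝ, V) 𝓘(ℝ, ℝ) ω (fun y => (f y).re) x :=
    (Complex.reCLM.contDiff (n := ω)).contMDiff.contMDiffAt.comp x h1
  exact h2.congr_of_eventuallyEq hf'

theorem continuousAt (hF : IsReHolomorphicAt V F x) : ContinuousAt F x :=
  hF.contMDiffAt_real.continuousAt

/-- Near `x` the quotient `k / k x` is close to one, so the principal logarithm is holomorphic on it
whatever the argument of `k x`. -/
theorem log_norm {k : X → ℂ} (hk : ContMDiffAt 𝓘(ℂ, V) 𝓘(ℂ, ℂ) ω k x) (h0 : k x ≠ 0) :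
    IsReHolomorphicAt V (fun y => Real.log ‖k y‖) x := by
  have h1 : ContDiffAt ℂ ω (fun z : ℂ => Complex.log (z / k x) + Complex.log (k x)) (k x) := by
    refine ContDiffAt.add (ContDiffAt.comp (g := Complex.log) (f := fun z : ℂ => z / k x) (k x)
      (Complex.contDiffAt_log ?_) (contDiffAt_id.div_const _)) contDiffAt_const
    simp [h0]
  refine ⟨fun y => Complex.log (k y / k x) + Complex.log (k x),
    h1.contMDiffAt.comp x hk, ?_⟩
  have h2 : ∀ᶠ y in 𝓝 x, k y ≠ 0 := hk.continuousAt.eventually_ne h0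
  filter_upwards [h2] with y hy
  rw [Complex.add_re, Complex.log_re, Complex.log_re, norm_div,
    Real.log_div (norm_ne_zero_iff.2 hy) (norm_ne_zero_iff.2 h0)]
  ring

end IsReHolomorphicAt

theorem MVOn.log_norm {d : V → ℂ} {B : Set V} (hd : ∀ u ∈ B, AnalyticAt ℂ d u)
    (h0 : ∀ u ∈ B, d u ≠ 0) : MVOn (fun u => Real.log ‖d u‖) B := by
  refine MVOn.of_harmonicAt (fun u hu => ?_) fun x ξ ζ hu => ?_
  · exact ((hd u hu).continuousAt.norm.log (norm_ne_zero_iff.2 (h0 u hu))).continuousWithinAt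
  · have h2 : AnalyticAt ℂ (fun ζ : ℂ => x + ζ • ξ) ζ :=
      analyticAt_const.add (analyticAt_id.smul analyticAt_const)
    exact (AnalyticAt.comp (f := fun ζ : ℂ => x + ζ • ξ) (hd _ hu) h2).harmonicAt_log_norm
      (h0 _ hu)

variable [IsManifold 𝓘(ℂ, V) ω X]

/-- Because of this, the curvature does not depend on the local holomorphic frame. -/
theorem mddbar_add_of_isReHolomorphicAt {F G : X → ℝ} {x : X}
    (hF : ContMDiffAt 𝓘(ℝ, V) 𝓘(ℝ, ℝ) 2 F x) (hG : IsReHolomorphicAt V G x) (v w : V) :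
    mddbar (V := V) (fun y => ((F y + G y : ℝ) : ℂ)) x v w =
      mddbar (V := V) (fun y => (F y : ℂ)) x v w := by
  have : IsManifold 𝓘(ℝ, V) ω X := isManifold_real
  have hF2 : ContDiffAt ℝ 2 (fun y => (F ((chartAt V x).symm y) : ℂ)) (chartAt V x x) := by
    have : IsManifold 𝓘(ℝ, V) 2 X := IsManifold.of_le (n := ω) le_top
    refine Complex.ofRealCLM.contDiff.contDiffAt.comp _
      (contDiffAt_comp_chart_symm (mem_chart_target V x) ?_)
    rwa [(chartAt V x).left_inv (mem_chart_source V x)]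
  obtain ⟨h, hh, hh'⟩ := hG
  have hh2 : ContDiffAt ℂ 2 (fun y => h ((chartAt V x).symm y)) (chartAt V x x) := by
    refine (contDiffAt_comp_chart_symm (n := ω) (mem_chart_target V x) ?_).of_le le_top
    rwa [(chartAt V x).left_inv (mem_chart_source V x)]
  have hre : ContDiffAt ℝ 2 (fun y => ((h ((chartAt V x).symm y)).re : ℂ)) (chartAt V x x) :=
    (Complex.ofRealCLM.comp Complex.reCLM).contDiff.contDiffAt.comp _ (hh2.restrict_scalars ℝ)
  have hev : ∀ᶠ y in 𝓝 (chartAt V x x), G ((chartAt V x).symm y) = (h ((chartAt V x).symm y)).re := by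
    have hc := (chartAt V x).continuousAt_symm (mem_chart_target V x)
    rw [ContinuousAt, (chartAt V x).left_inv (mem_chart_source V x)] at hc
    exact hc.eventually hh'
  unfold mddbar
  rw [ddbar_congr (g := fun y => (F ((chartAt V x).symm y) : ℂ) +
    ((h ((chartAt V x).symm y)).re : ℂ)), ddbar_add hF2 hre, ddbar_re hh2, add_zero]
  filter_upwards [hev] with y hy
  simp [hy]

/-- A real function with `∂∂̄F = 0` is locally the real part of a holomorphic function. -/
theorem isReHolomorphicAt_of_mddbar_eq_zero [FiniteDimensional ℂ V] {F : X → ℝ} {x : X}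
    (hF : ∀ᶠ y in 𝓝 x, ContMDiffAt 𝓘(ℝ, V) 𝓘(ℝ, ℝ) 2 F y)
    (h0 : ∀ᶠ y in 𝓝 x, ∀ v w : V, mddbar (V := V) (fun z => (F z : ℂ)) y v w = 0) :
    IsReHolomorphicAt V F x := by
  have : IsManifold 𝓘(ℝ, V) ω X := isManifold_real
  have : IsManifold 𝓘(ℝ, V) 2 X := IsManifold.of_le (n := ω) le_top
  let c := chartAt V x
  have hc := c.continuousAt_symm (mem_chart_target V x)
  rw [ContinuousAt, c.left_inv (mem_chart_source V x)] at hc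
  obtain ⟨ρ, hρ, hB⟩ := Metric.eventually_nhds_iff_ball.1
    ((hc.eventually (hF.and h0)).and (c.open_target.mem_nhds (mem_chart_target V x)))
  obtain ⟨h, hh, hre⟩ := exists_holomorphic_of_ddbar_eq_zero (f := fun y => F (c.symm y))
    (B := Metric.ball (c x) ρ) Metric.isOpen_ball (convex_ball _ _)
    (fun u hu => (contDiffAt_comp_chart_symm (hB u hu).2 (hB u hu).1.1).contDiffWithinAt)
    (fun u hu v w => by
      obtain ⟨⟨hF1, hF2⟩, hu'⟩ := hB u hu
      -- The hypothesis at a nearby point is expressed in the chart preferred there. The holomorphic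
      -- transition map carries it over to the chart at `x`.
      let b := chartAt V (c.symm u)
      have hb : c.symm u ∈ b.source := mem_chart_source V _
      have hψ : ContDiffAt ℂ 2 (fun y => b (c.symm y)) u :=
        (contDiffAt_chart_change (n := ω) hu' hb).of_le le_top
      have hF3 : ContDiffAt ℝ 2 (fun y => (F (b.symm y) : ℂ)) (b (c.symm u)) := by
        refine Complex.ofRealCLM.contDiff.contDiffAt.comp _
          (contDiffAt_comp_chart_symm (b.map_source hb) ?_)
        rwa [b.left_inv hb]
      have := ddbar_comp_eq_zero hψ hF3 (fun v w => hF2 v w) v w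
      rw [← this]
      refine ddbar_congr ?_ v w
      have h1 : ∀ᶠ y in 𝓝 u, c.symm y ∈ b.source :=
        (c.continuousAt_symm hu').eventually_mem (b.open_source.mem_nhds hb)
      filter_upwards [h1] with y hy
      rw [b.left_inv hy])
  refine ⟨fun y => h (c y), ?_, ?_⟩
  · exact contMDiffAt_comp_chart (mem_chart_source V x)
      ((hh _ (Metric.mem_ball_self hρ)).contDiffAt)
  · have h2 := (c.continuousAt (mem_chart_source V x)).eventually_mem (Metric.ball_mem_nhds _ hρ)
    filter_upwards [h2, c.open_source.mem_nhds (mem_chart_source V x)] with y hy hy'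
    rw [hre _ hy, c.left_inv hy']

/-- Restricted to a complex line in a chart, `F` is the real part of a holomorphic function of one
variable, hence harmonic. -/
theorem MVOn.of_isReHolomorphicAt {F : X → ℝ} {a : X} {B : Set V} (hB : B ⊆ (chartAt V a).target)
    (hF : ∀ u ∈ B, IsReHolomorphicAt V F ((chartAt V a).symm u)) :
    MVOn (fun u => F ((chartAt V a).symm u)) B := by
  refine MVOn.of_harmonicAt (fun u hu => ?_) fun x ξ ζ hu => ?_
  · exact (ContinuousAt.comp (g := F) (f := (chartAt V a).symm) (hF u hu).continuousAt
      ((chartAt V a).continuousAt_symm (hB hu))).continuousWithinAt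
  · obtain ⟨h, hh, hre⟩ := hF _ hu
    have h1 := (contDiffAt_comp_chart_symm (hB hu) hh).analyticAt
    have h2 : AnalyticAt ℂ (fun ζ : ℂ => x + ζ • ξ) ζ :=
      analyticAt_const.add (analyticAt_id.smul analyticAt_const)
    have h3 := AnalyticAt.comp (f := fun ζ : ℂ => x + ζ • ξ) h1 h2
    refine (InnerProductSpace.harmonicAt_congr_nhds ?_).1 h3.harmonicAt_re
    have h4 : ContinuousAt (fun ζ : ℂ => (chartAt V a).symm (x + ζ • ξ)) ζ :=
      ContinuousAt.comp (f := fun ζ : ℂ => x + ζ • ξ) ((chartAt V a).continuousAt_symm (hB hu))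
        h2.continuousAt
    filter_upwards [h4.eventually hre] with z hz
    exact hz.symm

/-- By the open mapping theorem a nonconstant holomorphic function takes all values near `h x`,
including some that are not real. This turns real-valued holomorphic cochains into locally constant
ones. -/
theorem eventually_eq_of_im_eq_zero {h : X → ℂ} {x : X} (hh : ContMDiffAt 𝓘(ℂ, V) 𝓘(ℂ, ℂ) ω h x)
    (h0 : ∀ᶠ y in 𝓝 x, (h y).im = 0) : ∀ᶠ y in 𝓝 x, h y = h x := by
  let c := chartAt V x
  have hcx : c.symm (c x) = x := c.left_inv (mem_chart_source V x)
  have hc := c.continuousAt_symm (mem_chart_target V x)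
  rw [ContinuousAt, hcx] at hc
  have ha : AnalyticAt ℂ (fun u => h (c.symm u)) (c x) := by
    refine (contDiffAt_comp_chart_symm (n := ω) (mem_chart_target V x) ?_).analyticAt
    rwa [hcx]
  rcases ha.eventually_constant_or_nhds_le_map_nhds with h1 | h1
  · filter_upwards [(c.continuousAt (mem_chart_source V x)).eventually h1,
      c.open_source.mem_nhds (mem_chart_source V x)] with y hy hy'
    rwa [c.left_inv hy', hcx] at hy
  · have h2 : ∀ᶠ z in 𝓝 (h x), z.im = 0 := by
      have h3 := h1
      rw [hcx] at h3
      exact h3 (hc.eventually h0)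
    obtain ⟨ε, hε, hε'⟩ := Metric.eventually_nhds_iff_ball.1 h2
    have e1 := hε' (h x) (Metric.mem_ball_self hε)
    have e2 := hε' (h x + (ε / 2 : ℝ) * Complex.I) (by
      rw [Metric.mem_ball, dist_eq_norm, add_sub_cancel_left, norm_mul, Complex.norm_I, mul_one,
        Complex.norm_real, Real.norm_of_nonneg (by positivity)]
      linarith)
    simp [e1] at e2
    exact absurd e2 hε.ne'

end ReHolomorphic

open FunctionSheaf

/-! ### Representatives of Čech classes. -/

section Cech

variable {M : Type*} [TopologicalSpace M] {A : Type*} [AddCommGroup A]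

theorem H1_mk_surjective (F : FunctionSheaf M A) (c : F.H1) :
    ∃ (f : M → M → M → A) (hf : f ∈ F.cocycles), H1.mk F f hf = c := by
  induction c using QuotientAddGroup.induction_on with
  | H f => exact ⟨f.1, f.2, rfl⟩

theorem H1_mk_eq_zero_iff {F : FunctionSheaf M A} {f : M → M → M → A} {hf : f ∈ F.cocycles} :
    H1.mk F f hf = 0 ↔ f ∈ F.coboundaries := by
  rw [H1.mk, QuotientAddGroup.eq_zero_iff]
  rfl

theorem H1_mk_sub {F : FunctionSheaf M A} {f g : M → M → M → A} (hf : f ∈ F.cocycles)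
    (hg : g ∈ F.cocycles) :
    H1.mk F f hf - H1.mk F g hg = H1.mk F (f - g) (F.cocycles.sub_mem hf hg) := rfl

theorem H1_mk_eq_iff {F : FunctionSheaf M A} {f g : M → M → M → A} {hf : f ∈ F.cocycles}
    {hg : g ∈ F.cocycles} : H1.mk F f hf = H1.mk F g hg ↔ f - g ∈ F.coboundaries := by
  rw [← sub_eq_zero, H1_mk_sub, H1_mk_eq_zero_iff]

end Cech

/-! ### Exactness of the exponential sequence at `H¹(𝒪)`. -/

section Exponential

variable {V : Type*} [NormedAddCommGroup V] [NormedSpace ℂ V]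
  {M : Type*} [TopologicalSpace M] [ChartedSpace V M]

theorem expH1_mk (f : M → M → M → ℂ) (hf : f ∈ (holoSheaf 𝓘(ℂ, V) M).cocycles) :
    ∃ hf', expH1 𝓘(ℂ, V) M (H1.mk _ f hf) =
      H1.mk (holoUnitsSheaf 𝓘(ℂ, V) M) (fun a b x => expHom (f a b x)) hf' :=
  ⟨_, rfl⟩

theorem realToHolo_mk (f : M → M → M → ℝ) (hf : f ∈ (constSheaf M ℝ).cocycles) :
    ∃ hf', realToHolo 𝓘(ℂ, V) M (H1.mk _ f hf) =
      H1.mk (holoSheaf 𝓘(ℂ, V) M) (fun a b x => (f a b x : ℂ)) hf' :=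
  ⟨_, rfl⟩

theorem intToHolo_mk (f : M → M → M → ℤ) (hf : f ∈ (constSheaf M ℤ).cocycles) :
    ∃ hf', intToHolo 𝓘(ℂ, V) M (H1.mk _ f hf) =
      H1.mk (holoSheaf 𝓘(ℂ, V) M) (fun a b x => (f a b x : ℂ)) hf' :=
  ⟨_, rfl⟩

@[simp] theorem expHom_toMul (c : ℂ) :
    (((expHom c).toMul : ℂˣ) : ℂ) = Complex.exp (2 * Real.pi * Complex.I * c) := rfl

theorem additive_units_ext {a b : Additive ℂˣ} (h : (a.toMul : ℂ) = b.toMul) : a = b :=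
  Additive.toMul.injective (Units.ext h)

variable [IsManifold 𝓘(ℂ, V) ω M]

/-- A nowhere vanishing holomorphic function has a local logarithm. -/
theorem exists_local_log {k : M → ℂ} {a : M} (hk : ContMDiffAt 𝓘(ℂ, V) 𝓘(ℂ, ℂ) ω k a)
    (h0 : k a ≠ 0) : ∃ l : M → ℂ, ∀ᶠ x in 𝓝 a, ContMDiffAt 𝓘(ℂ, V) 𝓘(ℂ, ℂ) ω l x ∧
      Complex.exp (2 * Real.pi * Complex.I * l x) = k x := by
  have h1 : ContDiffAt ℂ ω (fun z : ℂ => (Complex.log (z / k a) + Complex.log (k a)) /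
      (2 * Real.pi * Complex.I)) (k a) := by
    refine (ContDiffAt.add (ContDiffAt.comp (g := Complex.log) (f := fun z : ℂ => z / k a) (k a)
      (Complex.contDiffAt_log ?_) (contDiffAt_id.div_const _)) contDiffAt_const).div_const _
    simp [h0]
  refine ⟨fun y => (Complex.log (k y / k a) + Complex.log (k a)) / (2 * Real.pi * Complex.I), ?_⟩
  have h2 := (contMDiffAt_iff_contMDiffAt_nhds (by simp)).1 (h1.contMDiffAt.comp a hk)
  filter_upwards [h2, hk.continuousAt.eventually_ne h0] with y hy hy'
  refine ⟨hy, ?_⟩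
  rw [mul_div_cancel₀ _ (by simp [Real.pi_ne_zero]), Complex.exp_add,
    Complex.exp_log (div_ne_zero hy' h0), Complex.exp_log h0, div_mul_cancel₀ _ h0]

/-- An eventual property holds on an open neighbourhood. -/
theorem exists_opens_of_eventually {P : M → M → Prop} (h : ∀ a, ∀ᶠ x in 𝓝 a, P a x) :
    ∃ W : M → Opens M, (∀ a, a ∈ W a) ∧ ∀ a, ∀ x ∈ W a, P a x := by
  choose W hW hWo haW using fun a => eventually_nhds_iff.1 (h a)
  exact ⟨fun a => ⟨W a, hWo a⟩, haW, hW⟩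

/-- Holomorphic functions near `x` with integral values are locally constant. -/
theorem eventually_eq_of_integral {f : M → ℂ} {x : M} (hf : ContinuousAt f x)
    (hn : ∀ᶠ y in 𝓝 x, ∃ n : ℤ, f y = n) : ∀ᶠ y in 𝓝 x, f y = f x := by
  obtain ⟨n, hnx⟩ := hn.self_of_nhds
  have h1 := hf.eventually_mem (Metric.ball_mem_nhds _ one_pos)
  filter_upwards [hn, h1] with y ⟨m, hm⟩ hy
  rw [Metric.mem_ball, dist_eq_norm, hm, hnx, ← Int.cast_sub, Complex.norm_intCast] at hy
  rw [hm, hnx]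
  have : |m - n| < 1 := by exact_mod_cast hy
  have : m = n := by
    rw [Int.abs_lt_one_iff] at this
    omega
  rw [this]

/-- If `exp (2πif)` is the coboundary of `h`, then subtracting from `f` the coboundary of local
logarithms of `h` leaves a cocycle with integral values, which is locally constant by continuity. -/
theorem ker_expH1_le (c : (holoSheaf 𝓘(ℂ, V) M).H1) (hc : expH1 𝓘(ℂ, V) M c = 0) :
    c ∈ (intToHolo 𝓘(ℂ, V) M).range := by
  obtain ⟨f, hf, rfl⟩ := H1_mk_surjective _ c
  obtain ⟨hf', he⟩ := expH1_mk f hf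
  rw [he, H1_mk_eq_zero_iff] at hc
  obtain ⟨W, h, hW, hh, hfh⟩ := hc
  have hf₀ := hf
  obtain ⟨W', hW', hf1, hf2⟩ := hf₀
  choose l hl using fun a => exists_local_log (hh a a (hW a)) ((h a a).toMul.ne_zero)
  obtain ⟨W₀, hW₀, hl'⟩ := exists_opens_of_eventually hl
  let Z : M → Opens M := fun a => W a ⊓ W' a ⊓ W₀ a
  have hZ : ∀ a, a ∈ Z a := fun a => ⟨⟨hW a, hW' a⟩, hW₀ a⟩
  let g : M → M → M → ℂ := fun a b x => f a b x - (l b x - l a x)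
  have hint : ∀ a b, ∀ x ∈ Z a ⊓ Z b, ∃ n : ℤ, g a b x = n := by
    rintro a b x ⟨⟨⟨ha1, ha2⟩, ha3⟩, ⟨hb1, hb2⟩, hb3⟩
    have e1 : expHom (f a b x) = h b x - h a x := hfh a b x ⟨ha1, hb1⟩
    have e2 : Complex.exp (2 * Real.pi * Complex.I * f a b x) =
        ((h b x).toMul : ℂ) / ((h a x).toMul : ℂ) := by
      rw [← expHom_toMul, e1, toMul_sub, Units.val_div_eq_div_val]
    have e3 : Complex.exp (2 * Real.pi * Complex.I * g a b x) = 1 := by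
      simp only [g]
      rw [mul_sub, mul_sub, Complex.exp_sub, Complex.exp_sub, e2, (hl' a x ha3).2,
        (hl' b x hb3).2]
      exact div_self (div_ne_zero (Units.ne_zero _) (Units.ne_zero _))
    obtain ⟨n, hn⟩ := Complex.exp_eq_one_iff.1 e3
    refine ⟨n, ?_⟩
    have hp : (2 * Real.pi * Complex.I : ℂ) ≠ 0 := by simp [Real.pi_ne_zero]
    exact mul_left_cancel₀ hp (by rw [hn]; ring)
  have hgc : ∀ a b, ∀ x ∈ Z a ⊓ Z b, ContinuousAt (g a b) x := by
    rintro a b x ⟨⟨⟨ha1, ha2⟩, ha3⟩, ⟨hb1, hb2⟩, hb3⟩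
    exact (hf1 a b x ⟨ha2, hb2⟩).continuousAt.sub
      ((hl' b x hb3).1.continuousAt.sub (hl' a x ha3).1.continuousAt)
  -- Off the overlaps `g` need not be integral; rounding gives an integer everywhere and changes
  -- nothing on the overlaps.
  let m : M → M → M → ℤ := fun a b x => round (g a b x).re
  have hm : ∀ a b, ∀ x ∈ Z a ⊓ Z b, (m a b x : ℂ) = g a b x := fun a b x hx => by
    obtain ⟨n, hn⟩ := hint a b x hx
    simp [m, hn]
  have hmc : m ∈ (constSheaf M ℤ).cocycles := by
    refine ⟨Z, hZ, fun a b x hx => ?_, fun a b c x hx => ?_⟩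
    · have hnb := (Z a ⊓ Z b).isOpen.mem_nhds hx
      have := eventually_eq_of_integral (hgc a b x hx)
        (Filter.mem_of_superset hnb fun y hy => hint a b y hy)
      filter_upwards [this] with y hy
      simp [m, hy]
    · have e := hf2 a b c x ⟨⟨hx.1.1.1.2, hx.1.2.1.2⟩, hx.2.1.2⟩
      have : (m a b x : ℂ) + m b c x = m a c x := by
        rw [hm a b x hx.1, hm b c x ⟨hx.1.2, hx.2⟩, hm a c x ⟨hx.1.1, hx.2⟩]
        simp only [g]
        rw [← e]
        ring
      exact_mod_cast this
  obtain ⟨hm', e⟩ := intToHolo_mk (V := V) m hmc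
  refine ⟨H1.mk _ m hmc, ?_⟩
  refine e.trans (H1_mk_eq_iff.2 ?_)
  refine ⟨Z, fun a x => -l a x, hZ, fun a x hx => ?_, fun a b x hx => ?_⟩
  · exact (holoSheaf 𝓘(ℂ, V) M).neg (hl' a x hx.2).1
  · simp only [Pi.sub_apply]
    rw [hm a b x hx]
    simp only [g]
    ring

theorem toPic_injective : Function.Injective (Pic0.toPic 𝓘(ℂ, V) M) := by
  rw [injective_iff_map_eq_zero]
  intro c hc
  induction c using QuotientAddGroup.induction_on with
  | H c => exact (QuotientAddGroup.eq_zero_iff _).2 (ker_expH1_le c hc)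

end Exponential

/-! ### Frame changes and Gram determinants. -/

section Frames

variable {M : Type*} [TopologicalSpace M] {r : ℕ} {E : M → Type*}
  [TopologicalSpace (TotalSpace (Fin r → ℂ) E)]
  [∀ p, TopologicalSpace (E p)] [∀ p, AddCommMonoid (E p)] [∀ p, Module ℂ (E p)]
  [FiberBundle (Fin r → ℂ) E] [VectorBundle ℂ (Fin r → ℂ) E]

/-- The determinant of the coordinate change between two local frames. -/
def detChange (e e' : Trivialization (Fin r → ℂ) (π (Fin r → ℂ) E)) [MemTrivializationAtlas e]
    [MemTrivializationAtlas e'] (p : M) : ℂˣ :=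
  LinearEquiv.det (e.coordChangeL ℂ e' p).toLinearEquiv

theorem detTransition_eq (a b x : M) : detTransition r E a b x =
    Additive.ofMul (detChange (trivializationAt (Fin r → ℂ) E b)
      (trivializationAt (Fin r → ℂ) E a) x) := rfl

theorem coe_detChange (e e' : Trivialization (Fin r → ℂ) (π (Fin r → ℂ) E))
    [MemTrivializationAtlas e] [MemTrivializationAtlas e'] (p : M) :
    (detChange e e' p : ℂ) = LinearMap.det
      ((e.coordChangeL ℂ e' p : (Fin r → ℂ) →L[ℂ] Fin r → ℂ) : (Fin r → ℂ) →ₗ[ℂ] Fin r → ℂ) :=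
  LinearEquiv.coe_det _

variable (e e' e'' : Trivialization (Fin r → ℂ) (π (Fin r → ℂ) E)) [MemTrivializationAtlas e]
  [MemTrivializationAtlas e'] [MemTrivializationAtlas e'']

variable {e e' e''} in
theorem detChange_mul {p : M} (h : p ∈ e.baseSet) (h' : p ∈ e'.baseSet) (h'' : p ∈ e''.baseSet) :
    detChange e' e'' p * detChange e e' p = detChange e e'' p := by
  unfold detChange
  rw [← map_mul]
  congr 1
  ext1 v
  change (Trivialization.coordChangeL ℂ _ _ p) ((Trivialization.coordChangeL ℂ _ _ p) v) =
    (Trivialization.coordChangeL ℂ _ _ p) v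
  rw [Trivialization.coordChangeL_apply _ _ ⟨h', h''⟩,
    Trivialization.coordChangeL_apply _ _ ⟨h, h'⟩,
    Trivialization.coordChangeL_apply _ _ ⟨h, h''⟩]
  rw [Trivialization.symm_apply_apply_mk]
  exact h'

variable {e e'} in
theorem symm_coordChangeL_apply {p : M} (h : p ∈ e.baseSet) (h' : p ∈ e'.baseSet)
    (v : Fin r → ℂ) : e'.symm p (e.coordChangeL ℂ e' p v) = e.symm p v := by
  rw [Trivialization.coordChangeL_apply _ _ ⟨h, h'⟩, Trivialization.symm_apply_apply_mk]
  exact h'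

section Holomorphic

variable {V : Type*} [NormedAddCommGroup V] [NormedSpace ℂ V] {H : Type*} [TopologicalSpace H]
  {I : ModelWithCorners ℂ V H} [ChartedSpace H M] [ContMDiffVectorBundle ω (Fin r → ℂ) E I]

variable {e e'} in
theorem contMDiffAt_detChange {p : M} (h : p ∈ e.baseSet) (h' : p ∈ e'.baseSet) :
    ContMDiffAt I 𝓘(ℂ, ℂ) ω (fun q => (detChange e e' q : ℂ)) p := by
  have h1 := contMDiffAt_coordChangeL (n := ω) (IB := I) (e := e) (e' := e') h h'
  have h2 := (contDiff_det r).contMDiff.contMDiffAt.comp p h1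
  exact h2.congr_of_eventuallyEq (Eventually.of_forall fun y => coe_detChange e e' y)

end Holomorphic

section Metric

open scoped ComplexOrder

variable {V : Type*} [NormedAddCommGroup V] [NormedSpace ℝ V] {H : Type*} [TopologicalSpace H]
  {I : ModelWithCorners ℝ V H} [ChartedSpace H M] (g : HermitianMetric I r E)

theorem form_sum_smul (p : M) (a b : Fin r → E p) (v w : Fin r → ℂ) :
    g.form p (∑ i, v i • a i) (∑ j, w j • b j) =
      ∑ i, ∑ j, starRingEnd ℂ (v i) * w j * g.form p (a i) (b j) := by
  simp only [map_sum, LinearMap.map_smulₛₗ, LinearMap.sum_apply, LinearMap.smul_apply,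
    smul_eq_mul, RingHom.id_apply, Finset.mul_sum]
  rw [Finset.sum_comm]
  refine Finset.sum_congr rfl fun i _ => Finset.sum_congr rfl fun j _ => ?_
  ring

variable {e} in
theorem symm_eq_sum {p : M} (h : p ∈ e.baseSet) (v : Fin r → ℂ) :
    e.symm p v = ∑ i, v i • e.symm p (Pi.single i 1) := by
  have h1 : ∀ v, e.symm p v = e.symmₗ ℂ p v := fun v => by
    rw [Trivialization.coe_symmₗ]
    exact h
  simp only [h1, ← map_smul, ← map_sum]
  congr 1
  funext i
  simp [Finset.sum_apply, Pi.single_apply]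

variable {e} in
theorem form_symm_symm {p : M} (h : p ∈ e.baseSet) (v w : Fin r → ℂ) :
    g.form p (e.symm p v) (e.symm p w) =
      ∑ i, ∑ j, starRingEnd ℂ (v i) * w j *
        g.form p (e.symm p (Pi.single i 1)) (e.symm p (Pi.single j 1)) := by
  rw [symm_eq_sum h v, symm_eq_sum h w, form_sum_smul]

/-- The Gram matrix of `g` in the frame `e`. -/
def gramMatrix (p : M) : Matrix (Fin r) (Fin r) ℂ :=
  Matrix.of fun i j => g.form p (e.symm p (Pi.single i 1)) (e.symm p (Pi.single j 1))

theorem gramDet_eq (p : M) : g.gramDet e p = (gramMatrix e g p).det := rfl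

variable {e} in
theorem gramMatrix_posDef {p : M} (h : p ∈ e.baseSet) : (gramMatrix e g p).PosDef := by
  refine Matrix.PosDef.of_dotProduct_mulVec_pos ?_ fun x hx => ?_
  · ext i j
    simp only [Matrix.conjTranspose_apply, gramMatrix, Matrix.of_apply]
    exact (g.conj_symm p _ _).symm
  · have e1 : star x ⬝ᵥ (gramMatrix e g p).mulVec x = g.form p (e.symm p x) (e.symm p x) := by
      rw [form_symm_symm g h]
      simp only [dotProduct, Matrix.mulVec, gramMatrix, Matrix.of_apply, Pi.star_apply,
        Finset.mul_sum]
      refine Finset.sum_congr rfl fun i _ => Finset.sum_congr rfl fun j _ => ?_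
      rw [Complex.star_def]
      ring
    rw [e1]
    have hne : e.symm p x ≠ 0 := fun h0 => by
      apply hx
      have h1 := congrArg Prod.snd (e.apply_mk_symm h x)
      have h2 : (e ⟨p, e.symm p 0⟩).2 = 0 := congrArg Prod.snd (e.apply_mk_symm h 0)
      have h3 : e.symm p (0 : Fin r → ℂ) = 0 := by
        rw [← Trivialization.coe_symmₗ (R := ℂ)]
        · exact map_zero _
        · exact h
      rw [h0, ← h3] at h1
      rw [← h2]
      exact h1.symm
    have him : (g.form p (e.symm p x) (e.symm p x)).im = 0 :=
      Complex.conj_eq_iff_im.1 (g.conj_symm p _ _).symm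
    exact Complex.pos_iff.2 ⟨g.pos p _ hne, him.symm⟩

variable {e} in
theorem gramDet_pos {p : M} (h : p ∈ e.baseSet) : 0 < (g.gramDet e p).re :=
  (Complex.pos_iff.1 (gramMatrix_posDef g h).det_pos).1

-- The Gram matrices satisfy `G = C* G' C` for the matrix `C` of the coordinate change, whence the
-- factor `|det C|²`.
variable {e e'} in
theorem gramDet_change {p : M} (h : p ∈ e.baseSet) (h' : p ∈ e'.baseSet) :
    g.gramDet e p = (‖(detChange e e' p : ℂ)‖ ^ 2 : ℝ) * g.gramDet e' p := by
  let C : Matrix (Fin r) (Fin r) ℂ := LinearMap.toMatrix'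
    ((e.coordChangeL ℂ e' p : (Fin r → ℂ) →L[ℂ] Fin r → ℂ) : (Fin r → ℂ) →ₗ[ℂ] Fin r → ℂ)
  have hC : ∀ i k, C k i = e.coordChangeL ℂ e' p (Pi.single i 1) k := fun i k =>
    LinearMap.toMatrix'_apply _ _ _
  have hG : gramMatrix e g p = C.conjTranspose * gramMatrix e' g p * C := by
    ext i j
    simp only [gramMatrix, Matrix.of_apply]
    rw [← symm_coordChangeL_apply h h' (Pi.single i 1),
      ← symm_coordChangeL_apply h h' (Pi.single j 1), form_symm_symm g h']
    simp only [Matrix.mul_apply, Matrix.conjTranspose_apply, Matrix.of_apply, Finset.sum_mul, hC]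
    rw [Finset.sum_comm]
    refine Finset.sum_congr rfl fun k _ => Finset.sum_congr rfl fun l _ => ?_
    rw [Complex.star_def]
    ring
  have hd : C.det = detChange e e' p := by
    rw [coe_detChange, ← LinearMap.det_toMatrix']
  rw [gramDet_eq, gramDet_eq, hG, Matrix.det_mul, Matrix.det_mul, Matrix.det_conjTranspose, hd,
    ← Complex.normSq_eq_norm_sq, Complex.normSq_eq_conj_mul_self, Complex.star_def]
  ring

/-- The logarithm of the determinant of the Gram matrix of `g` in the frame `e`. -/
def logDet (p : M) : ℝ := Real.log (g.gramDet e p).re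

-- For holomorphic frames the correction term is pluriharmonic. It also shows that the
-- log-determinants split the logarithm of the absolute value of the determinant cocycle.
variable {e e'} in
theorem logDet_change {p : M} (h : p ∈ e.baseSet) (h' : p ∈ e'.baseSet) :
    logDet e g p = logDet e' g p + 2 * Real.log ‖(detChange e e' p : ℂ)‖ := by
  have hp : ‖(detChange e e' p : ℂ)‖ ≠ 0 := norm_ne_zero_iff.2 (Units.ne_zero _)
  rw [logDet, logDet, gramDet_change g h h', Complex.re_ofReal_mul,
    Real.log_mul (pow_ne_zero 2 hp) (gramDet_pos g h').ne', Real.log_pow]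
  push_cast
  ring

variable {e} in
theorem contMDiffAt_logDet {p : M} (h : p ∈ e.baseSet) :
    ContMDiffAt I 𝓘(ℝ, ℝ) ∞ (logDet e g) p := by
  have h1 : ContMDiffAt I 𝓘(ℝ, Fin r → Fin r → ℂ) ∞
      (fun q => (fun i j => g.form q (e.symm q (Pi.single i 1)) (e.symm q (Pi.single j 1)))) p := by
    rw [contMDiffAt_pi_space]
    intro i
    rw [contMDiffAt_pi_space]
    intro j
    exact (g.smooth e _ _).contMDiffAt (e.open_baseSet.mem_nhds h)
  have h2 : ContDiff ℝ ∞ fun A : Fin r → Fin r → ℂ => (Matrix.of A).det.re := by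
    refine Complex.reCLM.contDiff.comp ?_
    have : (fun A : Fin r → Fin r → ℂ => (Matrix.of A).det) = fun A =>
        ∑ σ : Equiv.Perm (Fin r), ((Equiv.Perm.sign σ : ℤ) : ℂ) * ∏ i, A (σ i) i := by
      funext A
      rw [Matrix.det_apply']
      rfl
    rw [this]
    refine ContDiff.sum fun σ _ => contDiff_const.mul (contDiff_prod fun i _ => ?_)
    exact (contDiff_apply_apply ℝ ℂ (σ i) i)
  have h3 : ContDiffAt ℝ ∞ Real.log (g.gramDet e p).re :=
    Real.contDiffAt_log.2 (gramDet_pos g h).ne'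
  exact (ContMDiffAt.comp (g := Real.log) p h3.contMDiffAt
    (h2.contMDiff.contMDiffAt.comp p h1))

end Metric

end Frames

/-! ### Frames and metrics restricted to the fibres of the family. -/

section Slices

variable {VX : Type*} [NormedAddCommGroup VX] [NormedSpace ℂ VX]
  {VU : Type*} [NormedAddCommGroup VU] [NormedSpace ℂ VU]
  {X : Type*} [TopologicalSpace X] [ChartedSpace VX X]
  {U : Type*} [TopologicalSpace U] [ChartedSpace VU U]
  {r : ℕ} {E : X × U → Type*} [TopologicalSpace (TotalSpace (Fin r → ℂ) E)]
  [∀ p, TopologicalSpace (E p)] [∀ p, AddCommGroup (E p)] [∀ p, Module ℂ (E p)]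
  [FiberBundle (Fin r → ℂ) E] [VectorBundle ℂ (Fin r → ℂ) E]

theorem pullback_symm (e : Trivialization (Fin r → ℂ) (π (Fin r → ℂ) E)) [MemTrivializationAtlas e]
    {t : U} {x : X} (hx : (x, t) ∈ e.baseSet) (u : Fin r → ℂ) :
    (e.pullback (slice VX VU X t)).symm x u = e.symm (x, t) u := by
  have h := (e.pullback (slice VX VU X t)).symm_apply_apply_mk hx (e.symm (x, t) u)
  have h' : ((e.pullback (slice VX VU X t)) ⟨x, e.symm (x, t) u⟩).2 = u :=
    congrArg Prod.snd (e.apply_mk_symm hx u)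
  rw [h'] at h
  exact h

instance pullback_mem (e : Trivialization (Fin r → ℂ) (π (Fin r → ℂ) E))
    [he : MemTrivializationAtlas e] (t : U) :
    MemTrivializationAtlas (F := Fin r → ℂ) (E := Fibre VX VU E t)
      (e.pullback (slice VX VU X t)) :=
  ⟨⟨e, he, rfl⟩⟩

theorem detChange_pullback (e e' : Trivialization (Fin r → ℂ) (π (Fin r → ℂ) E))
    [MemTrivializationAtlas e] [MemTrivializationAtlas e'] {t : U} {x : X}
    (hx : (x, t) ∈ e.baseSet) (hx' : (x, t) ∈ e'.baseSet) :
    detChange (E := Fibre VX VU E t) (e.pullback (slice VX VU X t))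
      (e'.pullback (slice VX VU X t)) x = detChange e e' (x, t) := by
  unfold detChange
  congr 1
  ext1 v
  change (Trivialization.coordChangeL ℂ _ _ x) v = (Trivialization.coordChangeL ℂ _ _ (x, t)) v
  rw [Trivialization.coordChangeL_apply _ _ ⟨hx, hx'⟩]
  rw [Trivialization.coordChangeL_apply (e.pullback (slice VX VU X t))
    (e'.pullback (slice VX VU X t)) ⟨hx, hx'⟩, pullback_symm e hx]
  rfl

theorem logDet_pullback (g : HermitianMetric (𝓘(ℝ, VX).prod 𝓘(ℝ, VU)) r E)
    (e : Trivialization (Fin r → ℂ) (π (Fin r → ℂ) E)) [MemTrivializationAtlas e] {t : U} {x : X}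
    (hx : (x, t) ∈ e.baseSet) :
    logDet (E := Fibre VX VU E t) (e.pullback (slice VX VU X t)) (g.restrict t) x =
      logDet e g (x, t) := by
  unfold logDet HermitianMetric.gramDet
  simp only [pullback_symm e hx]
  rfl

end Slices

open FunctionSheaf

/-! ### Real classes and pluriharmonic corrections. -/

section RealClasses

variable {V : Type*} [NormedAddCommGroup V] [NormedSpace ℂ V]
  {M : Type*} [TopologicalSpace M] [ChartedSpace V M]

/-- If `exp f` and `D` differ by the coboundary of `h` and `2 log ‖D‖` is the coboundary of `S`,
then the imaginary part of `f` is a coboundary. -/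
theorem im_eq_of_expHom_sub {f : ℂ} {D h h' : Additive ℂˣ} {S S' : ℝ}
    (e : expHom f - D = h' - h) (hS : S' - S = 2 * Real.log ‖(D.toMul : ℂ)‖) :
    -(2 * Real.pi * f.im) = (S' / 2 + Real.log ‖(h'.toMul : ℂ)‖) -
      (S / 2 + Real.log ‖(h.toMul : ℂ)‖) := by
  have hn : ∀ d : Additive ℂˣ, ‖(d.toMul : ℂ)‖ ≠ 0 := fun d => norm_ne_zero_iff.2 (Units.ne_zero _)
  have e1 : expHom f + h = h' + D := by
    rw [sub_eq_sub_iff_add_eq_add] at e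
    exact e
  have e2 : ‖Complex.exp (2 * Real.pi * Complex.I * f)‖ * ‖(h.toMul : ℂ)‖ =
      ‖(h'.toMul : ℂ)‖ * ‖(D.toMul : ℂ)‖ := by
    rw [← expHom_toMul, ← norm_mul, ← norm_mul, ← Units.val_mul, ← Units.val_mul, ← toMul_add,
      ← toMul_add, e1]
  have e3 := congrArg Real.log e2
  rw [Real.log_mul (by simp) (hn _), Real.log_mul (hn _) (hn _), Complex.norm_exp,
    Real.log_exp] at e3
  have e4 : (2 * Real.pi * Complex.I * f).re = -(2 * Real.pi * f.im) := by
    simp [Complex.mul_re, Complex.mul_im]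
  rw [e4] at e3
  linarith

variable [IsManifold 𝓘(ℂ, V) ω M]

/-- Let `D` be a multiplicative cocycle for which `2 log ‖D‖` is the coboundary of the real
cochain `S`.  A class in `Pic⁰` over the class of `D` is real if and only if `S` can be made
pluriharmonic by adding a global function. -/
theorem mem_realPic0_iff {D : M → M → M → Additive ℂˣ}
    (hD : D ∈ (holoUnitsSheaf 𝓘(ℂ, V) M).cocycles) {S : M → M → ℝ} {Z : M → Opens M}
    (hZ : ∀ a, a ∈ Z a)
    (hS : ∀ a b, ∀ x ∈ Z a ⊓ Z b, S b x - S a x = 2 * Real.log ‖((D a b x).toMul : ℂ)‖)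
    {c : Pic0 𝓘(ℂ, V) M} (hc : Pic0.toPic 𝓘(ℂ, V) M c = H1.mk _ D hD) :
    c ∈ realPic0 𝓘(ℂ, V) M ↔ ∃ u : M → ℝ, ∀ a, IsReHolomorphicAt V (fun x => S a x + u x) a := by
  constructor
  · rintro ⟨_, ⟨ρ, rfl⟩, rfl⟩
    obtain ⟨m, hm, rfl⟩ := H1_mk_surjective _ ρ
    obtain ⟨hm', e⟩ := realToHolo_mk (V := V) m hm
    obtain ⟨hm'', e'⟩ := expH1_mk _ hm'
    have hc' : expH1 𝓘(ℂ, V) M (realToHolo 𝓘(ℂ, V) M (H1.mk _ m hm)) = H1.mk _ D hD := hc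
    rw [e, e'] at hc'
    obtain ⟨W, h, hW, hh, hfh⟩ := H1_mk_eq_iff.1 hc'
    -- Since the cocycle is real, `S a / 2 + log |h a|` is independent of `a` on overlaps and
    -- defines a global function, evaluated here at the index `x` itself. Adding its multiple by
    -- `-2` turns `S a` into `-2 log |h a|`.
    refine ⟨fun x => -2 * (S x x / 2 + Real.log ‖((h x x).toMul : ℂ)‖), fun a => ?_⟩
    refine ((IsReHolomorphicAt.log_norm (hh a a (hW a)) (Units.ne_zero _)).const_mul (-2)).congr ?_
    filter_upwards [(Z a).isOpen.mem_nhds (hZ a), (W a).isOpen.mem_nhds (hW a)] with x hx hx'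
    have := im_eq_of_expHom_sub (hfh a x x ⟨hx', hW x⟩) (hS a x x ⟨hx, hZ x⟩)
    simp only [Complex.ofReal_im] at this
    linarith
  · rintro ⟨u, hu⟩
    induction c using QuotientAddGroup.induction_on with
    | H c =>
    obtain ⟨f, hf, rfl⟩ := H1_mk_surjective _ c
    obtain ⟨hf', e⟩ := expH1_mk f hf
    have hc' : expH1 𝓘(ℂ, V) M (H1.mk _ f hf) = H1.mk _ D hD := hc
    rw [e] at hc'
    obtain ⟨W, h, hW, hh, hfh⟩ := H1_mk_eq_iff.1 hc'
    have hf₀ := hf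
    obtain ⟨W', hW', hf1, hf2⟩ := hf₀
    -- The global function `u` drops out of coboundaries, so these pluriharmonic functions have the
    -- coboundary `-2π Im f`; holomorphic functions with these real parts will correct `f` to a real
    -- cocycle.
    have hT : ∀ a, IsReHolomorphicAt V
        (fun x => S a x / 2 + Real.log ‖((h a x).toMul : ℂ)‖ + u x / 2) a := fun a => by
      refine (((hu a).const_mul (1 / 2)).add
        (IsReHolomorphicAt.log_norm (hh a a (hW a)) (Units.ne_zero _))).congr ?_
      exact Eventually.of_forall fun x => by ring
    choose l hl hl' using hT
    have hl0 := fun a => (contMDiffAt_iff_contMDiffAt_nhds (by simp)).1 (hl a)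
    obtain ⟨Y, hY, hYl⟩ := exists_opens_of_eventually fun a => (hl0 a).and (hl' a)
    let A : M → Opens M := fun a => Z a ⊓ W a ⊓ W' a ⊓ Y a
    have hA : ∀ a, a ∈ A a := fun a => ⟨⟨⟨hZ a, hW a⟩, hW' a⟩, hY a⟩
    have hp : (2 * Real.pi * Complex.I : ℂ) ≠ 0 := by simp [Real.pi_ne_zero]
    -- Division by `2πi` makes the imaginary part of `k a` equal to `-Re (l a) / 2π`, so that
    -- subtracting the coboundary of `k` removes the imaginary part of `f`.
    let k : M → M → ℂ := fun a x => l a x / (2 * Real.pi * Complex.I)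
    have hk : ∀ a, ∀ x ∈ A a, ContMDiffAt 𝓘(ℂ, V) 𝓘(ℂ, ℂ) ω (k a) x := fun a x hx => by
      have h1 : ContDiff ℂ ω fun z : ℂ => z / (2 * Real.pi * Complex.I) :=
        contDiff_id.div_const _
      exact h1.contMDiff.contMDiffAt.comp x (hYl a x hx.2).1
    have him : ∀ a b, ∀ x ∈ A a ⊓ A b, (f a b x - (k b x - k a x)).im = 0 := by
      rintro a b x ⟨⟨⟨⟨ha1, ha2⟩, ha3⟩, ha4⟩, ⟨⟨hb1, hb2⟩, hb3⟩, hb4⟩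
      have e1 := im_eq_of_expHom_sub (hfh a b x ⟨ha2, hb2⟩) (hS a b x ⟨ha1, hb1⟩)
      have e2 := (hYl a x ha4).2
      have e3 := (hYl b x hb4).2
      have e4 : ∀ a, (k a x).im = -(l a x).re / (2 * Real.pi) := fun a => by
        have : l a x = 2 * Real.pi * Complex.I * k a x := (mul_div_cancel₀ _ hp).symm
        rw [this]
        simp only [Complex.mul_re, Complex.mul_im, Complex.ofReal_re, Complex.ofReal_im,
          Complex.I_re, Complex.I_im, Complex.re_ofNat, Complex.im_ofNat]
        field_simp
        ring
      rw [Complex.sub_im, Complex.sub_im, e4, e4]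
      have := Real.pi_pos
      field_simp
      linarith
    let m : M → M → M → ℝ := fun a b x => (f a b x - (k b x - k a x)).re
    have hm : ∀ a b, ∀ x ∈ A a ⊓ A b, (m a b x : ℂ) = f a b x - (k b x - k a x) :=
      fun a b x hx => Complex.ext rfl (him a b x hx).symm
    have hmc : m ∈ (constSheaf M ℝ).cocycles := by
      refine ⟨A, hA, fun a b x hx => ?_, fun a b c x hx => ?_⟩
      · have h1 : (holoSheaf 𝓘(ℂ, V) M).IsSectionAt (f a b + -(k b + -k a)) x :=
          (holoSheaf 𝓘(ℂ, V) M).add (hf1 a b x ⟨hx.1.1.2, hx.2.1.2⟩)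
            ((holoSheaf 𝓘(ℂ, V) M).neg ((holoSheaf 𝓘(ℂ, V) M).add (hk b x hx.2)
              ((holoSheaf 𝓘(ℂ, V) M).neg (hk a x hx.1))))
        have h2 : ContMDiffAt 𝓘(ℂ, V) 𝓘(ℂ, ℂ) ω (fun y => f a b y - (k b y - k a y)) x := by
          refine ContMDiffAt.congr_of_eventuallyEq h1 (Eventually.of_forall fun y => ?_)
          simp only [Pi.add_apply, Pi.neg_apply]
          ring
        have := eventually_eq_of_im_eq_zero h2
          (Filter.mem_of_superset ((A a ⊓ A b).isOpen.mem_nhds hx) fun y hy => him a b y hy)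
        filter_upwards [this] with y hy
        simp only [m, hy]
      · have e1 := hf2 a b c x ⟨⟨hx.1.1.1.2, hx.1.2.1.2⟩, hx.2.1.2⟩
        simp only [m]
        rw [← Complex.add_re]
        congr 1
        rw [← e1]
        ring
    obtain ⟨hm', e⟩ := realToHolo_mk (V := V) m hmc
    refine ⟨_, ⟨H1.mk _ m hmc, rfl⟩, congrArg _ (e.trans (H1_mk_eq_iff.2 ?_))⟩
    refine ⟨A, fun a x => -k a x, hA, fun a x hx => ?_, fun a b x hx => ?_⟩
    · exact (holoSheaf 𝓘(ℂ, V) M).neg (hk a x hx)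
    · simp only [Pi.sub_apply]
      rw [hm a b x hx]
      ring

variable {r : ℕ} {E₀ E₁ : M → Type*}
  [TopologicalSpace (TotalSpace (Fin r → ℂ) E₀)]
  [∀ p, TopologicalSpace (E₀ p)] [∀ p, AddCommMonoid (E₀ p)] [∀ p, Module ℂ (E₀ p)]
  [FiberBundle (Fin r → ℂ) E₀] [VectorBundle ℂ (Fin r → ℂ) E₀]
  [ContMDiffVectorBundle ω (Fin r → ℂ) E₀ 𝓘(ℂ, V)]
  [TopologicalSpace (TotalSpace (Fin r → ℂ) E₁)]
  [∀ p, TopologicalSpace (E₁ p)] [∀ p, AddCommMonoid (E₁ p)] [∀ p, Module ℂ (E₁ p)]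
  [FiberBundle (Fin r → ℂ) E₁] [VectorBundle ℂ (Fin r → ℂ) E₁]
  [ContMDiffVectorBundle ω (Fin r → ℂ) E₁ 𝓘(ℂ, V)]

/-- The class in `Pic⁰` of the difference of the determinants of two bundles with metrics is real
if and only if the curvatures of the two metrics agree after a conformal change. -/
theorem mem_realPic0_iff_logDet (g₀ : HermitianMetric 𝓘(ℝ, V) r E₀)
    (g₁ : HermitianMetric 𝓘(ℝ, V) r E₁) {c : Pic0 𝓘(ℂ, V) M}
    (hc : Pic0.toPic 𝓘(ℂ, V) M c = detClass 𝓘(ℂ, V) r E₁ - detClass 𝓘(ℂ, V) r E₀) :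
    c ∈ realPic0 𝓘(ℂ, V) M ↔ ∃ u : M → ℝ, ∀ a, IsReHolomorphicAt V
      (fun x => logDet (trivializationAt (Fin r → ℂ) E₁ a) g₁ x + u x -
        logDet (trivializationAt (Fin r → ℂ) E₀ a) g₀ x) a := by
  have h := mem_realPic0_iff (V := V) (c := c) (D := detTransition r E₁ - detTransition r E₀)
    (S := fun a x => logDet (trivializationAt (Fin r → ℂ) E₁ a) g₁ x -
        logDet (trivializationAt (Fin r → ℂ) E₀ a) g₀ x)
    (Z := fun a => ⟨(trivializationAt (Fin r → ℂ) E₁ a).baseSet ∩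
      (trivializationAt (Fin r → ℂ) E₀ a).baseSet,
      (trivializationAt (Fin r → ℂ) E₁ a).open_baseSet.inter
        (trivializationAt (Fin r → ℂ) E₀ a).open_baseSet⟩)
    (AddSubgroup.sub_mem _ (detTransition_mem 𝓘(ℂ, V) r E₁) (detTransition_mem 𝓘(ℂ, V) r E₀))
    (fun a => ⟨FiberBundle.mem_baseSet_trivializationAt' a,
      FiberBundle.mem_baseSet_trivializationAt' a⟩)
    (by
      rintro a b x ⟨⟨h1, h0⟩, h1', h0'⟩
      have e1 := logDet_change g₁ h1' h1
      have e0 := logDet_change g₀ h0' h0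
      simp only [Pi.sub_apply, detTransition_eq, toMul_sub, toMul_ofMul,
        Units.val_div_eq_div_val, norm_div]
      rw [Real.log_div (norm_ne_zero_iff.2 (Units.ne_zero _))
        (norm_ne_zero_iff.2 (Units.ne_zero _)), e1, e0]
      ring) hc
  rw [h]
  refine exists_congr fun u => forall_congr' fun a => ?_
  have : (fun x => logDet (trivializationAt (Fin r → ℂ) E₁ a) g₁ x -
        logDet (trivializationAt (Fin r → ℂ) E₀ a) g₀ x + u x) =
      fun x => logDet (trivializationAt (Fin r → ℂ) E₁ a) g₁ x + u x -
        logDet (trivializationAt (Fin r → ℂ) E₀ a) g₀ x := by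
    funext x
    ring
  rw [this]

end RealClasses

open FunctionSheaf

/-! ### Determinant classes in arbitrary frames, and logarithms of cocycles. -/

section DetClass

variable {V : Type*} [NormedAddCommGroup V] [NormedSpace ℂ V]
  {M : Type*} [TopologicalSpace M] [ChartedSpace V M]
  {r : ℕ} {E : M → Type*} [TopologicalSpace (TotalSpace (Fin r → ℂ) E)]
  [∀ p, TopologicalSpace (E p)] [∀ p, AddCommMonoid (E p)] [∀ p, Module ℂ (E p)]
  [FiberBundle (Fin r → ℂ) E] [VectorBundle ℂ (Fin r → ℂ) E]
  [ContMDiffVectorBundle ω (Fin r → ℂ) E 𝓘(ℂ, V)]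

/-- The class of the determinant can be computed in arbitrary local frames. -/
theorem detClass_eq (e : M → Trivialization (Fin r → ℂ) (π (Fin r → ℂ) E))
    [∀ a, MemTrivializationAtlas (e a)] (he : ∀ a, a ∈ (e a).baseSet) :
    ∃ h, detClass 𝓘(ℂ, V) r E = H1.mk (holoUnitsSheaf 𝓘(ℂ, V) M)
      (fun a b x => Additive.ofMul (detChange (e b) (e a) x)) h := by
  have hc : (fun a b x => Additive.ofMul (detChange (e b) (e a) x)) ∈
      (holoUnitsSheaf 𝓘(ℂ, V) M).cocycles := by
    refine ⟨fun a => ⟨(e a).baseSet, (e a).open_baseSet⟩, he, fun a b x hx => ?_,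
      fun a b c x hx => ?_⟩
    · exact contMDiffAt_detChange (e := e b) (e' := e a) hx.2 hx.1
    · rw [← ofMul_mul, detChange_mul (e := e c) (e' := e b) (e'' := e a) hx.2 hx.1.2 hx.1.1]
  refine ⟨hc, H1_mk_eq_iff.2 ?_⟩
  -- The cocycles in the two systems of frames differ by the coboundary of the determinants of the
  -- changes between the two frames at each `a`.
  refine ⟨fun a => ⟨(e a).baseSet ∩ (trivializationAt (Fin r → ℂ) E a).baseSet,
    (e a).open_baseSet.inter (trivializationAt (Fin r → ℂ) E a).open_baseSet⟩,
    fun a x => Additive.ofMul (detChange (trivializationAt (Fin r → ℂ) E a) (e a) x),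
    fun a => ⟨he a, FiberBundle.mem_baseSet_trivializationAt' a⟩, fun a x hx => ?_,
    fun a b x hx => ?_⟩
  · exact contMDiffAt_detChange (e := trivializationAt (Fin r → ℂ) E a) (e' := e a) hx.2 hx.1
  · obtain ⟨⟨h1, h2⟩, h3, h4⟩ := hx
    simp only [Pi.sub_apply, detTransition_eq]
    rw [sub_eq_sub_iff_add_eq_add, ← ofMul_mul, ← ofMul_mul, mul_comm _ (detChange (e b) (e a) x),
      detChange_mul (e := trivializationAt (Fin r → ℂ) E b) (e' := e b) (e'' := e a) h4 h3 h1,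
      mul_comm, detChange_mul (e := trivializationAt (Fin r → ℂ) E b)
        (e' := trivializationAt (Fin r → ℂ) E a) (e'' := e a) h4 h2 h1]

/-- A multiplicative cocycle with values in the right half plane has a logarithm. -/
theorem mem_range_expH1_of_re_pos {D : M → M → M → Additive ℂˣ}
    (hD : D ∈ (holoUnitsSheaf 𝓘(ℂ, V) M).cocycles) {Z : M → Opens M} (hZ : ∀ a, a ∈ Z a)
    (hre : ∀ a b, ∀ x ∈ Z a ⊓ Z b, 0 < ((D a b x).toMul : ℂ).re) :
    H1.mk _ D hD ∈ (expH1 𝓘(ℂ, V) M).range := by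
  have hD₀ := hD
  obtain ⟨W, hW, hD1, hD2⟩ := hD₀
  have hp : (2 * Real.pi * Complex.I : ℂ) ≠ 0 := by simp [Real.pi_ne_zero]
  let f : M → M → M → ℂ := fun a b x => Complex.log ((D a b x).toMul : ℂ) / (2 * Real.pi * Complex.I)
  have hf : f ∈ (holoSheaf 𝓘(ℂ, V) M).cocycles := by
    refine ⟨fun a => Z a ⊓ W a, fun a => ⟨hZ a, hW a⟩, ?_, ?_⟩
    · rintro a b x ⟨⟨h1, h2⟩, h3, h4⟩
      have e1 : ContDiffAt ℂ ω (fun z => Complex.log z / (2 * Real.pi * Complex.I))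
          ((D a b x).toMul : ℂ) :=
        (Complex.contDiffAt_log (Or.inl (hre a b x ⟨h1, h3⟩))).div_const _
      exact ContMDiffAt.comp (g := fun z => Complex.log z / (2 * Real.pi * Complex.I)) x
        e1.contMDiffAt (hD1 a b x ⟨h2, h4⟩)
    · rintro a b c x ⟨⟨⟨h1, h2⟩, h3, h4⟩, h5, h6⟩
      have e1 := hre a b x ⟨h1, h3⟩
      have e2 := hre b c x ⟨h3, h5⟩
      have e3 := congrArg (fun d : Additive ℂˣ => (d.toMul : ℂ)) (hD2 a b c x ⟨⟨h2, h4⟩, h6⟩)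
      simp only [toMul_add, Units.val_mul] at e3
      simp only [f]
      -- Both arguments lie strictly between `-π/2` and `π/2`, so their sum stays within the range
      -- of the principal branch and the logarithm is additive.
      rw [← e3, Complex.log_mul (Units.ne_zero _) (Units.ne_zero _), add_div]
      have a1 := Complex.abs_arg_lt_pi_div_two_iff.2 (Or.inl e1)
      have a2 := Complex.abs_arg_lt_pi_div_two_iff.2 (Or.inl e2)
      rw [abs_lt] at a1 a2
      constructor <;> linarith [a1.1, a1.2, a2.1, a2.2]
  obtain ⟨hf', e⟩ := expH1_mk (V := V) f hf
  refine ⟨H1.mk _ f hf, ?_⟩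
  rw [e]
  refine H1_mk_eq_iff.2 ⟨Z, 0, hZ, fun a x _ => (holoUnitsSheaf 𝓘(ℂ, V) M).zero x,
    fun a b x _ => ?_⟩
  simp only [Pi.sub_apply, Pi.zero_apply, sub_self, sub_eq_zero]
  refine additive_units_ext ?_
  rw [expHom_toMul]
  simp only [f]
  rw [mul_div_cancel₀ _ hp, Complex.exp_log (Units.ne_zero _)]

end DetClass

/-! ### The determinant map of the family. -/

section Family

variable {VX : Type*} [NormedAddCommGroup VX] [NormedSpace ℂ VX]
  {VU : Type*} [NormedAddCommGroup VU] [NormedSpace ℂ VU]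
  {X : Type*} [TopologicalSpace X] [ChartedSpace VX X]
  {U : Type*} [TopologicalSpace U] [ChartedSpace VU U]
  {r : ℕ} {E : X × U → Type*} [TopologicalSpace (TotalSpace (Fin r → ℂ) E)]
  [∀ p, TopologicalSpace (E p)] [∀ p, AddCommGroup (E p)] [∀ p, Module ℂ (E p)]
  [FiberBundle (Fin r → ℂ) E] [VectorBundle ℂ (Fin r → ℂ) E]
  [ContMDiffVectorBundle ω (Fin r → ℂ) E (𝓘(ℂ, VX).prod 𝓘(ℂ, VU))]

/-- Frames of the family around `X × {t₀}` serve for both `E_t` and `E_{t₀}`. By compactness, on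
finitely many overlaps with compact closure, the quotients of the transition determinants have
positive real part for `t` near `t₀`, so the quotient cocycle has a logarithm. -/
theorem eventually_detClass_sub_mem [T2Space X] [CompactSpace X] (t₀ : U) : ∀ᶠ t in 𝓝 t₀,
    detClass 𝓘(ℂ, VX) r (Fibre VX VU E t) - detClass 𝓘(ℂ, VX) r (Fibre VX VU E t₀) ∈
      (expH1 𝓘(ℂ, VX) X).range := by
  let τ : X → Trivialization (Fin r → ℂ) (π (Fin r → ℂ) E) :=
    fun a => trivializationAt (Fin r → ℂ) E (a, t₀)
  have hB : ∀ a : X, ∃ B : Set X, IsOpen B ∧ a ∈ B ∧ ∀ x ∈ closure B, (x, t₀) ∈ (τ a).baseSet := by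
    intro a
    have h1 : {x : X | (x, t₀) ∈ (τ a).baseSet} ∈ 𝓝 a :=
      (((τ a).open_baseSet).preimage (by fun_prop : Continuous fun x : X => (x, t₀))).mem_nhds
        (FiberBundle.mem_baseSet_trivializationAt' (a, t₀))
    obtain ⟨K, hK, hKc, hKs⟩ := exists_mem_nhds_isClosed_subset h1
    refine ⟨interior K, isOpen_interior, mem_interior_iff_mem_nhds.2 hK, fun x hx => hKs ?_⟩
    exact closure_minimal interior_subset hKc hx
  choose B hBo haB hBc using hB
  obtain ⟨s, hs⟩ := isCompact_univ.elim_finite_subcover B hBo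
    (fun a _ => mem_iUnion.2 ⟨a, haB a⟩)
  have hi : ∀ a : X, ∃ i ∈ s, a ∈ B i := fun a => by simpa using hs (mem_univ a)
  choose i his hai using hi
  have hev : ∀ j ∈ s, ∀ k ∈ s, ∀ᶠ t in 𝓝 t₀, ∀ x ∈ closure (B j) ∩ closure (B k),
      ((x, t) ∈ (τ j).baseSet ∧ (x, t) ∈ (τ k).baseSet) ∧
      0 < ((detChange (τ k) (τ j) (x, t) : ℂ) / detChange (τ k) (τ j) (x, t₀)).re := by
    intro j _ k _
    refine IsCompact.eventually_forall_of_forall_eventually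
      (isClosed_closure.inter isClosed_closure).isCompact fun x hx => ?_
    have h1 := hBc j x hx.1
    have h2 := hBc k x hx.2
    have c0 : ContinuousAt (fun q : X × U => (detChange (τ k) (τ j) q : ℂ)) (x, t₀) :=
      (contMDiffAt_detChange (I := 𝓘(ℂ, VX).prod 𝓘(ℂ, VU)) h2 h1).continuousAt
    have c1 : ContinuousAt (fun q : U × X => (detChange (τ k) (τ j) (q.2, q.1) : ℂ)) (t₀, x) :=
      ContinuousAt.comp (g := fun q : X × U => (detChange (τ k) (τ j) q : ℂ)) c0
        (by fun_prop : ContinuousAt (fun q : U × X => (q.2, q.1)) (t₀, x))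
    have c2 : ContinuousAt (fun q : U × X => (detChange (τ k) (τ j) (q.2, t₀) : ℂ)) (t₀, x) :=
      ContinuousAt.comp (g := fun q : X × U => (detChange (τ k) (τ j) q : ℂ)) c0
        (by fun_prop : ContinuousAt (fun q : U × X => (q.2, t₀)) (t₀, x))
    have c3 := Complex.continuous_re.continuousAt.comp (c1.div c2 (Units.ne_zero _))
    have hsw : ContinuousAt (fun q : U × X => (q.2, q.1)) (t₀, x) := by fun_prop
    refine ((hsw.eventually ((τ j).open_baseSet.mem_nhds h1)).and
      (hsw.eventually ((τ k).open_baseSet.mem_nhds h2))).and ?_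
    refine c3.eventually_const_lt ?_
    simp [div_self]
  have hev' := (Filter.eventually_all_finset s).2 fun j hj =>
    (Filter.eventually_all_finset s).2 fun k hk => hev j hj k hk
  filter_upwards [hev'] with t ht
  have hcl : ∀ a, ∀ x ∈ B (i a), x ∈ closure (B (i a)) := fun a x hx => subset_closure hx
  obtain ⟨h1, e1⟩ := detClass_eq (V := VX) (E := Fibre VX VU E t)
    (fun a => (τ (i a)).pullback (slice VX VU X t))
    (fun a => (ht _ (his a) _ (his a) a ⟨hcl a a (hai a), hcl a a (hai a)⟩).1.1)
  obtain ⟨h0, e0⟩ := detClass_eq (V := VX) (E := Fibre VX VU E t₀)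
    (fun a => (τ (i a)).pullback (slice VX VU X t₀))
    (fun a => hBc _ _ (hcl a a (hai a)))
  rw [e1, e0]
  have := mem_range_expH1_of_re_pos (AddSubgroup.sub_mem _ h1 h0)
    (Z := fun a => ⟨B (i a), hBo _⟩) hai ?_
  · exact this
  · rintro a b x ⟨ha, hb⟩
    have h2 := ht _ (his a) _ (his b) x ⟨hcl a x ha, hcl b x hb⟩
    simp only [Pi.sub_apply, toMul_sub, toMul_ofMul, Units.val_div_eq_div_val]
    rw [detChange_pullback (τ (i b)) (τ (i a)) h2.1.2 h2.1.1,
      detChange_pullback (τ (i b)) (τ (i a)) (hBc _ _ (hcl b x hb)) (hBc _ _ (hcl a x ha))]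
    exact h2.2

/-- Having determinants that differ by an element of the image of `H¹(𝒪)` is an equivalence relation
on `U` which holds locally, hence on all of the connected space `U`. -/
theorem detClass_sub_mem [T2Space X] [CompactSpace X] [PreconnectedSpace U] (t t' : U) :
    detClass 𝓘(ℂ, VX) r (Fibre VX VU E t) - detClass 𝓘(ℂ, VX) r (Fibre VX VU E t') ∈
      (expH1 𝓘(ℂ, VX) X).range := by
  refine isPreconnected_univ.induction₂ (fun t' t : U =>
    detClass 𝓘(ℂ, VX) r (Fibre VX VU E t) - detClass 𝓘(ℂ, VX) r (Fibre VX VU E t') ∈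
      (expH1 𝓘(ℂ, VX) X).range)
    (fun t₀ _ => (eventually_detClass_sub_mem t₀).filter_mono nhdsWithin_le_nhds) ?_ ?_
    (mem_univ t') (mem_univ t)
  · intro a b c _ _ _ hab hbc
    simpa using AddSubgroup.add_mem _ hbc hab
  · intro a b _ _ hab
    exact (neg_sub (detClass 𝓘(ℂ, VX) r (Fibre VX VU E b)) (detClass 𝓘(ℂ, VX) r (Fibre VX VU E a))) ▸
      AddSubgroup.neg_mem _ hab

/-- The determinant map of a family exists and is unique. -/
theorem existsUnique_isDetMap [IsManifold 𝓘(ℂ, VX) ω X] [T2Space X] [CompactSpace X]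
    [PreconnectedSpace U] (o : U) :
    ∃! η : U → Pic0 𝓘(ℂ, VX) X, IsDetMap VX VU r E o η := by
  choose c hc using fun t : U => detClass_sub_mem (VX := VX) (VU := VU) (r := r) (E := E) t o
  refine ⟨fun t => QuotientAddGroup.mk (c t), fun t => hc t, fun η hη => ?_⟩
  funext t
  exact toPic_injective ((hη t).trans (hc t).symm)

end Family

/-! ### The a priori estimate on a compact manifold. -/

section Estimate

variable (V : Type*) [NormedAddCommGroup V] [NormedSpace ℂ V]
  {X : Type*} [TopologicalSpace X] [ChartedSpace V X]

/-- The function `v` satisfies the mean value property on `O` in the preferred chart at `a`. -/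
def MVChart (a : X) (O : Set X) (v : X → ℝ) : Prop :=
  MVOn (fun u => v ((chartAt V a).symm u)) ((chartAt V a).target ∩ (chartAt V a).symm ⁻¹' O)

variable {V}

theorem MVChart.continuousAt {a x : X} {O : Set X} {v : X → ℝ} (h : MVChart V a O v)
    (hO : IsOpen O) (hx : x ∈ O) (hxa : x ∈ (chartAt V a).source) : ContinuousAt v x := by
  have hm : chartAt V a x ∈ (chartAt V a).target ∩ (chartAt V a).symm ⁻¹' O :=
    ⟨(chartAt V a).map_source hxa, by simpa [(chartAt V a).left_inv hxa] using hx⟩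
  have h1 := h.1.continuousAt (((chartAt V a).isOpen_inter_preimage_symm hO).mem_nhds hm)
  have h2 := ContinuousAt.comp (g := fun u => v ((chartAt V a).symm u)) h1
    ((chartAt V a).continuousAt hxa)
  refine h2.congr ?_
  filter_upwards [(chartAt V a).open_source.mem_nhds hxa] with y hy
  simp [(chartAt V a).left_inv hy]

variable [FiniteDimensional ℂ V]

/-- The Harnack inequality transported by the chart. Its point is that `A` and `K` do not depend on
`v`. -/
theorem exists_harnack_chart {a : X} {O : Set X} (hO : IsOpen O) (ha : a ∈ O) :
    ∃ A : Set X, IsOpen A ∧ a ∈ A ∧ A ⊆ O ∧ ∃ K : ℝ, 1 ≤ K ∧ ∀ v : X → ℝ, MVChart V a O v →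
      (∀ x ∈ O, 0 ≤ v x) → ∀ x ∈ A, ∀ y ∈ A, v y ≤ K * v x := by
  have hm : chartAt V a a ∈ (chartAt V a).target ∩ (chartAt V a).symm ⁻¹' O :=
    ⟨mem_chart_target V a, by simpa using ha⟩
  obtain ⟨ε, hε, hB⟩ := Metric.isOpen_iff.1 ((chartAt V a).isOpen_inter_preimage_symm hO) _ hm
  -- With centres within `ε / 8` of the centre of the chart, two points are at most `r = ε / 4`
  -- apart and balls of radius `3r` stay inside the ball of radius `ε`.
  obtain ⟨K, hK, hK'⟩ := exists_harnack V (r := ε / 4) (by positivity)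
  refine ⟨(chartAt V a).source ∩ chartAt V a ⁻¹' Metric.ball (chartAt V a a) (ε / 8),
    (chartAt V a).isOpen_inter_preimage Metric.isOpen_ball,
    ⟨mem_chart_source V a, Metric.mem_ball_self (by positivity)⟩, ?_, K, hK, ?_⟩
  · rintro x ⟨hx, hx'⟩
    have := (hB (Metric.ball_subset_ball (by linarith) hx')).2
    simpa [(chartAt V a).left_inv hx] using this
  · rintro v hv h0 x ⟨hx, hx'⟩ y ⟨hy, hy'⟩
    have h1 := hK' _ _ Metric.isOpen_ball (hv.mono hB) (fun u hu => h0 _ (hB hu).2)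
      (chartAt V a x) (chartAt V a y) ?_ ?_
    · simpa [(chartAt V a).left_inv hx, (chartAt V a).left_inv hy] using h1
    · refine Metric.closedBall_subset_ball' ?_
      have := Metric.mem_ball.1 hx'
      linarith
    · have e1 := Metric.mem_ball.1 hx'
      have e2 := Metric.mem_ball.1 hy'
      have := dist_triangle_right (chartAt V a y) (chartAt V a x) (chartAt V a a)
      linarith

/-- An a priori estimate: if `w a - u` is pluriharmonic on `O a` for all `a`, then `u` is bounded
by the functions `w a` and by its values at base points of the connected components. -/
theorem exists_estimate (V : Type*) [NormedAddCommGroup V] [NormedSpace ℂ V]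
    [FiniteDimensional ℂ V] {X : Type*} [TopologicalSpace X] [ChartedSpace V X] [CompactSpace X]
    {O : X → Set X} (hO : ∀ a, IsOpen (O a)) (haO : ∀ a, a ∈ O a) {p : X → X}
    (hp : ∀ x, p x ∈ connectedComponent x) :
    ∃ s : Finset X, (∀ x, ∃ a ∈ s, x ∈ O a) ∧ ∃ C : ℝ, ∀ (u : X → ℝ) (w : X → X → ℝ) (δ : ℝ),
      0 ≤ δ → Continuous u → (∀ a ∈ s, ∀ x ∈ O a, |w a x| ≤ δ) →
      (∀ a ∈ s, MVChart V a (O a) (fun x => w a x - u x)) → (∀ x, |u (p x)| ≤ δ) →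
      ∀ x, |u x| ≤ C * δ := by
  choose A hA haA hAO K hK1 hK using fun a => exists_harnack_chart (V := V) (hO a) (haO a)
  obtain ⟨s, hs⟩ := isCompact_univ.elim_finite_subcover A hA
    (fun a _ => mem_iUnion.2 ⟨a, haA a⟩)
  have hi : ∀ x : X, ∃ a ∈ s, x ∈ A a := fun x => by simpa using hs (mem_univ x)
  refine ⟨s, fun x => (hi x).imp fun a h => ⟨h.1, hAO a h.2⟩, ?_⟩
  -- Here `m` is any upper bound of `u`. Then `w a - u + (m + δ)` is nonnegative with the mean value
  -- property, and lies between `m - u` and `m - u + 2δ`, so Harnack controls the oscillation of `m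
  -- - u + 2δ`.
  let Adm : (X → ℝ) → (X → X → ℝ) → ℝ → ℝ → Prop := fun u w δ m =>
    0 ≤ δ ∧ (∀ a ∈ s, ∀ x ∈ O a, |w a x| ≤ δ) ∧
      (∀ a ∈ s, MVChart V a (O a) (fun x => w a x - u x)) ∧ ∀ x, u x ≤ m
  let P : X → X → Prop := fun x y => ∃ C : ℝ, 0 ≤ C ∧ ∀ u w δ m, Adm u w δ m →
    m - u y + 2 * δ ≤ C * (m - u x + 2 * δ)
  have hloc : ∀ a ∈ s, ∀ x ∈ A a, ∀ y ∈ A a, ∀ u w δ m, Adm u w δ m →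
      m - u y + 2 * δ ≤ (K a + 1) * (m - u x + 2 * δ) := by
    rintro a ha x hx y hy u w δ m ⟨hδ, hw, hmv, hm⟩
    have h1 := hK a (fun z => w a z - u z + (m + δ)) ((hmv a ha).add (MVOn.const _ _))
      (fun z hz => by linarith [(abs_le.1 (hw a ha z hz)).1, hm z]) x hx y hy
    have h2 := (abs_le.1 (hw a ha x (hAO a hx))).2
    have h3 := (abs_le.1 (hw a ha y (hAO a hy))).1
    have h4 := hm x
    have h5 : K a * (w a x - u x + (m + δ)) ≤ K a * (m - u x + 2 * δ) :=
      mul_le_mul_of_nonneg_left (by linarith) (by linarith [hK1 a])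
    linarith
  -- The Harnack comparison is local and symmetric, and constants multiply under composition, so it
  -- extends along connected components with a constant independent of the data.
  have hconn : ∀ a, P a (p a) := fun a => by
    refine isPreconnected_connectedComponent.induction₂' P (fun x _ => ?_) ?_
      mem_connectedComponent (hp a)
    · obtain ⟨b, hb, hxb⟩ := hi x
      refine Filter.Eventually.filter_mono nhdsWithin_le_nhds ?_
      filter_upwards [(hA b).mem_nhds hxb] with y hy
      exact ⟨⟨K b + 1, by linarith [hK1 b], hloc b hb x hxb y hy⟩,
        ⟨K b + 1, by linarith [hK1 b], hloc b hb y hy x hxb⟩⟩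
    · rintro x y z _ _ _ ⟨C, hC, h1⟩ ⟨D, hD, h2⟩
      refine ⟨D * C, mul_nonneg hD hC, fun u w δ m hadm => (h2 u w δ m hadm).trans ?_⟩
      rw [mul_assoc]
      exact mul_le_mul_of_nonneg_left (h1 u w δ m hadm) hD
  choose C hC0 hC using hconn
  -- At a maximum point `m - u + 2δ` is just `2δ`. One comparison leads to the centre `a` of a patch
  -- and another to its base point, where `u ≤ δ`; the summand one accounts for this last bound.
  obtain ⟨B, hB⟩ := (s.image fun a => 2 * (C a * (K a + 1)) + 1).exists_le
  replace hB : ∀ a ∈ s, 2 * (C a * (K a + 1)) + 1 ≤ B := fun a ha =>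
    hB _ (Finset.mem_image_of_mem _ ha)
  have key : ∀ (u : X → ℝ) (w : X → X → ℝ) (δ : ℝ),
      0 ≤ δ → Continuous u → (∀ a ∈ s, ∀ x ∈ O a, |w a x| ≤ δ) →
      (∀ a ∈ s, MVChart V a (O a) (fun x => w a x - u x)) → (∀ x, |u (p x)| ≤ δ) →
      ∀ x, u x ≤ B * δ := by
    intro u w δ hδ hu hw hmv hup x
    obtain ⟨x₀, -, hx₀⟩ := isCompact_univ.exists_isMaxOn ⟨x, mem_univ x⟩ hu.continuousOn
    obtain ⟨a, ha, hxa⟩ := hi x₀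
    have hadm : Adm u w δ (u x₀) := ⟨hδ, hw, hmv, fun y => hx₀ (mem_univ y)⟩
    have h1 := hloc a ha x₀ hxa a (haA a) u w δ _ hadm
    have h2 := hC a u w δ _ hadm
    have h3 := mul_le_mul_of_nonneg_left h1 (hC0 a)
    have h4 := (abs_le.1 (hup a)).2
    have h5 := mul_le_mul_of_nonneg_right (hB a ha) hδ
    have h6 : u x ≤ u x₀ := hx₀ (mem_univ x)
    nlinarith
  refine ⟨B, fun u w δ hδ hu hw hmv hup x => abs_le.2 ⟨?_, key u w δ hδ hu hw hmv hup x⟩⟩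
  have := key (fun x => -u x) (fun a x => -w a x) δ hδ hu.neg
    (fun a ha x hx => by simpa using hw a ha x hx)
    (fun a ha => (hmv a ha).neg.congr fun z _ => by ring) (fun x => by simpa using hup x) x
  linarith

end Estimate

/-! ### Dependence of normalized solutions on the parameter. -/

section Parameters

variable {V : Type*} [NormedAddCommGroup V] [NormedSpace ℂ V]
  {W : Type*} [NormedAddCommGroup W] [NormedSpace ℂ W]

/-- Averages over the discs of the parameter space preserve the mean value property. -/
theorem MVOn.circleAverage [FiniteDimensional ℂ V] {F : V → W → ℝ} {B : Set V} {N : Set W}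
    (hB : IsOpen B)
    (hc : ContinuousOn (fun q : V × W => F q.1 q.2) (B ×ˢ N)) (hF : ∀ σ ∈ N, MVOn (fun v => F v σ) B)
    {σ ξ : W} (h : ∀ ζ : ℂ, ‖ζ‖ ≤ 1 → σ + ζ • ξ ∈ N) :
    MVOn (fun v => Real.circleAverage (fun ζ => F v (σ + ζ • ξ)) 0 1) B := by
  have hcirc : ∀ θ : ℝ, ‖circleMap 0 1 θ‖ ≤ 1 := fun θ => by simp
  constructor
  · rw [continuousOn_iff_continuous_domRestrict]
    have : ProperSpace V := FiniteDimensional.proper ℂ V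
    have : LocallyCompactSpace B := hB.locallyCompactSpace
    have h1 : Continuous fun q : B × ℝ => F q.1 (σ + circleMap 0 1 q.2 • ξ) := by
      refine hc.comp_continuous (f := fun q : B × ℝ => ((q.1 : V), σ + circleMap 0 1 q.2 • ξ))
        (by fun_prop) fun q => ⟨q.1.2, h _ (hcirc _)⟩
    have h2 := intervalIntegral.continuous_parametric_intervalIntegral_of_continuous'
      (μ := MeasureTheory.volume) (f := fun (v : B) (θ : ℝ) => F v (σ + circleMap 0 1 θ • ξ))
      h1 0 (2 * Real.pi)
    exact h2.const_smul (2 * Real.pi)⁻¹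
  · intro v η hv
    have h1 : Continuous fun q : ℝ × ℝ =>
        F (v + circleMap 0 1 q.1 • η) (σ + circleMap 0 1 q.2 • ξ) := by
      refine hc.comp_continuous
        (f := fun q : ℝ × ℝ => (v + circleMap 0 1 q.1 • η, σ + circleMap 0 1 q.2 • ξ))
        (by fun_prop) fun q => ⟨hv _ (hcirc _), h _ (hcirc _)⟩
    have h2 : ∀ θ : ℝ, Real.circleAverage (fun ζ => F (v + ζ • η) (σ + circleMap 0 1 θ • ξ)) 0 1 =
        F v (σ + circleMap 0 1 θ • ξ) := fun θ => (hF _ (h _ (hcirc _))).2 v η hv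
    simp only [Real.circleAverage_def] at h2 ⊢
    rw [intervalIntegral.integral_smul]
    rw [MeasureTheory.intervalIntegral_intervalIntegral_swap]
    · rw [← intervalIntegral.integral_smul]
      simp only [h2]
    · exact h1.continuousOn.integrableOn_compact (isCompact_uIcc.prod isCompact_uIcc) |>.mono_set
        (prod_mono uIoc_subset_uIcc uIoc_subset_uIcc)

variable [FiniteDimensional ℂ V] {X : Type*} [TopologicalSpace X] [ChartedSpace V X]
  {O : X → Set X} {s : Finset X} {p i : X → X} {C : ℝ} {N : Set W} {R : X → X → W → ℝ}
  {u : X → W → ℝ}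

theorem continuous_of_mvChart (hO : ∀ a, IsOpen (O a)) (hOs : ∀ a, O a ⊆ (chartAt V a).source)
    (hi : ∀ x, i x ∈ s ∧ x ∈ O (i x)) {f : X → X → ℝ} {w : X → ℝ}
    (hf : ∀ a ∈ s, ∀ x ∈ O a, ContinuousAt (f a) x)
    (hw : ∀ a ∈ s, MVChart V a (O a) (fun x => f a x + w x)) : Continuous w := by
  refine continuous_iff_continuousAt.2 fun x => ?_
  have h1 := (hw _ (hi x).1).continuousAt (hO _) (hi x).2 (hOs _ (hi x).2)
  refine (h1.sub (hf _ (hi x).1 x (hi x).2)).congr (Eventually.of_forall fun y => ?_)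
  simp

/-- Normalized solutions `u` of the equations `R a + u = ` pluriharmonic depend continuously on
the parameter. -/
theorem continuousAt_of_normalized (hO : ∀ a, IsOpen (O a))
    (hOs : ∀ a, O a ⊆ (chartAt V a).source) {K : X → Set X} (hK : ∀ a, IsCompact (K a))
    (hOK : ∀ a, O a ⊆ K a) (hi : ∀ x, i x ∈ s ∧ x ∈ O (i x))
    (hC : ∀ (u : X → ℝ) (w : X → X → ℝ) (δ : ℝ),
      0 ≤ δ → Continuous u → (∀ a ∈ s, ∀ x ∈ O a, |w a x| ≤ δ) →
      (∀ a ∈ s, MVChart V a (O a) (fun x => w a x - u x)) → (∀ x, |u (p x)| ≤ δ) →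
      ∀ x, |u x| ≤ C * δ)
    (hN : IsOpen N)
    (hR : ∀ a ∈ s, ∀ x ∈ K a, ∀ σ ∈ N, ContinuousAt (fun q : X × W => R a q.1 q.2) (x, σ))
    (hu : ∀ σ ∈ N, ∀ a ∈ s, MVChart V a (O a) (fun x => R a x σ + u x σ))
    (hp : ∀ σ ∈ N, ∀ x, u (p x) σ = -R (i (p x)) (p x) σ) {x : X} {σ : W} (hσ : σ ∈ N) :
    ContinuousAt (fun q : X × W => u q.1 q.2) (x, σ) := by
  have hRx : ∀ σ ∈ N, ∀ a ∈ s, ∀ x ∈ O a, ContinuousAt (fun y => R a y σ) x :=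
    fun σ hσ a ha x hx => ContinuousAt.comp (g := fun q : X × W => R a q.1 q.2)
      (f := fun y => (y, σ)) (hR a ha x (hOK a hx) σ hσ) (by fun_prop)
  have hcont : ∀ σ ∈ N, Continuous fun x => u x σ := fun σ hσ =>
    continuous_of_mvChart hO hOs hi (f := fun a y => R a y σ) (hRx σ hσ) (hu σ hσ)
  have hunif : ∀ ε > 0, ∀ᶠ τ in 𝓝 σ, ∀ y, |u y τ - u y σ| ≤ ε := by
    intro ε hε
    -- The sign of `C` is not known, hence the absolute value; adding one avoids division by zero.
    have hδ : 0 < ε / (|C| + 1) := by positivity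
    have h1 : ∀ a ∈ s, ∀ᶠ τ in 𝓝 σ, ∀ y ∈ K a, |R a y σ - R a y τ| ≤ ε / (|C| + 1) := by
      intro a ha
      refine IsCompact.eventually_forall_of_forall_eventually (hK a) fun y hy => ?_
      have c1 : ContinuousAt (fun q : W × X => R a q.2 q.1) (σ, y) :=
        ContinuousAt.comp (g := fun q : X × W => R a q.1 q.2)
          (f := fun q : W × X => (q.2, q.1)) (hR a ha y hy σ hσ) (by fun_prop)
      have c2 : ContinuousAt (fun q : W × X => R a q.2 σ) (σ, y) :=
        ContinuousAt.comp (g := fun q : X × W => R a q.1 q.2)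
          (f := fun q : W × X => (q.2, σ)) (hR a ha y hy σ hσ) (by fun_prop)
      have c3 := (c2.sub c1).abs
      refine (c3.eventually_lt_const (u := ε / (|C| + 1)) (by simpa using hδ)).mono fun q hq => ?_
      exact hq.le
    filter_upwards [(Filter.eventually_all_finset s).2 h1, hN.mem_nhds hσ] with τ hτ hτN y
    -- The difference of two solutions solves the problem for the difference of the data, and the
    -- normalization bounds it at the base points by the same quantity.
    have h2 := hC (fun y => u y τ - u y σ) (fun a y => R a y σ - R a y τ) _ hδ.le
      ((hcont τ hτN).sub (hcont σ hσ)) (fun a ha y hy => hτ a ha y (hOK a hy))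
      (fun a ha => ((hu σ hσ a ha).sub (hu τ hτN a ha)).congr fun z _ => by ring)
      (fun y => by
        have := hτ _ (hi (p y)).1 (p y) (hOK _ (hi (p y)).2)
        rw [hp τ hτN, hp σ hσ]
        rwa [show -R (i (p y)) (p y) τ - -R (i (p y)) (p y) σ =
          R (i (p y)) (p y) σ - R (i (p y)) (p y) τ by ring]) y
    refine h2.trans ?_
    calc C * (ε / (|C| + 1)) ≤ (|C| + 1) * (ε / (|C| + 1)) :=
          mul_le_mul_of_nonneg_right (by linarith [le_abs_self C]) hδ.le
      _ = ε := by field_simp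
  rw [Metric.continuousAt_iff']
  intro ε hε
  have h1 := (hunif (ε / 2) (by positivity)).prod_inr (𝓝 x)
  have h2 := ((Metric.continuousAt_iff'.1 (hcont σ hσ).continuousAt) (ε / 2)
    (by positivity)).prod_inl_nhds (y := σ) (x := x)
  rw [nhds_prod_eq]
  rw [nhds_prod_eq] at h2
  filter_upwards [h1, h2] with q hq1 hq2
  rw [Real.dist_eq] at hq2 ⊢
  have := hq1 q.1
  calc |u q.1 q.2 - u x σ| = |(u q.1 q.2 - u q.1 σ) + (u q.1 σ - u x σ)| := by ring_nf
    _ ≤ |u q.1 q.2 - u q.1 σ| + |u q.1 σ - u x σ| := abs_add_le _ _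
    _ < ε := by linarith

/-- Normalized solutions `u` of the equations `R a + u = ` pluriharmonic have the mean value
property in the parameter, if the differences `R b - R a` do. -/
theorem mvOn_parameter_of_normalized (hO : ∀ a, IsOpen (O a))
    (hOs : ∀ a, O a ⊆ (chartAt V a).source) (hi : ∀ x, i x ∈ s ∧ x ∈ O (i x))
    (hC : ∀ (u : X → ℝ) (w : X → X → ℝ) (δ : ℝ),
      0 ≤ δ → Continuous u → (∀ a ∈ s, ∀ x ∈ O a, |w a x| ≤ δ) →
      (∀ a ∈ s, MVChart V a (O a) (fun x => w a x - u x)) → (∀ x, |u (p x)| ≤ δ) →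
      ∀ x, |u x| ≤ C * δ)
    (hR : ∀ a ∈ s, ∀ x ∈ O a, ∀ σ ∈ N, ContinuousAt (fun q : X × W => R a q.1 q.2) (x, σ))
    (hRab : ∀ a ∈ s, ∀ b ∈ s, ∀ x ∈ O a, x ∈ O b → MVOn (fun σ => R a x σ - R b x σ) N)
    (hu : ∀ σ ∈ N, ∀ a ∈ s, MVChart V a (O a) (fun x => R a x σ + u x σ))
    (hp : ∀ σ ∈ N, ∀ x, u (p x) σ = -R (i (p x)) (p x) σ)
    (huc : ∀ x, ∀ σ ∈ N, ContinuousAt (fun q : X × W => u q.1 q.2) (x, σ))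
    {a : X} (ha : a ∈ s) {x : X} (hx : x ∈ O a) : MVOn (fun σ => R a x σ + u x σ) N := by
  have hcc : ∀ a ∈ s, ∀ x ∈ O a, ContinuousOn (fun σ => R a x σ + u x σ) N :=
    fun a ha x hx σ hσ => ContinuousAt.continuousWithinAt
      (ContinuousAt.comp (g := fun q : X × W => R a q.1 q.2 + u q.1 q.2)
        (f := fun σ => (x, σ)) ((hR a ha x hx σ hσ).add (huc x σ hσ)) (by fun_prop))
  refine ⟨hcc a ha x hx, fun σ ξ hσξ => ?_⟩
  have hσ : σ ∈ N := by simpa using hσξ 0 (by simp)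
  let av : (W → ℝ) → ℝ := fun f => Real.circleAverage (fun ζ => f (σ + ζ • ξ)) 0 1
  -- The candidate for `u` at the centre `σ` of the disc, obtained by averaging. It does not depend
  -- on the patch chosen, because `R a - R b` has the mean value property in the parameter.
  let w : X → ℝ := fun y => av (fun τ => R (i y) y τ + u y τ) - R (i y) y σ
  have hw : ∀ b ∈ s, ∀ y ∈ O b, R b y σ + w y = av fun τ => R b y τ + u y τ := by
    intro b hb y hy
    have h1 := (hRab b hb _ (hi y).1 y hy (hi y).2).2 σ ξ hσξ
    have h2 := Real.circleAverage_sub (circleIntegrable_disc (hcc b hb y hy) hσξ)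
      (circleIntegrable_disc (hcc _ (hi y).1 y (hi y).2) hσξ)
    have h3 : av (fun τ => R b y τ + u y τ) - av (fun τ => R (i y) y τ + u y τ) =
        R b y σ - R (i y) y σ := by
      refine h2.symm.trans (Eq.trans ?_ h1)
      congr 1
      funext ζ
      simp
    simp only [w]
    linarith
  have hwm : ∀ b ∈ s, MVChart V b (O b) (fun y => R b y σ + w y) := by
    intro b hb
    have h1 := MVOn.circleAverage (V := V) (W := W) (N := N)
      (B := (chartAt V b).target ∩ (chartAt V b).symm ⁻¹' O b)
      (F := fun v τ => R b ((chartAt V b).symm v) τ + u ((chartAt V b).symm v) τ)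
      ((chartAt V b).isOpen_inter_preimage_symm (hO b)) ?_ (fun τ hτ => hu τ hτ b hb) hσξ
    · exact h1.congr fun v hv => hw b hb _ hv.2
    · rintro ⟨v, τ⟩ ⟨hv, hτ⟩
      refine ContinuousAt.continuousWithinAt ?_
      have c1 : ContinuousAt (fun q : V × W => ((chartAt V b).symm q.1, q.2)) (v, τ) :=
        (((chartAt V b).continuousAt_symm hv.1).comp continuousAt_fst).prodMk continuousAt_snd
      exact ContinuousAt.comp (g := fun q : X × W => R b q.1 q.2 + u q.1 q.2)
        (f := fun q : V × W => ((chartAt V b).symm q.1, q.2))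
        ((hR b hb _ hv.2 τ hτ).add (huc _ τ hτ)) c1
  have hRx : ∀ a ∈ s, ∀ x ∈ O a, ContinuousAt (fun y => R a y σ) x :=
    fun a ha x hx => ContinuousAt.comp (g := fun q : X × W => R a q.1 q.2)
      (f := fun y => (y, σ)) (hR a ha x hx σ hσ) (by fun_prop)
  have hwc : Continuous w := continuous_of_mvChart hO hOs hi (f := fun a y => R a y σ) hRx hwm
  have hucσ : Continuous fun y => u y σ :=
    continuous_of_mvChart hO hOs hi (f := fun a y => R a y σ) hRx (hu σ hσ)
  -- Uniqueness is the estimate with `δ = 0`: `u` at `σ` and `w` solve the same equation and agree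
  -- at the base points.
  have heq := hC (fun y => u y σ - w y) (fun _ _ => 0) 0 le_rfl (hucσ.sub hwc)
    (fun _ _ _ _ => by simp)
    (fun b hb => ((hwm b hb).sub (hu σ hσ b hb)).congr fun z _ => by ring)
    (fun y => by
      have h1 : av (fun τ => R (i (p y)) (p y) τ + u (p y) τ) = 0 := by
        rw [← Real.circleAverage_const (0 : ℝ) (0 : ℂ) 1]
        refine Real.circleAverage_congr_sphere fun ζ hζ => ?_
        have := hp (σ + ζ • ξ) (hσξ ζ (by simpa using (by simpa using hζ : ‖ζ‖ = 1).le)) y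
        simp only [this]
        ring
      simp only [w, h1, hp σ hσ]
      simp) x
  have h4 : u x σ = w x := by
    have : |u x σ - w x| ≤ 0 := by simpa using heq
    exact sub_eq_zero.1 (abs_nonpos_iff.1 this)
  exact (hw a ha x hx).symm.trans (by simp only [h4])

/-- Normalized solutions `u` of the equations `R a + u = ` pluriharmonic depend smoothly on the
parameter. -/
theorem contDiffOn_of_normalized [FiniteDimensional ℂ W] (hO : ∀ a, IsOpen (O a))
    (hOs : ∀ a, O a ⊆ (chartAt V a).source) {K : X → Set X} (hK : ∀ a, IsCompact (K a))
    (hOK : ∀ a, O a ⊆ K a) (hi : ∀ x, i x ∈ s ∧ x ∈ O (i x))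
    (hC : ∀ (u : X → ℝ) (w : X → X → ℝ) (δ : ℝ),
      0 ≤ δ → Continuous u → (∀ a ∈ s, ∀ x ∈ O a, |w a x| ≤ δ) →
      (∀ a ∈ s, MVChart V a (O a) (fun x => w a x - u x)) → (∀ x, |u (p x)| ≤ δ) →
      ∀ x, |u x| ≤ C * δ)
    (hN : IsOpen N)
    (hR : ∀ a ∈ s, ∀ x ∈ K a, ∀ σ ∈ N, ContinuousAt (fun q : X × W => R a q.1 q.2) (x, σ))
    (hRab : ∀ a ∈ s, ∀ b ∈ s, ∀ x ∈ O a, x ∈ O b → MVOn (fun σ => R a x σ - R b x σ) N)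
    (hu : ∀ σ ∈ N, ∀ a ∈ s, MVChart V a (O a) (fun x => R a x σ + u x σ))
    (hp : ∀ σ ∈ N, ∀ x, u (p x) σ = -R (i (p x)) (p x) σ) {a : X} (ha : a ∈ s) :
    ContDiffOn ℝ ∞ (fun q : V × W => R a ((chartAt V a).symm q.1) q.2 +
      u ((chartAt V a).symm q.1) q.2) (((chartAt V a).target ∩ (chartAt V a).symm ⁻¹' O a) ×ˢ N) := by
  have huc : ∀ x, ∀ σ ∈ N, ContinuousAt (fun q : X × W => u q.1 q.2) (x, σ) := fun x σ hσ =>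
    continuousAt_of_normalized hO hOs hK hOK hi hC hN hR hu hp hσ
  have hR' : ∀ a ∈ s, ∀ x ∈ O a, ∀ σ ∈ N, ContinuousAt (fun q : X × W => R a q.1 q.2) (x, σ) :=
    fun a ha x hx => hR a ha x (hOK a hx)
  refine contDiffOn_of_separately_MVOn
    (v := fun q : V × W => R a ((chartAt V a).symm q.1) q.2 + u ((chartAt V a).symm q.1) q.2)
    ((chartAt V a).isOpen_inter_preimage_symm (hO a)) hN ?_ (fun σ hσ => hu σ hσ a ha)
    fun v hv => mvOn_parameter_of_normalized hO hOs hi hC hR' hRab hu hp huc ha hv.2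
  rintro ⟨v, τ⟩ ⟨hv, hτ⟩
  refine ContinuousAt.continuousWithinAt ?_
  have c1 : ContinuousAt (fun q : V × W => ((chartAt V a).symm q.1, q.2)) (v, τ) :=
    (((chartAt V a).continuousAt_symm hv.1).comp continuousAt_fst).prodMk continuousAt_snd
  exact ContinuousAt.comp (g := fun q : X × W => R a q.1 q.2 + u q.1 q.2)
    (f := fun q : V × W => ((chartAt V a).symm q.1, q.2))
    ((hR' a ha _ hv.2 τ hτ).add (huc _ τ hτ)) c1

end Parameters

/-- One point is chosen in each component. Components are open, so the choice is locally constant,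
and subtracting a value at `p x` only subtracts a locally constant function. -/
theorem exists_basePoint (X : Type*) [TopologicalSpace X] [LocallyConnectedSpace X] :
    ∃ p : X → X, (∀ x, p x ∈ connectedComponent x) ∧ (∀ x, p (p x) = p x) ∧
      ∀ x, ∀ᶠ y in 𝓝 x, p y = p x := by
  let p : X → X := fun x => Quotient.out (ConnectedComponents.mk x)
  have h1 : ∀ x, ConnectedComponents.mk (p x) = ConnectedComponents.mk x := fun x =>
    Quotient.out_eq _
  have h2 : ∀ x, p x ∈ connectedComponent x := fun x => by
    rw [← ConnectedComponents.coe_eq_coe.1 (h1 x)]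
    exact mem_connectedComponent
  have h3 : ∀ x, ∀ y ∈ connectedComponent x, p y = p x := fun x y hy => by
    have : ConnectedComponents.mk y = ConnectedComponents.mk x :=
      ConnectedComponents.coe_eq_coe'.2 hy
    simp only [p, this]
  exact ⟨p, h2, fun x => h3 x _ (h2 x), fun x =>
    Filter.mem_of_superset (isOpen_connectedComponent.mem_nhds mem_connectedComponent) (h3 x)⟩

/-! ### Smooth solutions on the whole family. -/

section Solutions

variable {VX : Type*} [NormedAddCommGroup VX] [NormedSpace ℂ VX]
  {VU : Type*} [NormedAddCommGroup VU] [NormedSpace ℂ VU]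
  {X : Type*} [TopologicalSpace X] [ChartedSpace VX X]
  {U : Type*} [TopologicalSpace U] [ChartedSpace VU U]
  {r : ℕ} {E : X × U → Type*} [TopologicalSpace (TotalSpace (Fin r → ℂ) E)]
  [∀ p, TopologicalSpace (E p)] [∀ p, AddCommGroup (E p)] [∀ p, Module ℂ (E p)]
  [FiberBundle (Fin r → ℂ) E] [VectorBundle ℂ (Fin r → ℂ) E]

/-- After multiplication of `det g` by `exp u` on `E_t`, the curvature of `E_t` is that of `E_o`:
the difference of the logarithms of the determinants is pluriharmonic. -/
def IsFlattening (g : HermitianMetric (𝓘(ℝ, VX).prod 𝓘(ℝ, VU)) r E) (o t : U) (u : X → ℝ) : Prop :=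
  ∀ a, IsReHolomorphicAt VX
    (fun x => logDet (trivializationAt (Fin r → ℂ) (Fibre VX VU E t) a) (g.restrict t) x + u x -
      logDet (trivializationAt (Fin r → ℂ) (Fibre VX VU E o) a) (g.restrict o) x) a

variable {g : HermitianMetric (𝓘(ℝ, VX).prod 𝓘(ℝ, VU)) r E} {o t : U} {u : X → ℝ}

theorem IsFlattening.add_isReHolomorphicAt {v : X → ℝ} (h : IsFlattening g o t u)
    (hv : ∀ a, IsReHolomorphicAt VX v a) : IsFlattening g o t fun x => u x + v x := fun a =>
  ((h a).add (hv a)).congr (Eventually.of_forall fun x => by ring)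

theorem IsFlattening.isReHolomorphicAt {v : X → ℝ} (h : IsFlattening g o o v) (a : X) :
    IsReHolomorphicAt VX v a :=
  (h a).congr (Eventually.of_forall fun x => by ring)

theorem IsFlattening.sum {ι : Type*} (s : Finset ι) {u : ι → X → ℝ} {c : ι → ℝ}
    (hc : ∑ j ∈ s, c j = 1) (h : ∀ j ∈ s, IsFlattening g o t (u j)) :
    IsFlattening g o t fun x => ∑ j ∈ s, c j * u j x := fun a => by
  refine (IsReHolomorphicAt.sum s fun j hj => (h j hj a).const_mul (c j)).congr
    (Eventually.of_forall fun x => ?_)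
  simp only [mul_sub, mul_add, Finset.sum_sub_distrib, Finset.sum_add_distrib, ← Finset.sum_mul, hc]
  ring

variable [ContMDiffVectorBundle ω (Fin r → ℂ) E (𝓘(ℂ, VX).prod 𝓘(ℂ, VU))]

theorem isReHolomorphicAt_logDet_sub (g : HermitianMetric (𝓘(ℝ, VX).prod 𝓘(ℝ, VU)) r E) {t : U}
    {a b : X}
    (e : Trivialization (Fin r → ℂ) (π (Fin r → ℂ) E)) [MemTrivializationAtlas e]
    (hb : b ∈ (trivializationAt (Fin r → ℂ) (Fibre VX VU E t) a).baseSet)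
    (he : (b, t) ∈ e.baseSet) : IsReHolomorphicAt VX (fun x => logDet e g (x, t) -
      logDet (trivializationAt (Fin r → ℂ) (Fibre VX VU E t) a) (g.restrict t) x) b := by
  have h2 : b ∈ (e.pullback (slice VX VU X t)).baseSet := he
  have h3 := contMDiffAt_detChange (I := 𝓘(ℂ, VX)) h2 hb
  refine ((IsReHolomorphicAt.log_norm h3 (Units.ne_zero _)).const_mul 2).congr ?_
  filter_upwards [(e.pullback (slice VX VU X t)).open_baseSet.mem_nhds h2,
    (trivializationAt (Fin r → ℂ) (Fibre VX VU E t) a).open_baseSet.mem_nhds hb] with x hx hx'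
  have h4 := logDet_change (g.restrict t) hx hx'
  rw [logDet_pullback g e hx] at h4
  rw [h4]
  ring

/-- The condition `IsFlattening` in arbitrary frames. -/
theorem IsFlattening.isReHolomorphicAt_frame (h : IsFlattening g o t u) {x : X}
    (e e' : Trivialization (Fin r → ℂ) (π (Fin r → ℂ) E)) [MemTrivializationAtlas e]
    [MemTrivializationAtlas e'] (he : (x, t) ∈ e.baseSet) (he' : (x, o) ∈ e'.baseSet) :
    IsReHolomorphicAt VX (fun y => logDet e g (y, t) + u y - logDet e' g (y, o)) x := by
  have h1 := isReHolomorphicAt_logDet_sub g e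
    (FiberBundle.mem_baseSet_trivializationAt (Fin r → ℂ) (Fibre VX VU E t) x) he
  have h2 := isReHolomorphicAt_logDet_sub g e'
    (FiberBundle.mem_baseSet_trivializationAt (Fin r → ℂ) (Fibre VX VU E o) x) he'
  exact (((h x).add h1).sub h2).congr (Eventually.of_forall fun y => by ring)

/-- The difference is `2 log` of the absolute value of a transition determinant, which is
holomorphic in the parameter as well. This is the only place where the holomorphic dependence of `E`
on `t` enters the smooth choice of solutions. -/
theorem mvOn_logDet_sub [IsManifold 𝓘(ℂ, VU) ω U]
    (g : HermitianMetric (𝓘(ℝ, VX).prod 𝓘(ℝ, VU)) r E) {t₀ : U} {x : X}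
    {N : Set VU} (hN : N ⊆ (chartAt VU t₀).target)
    (e e' : Trivialization (Fin r → ℂ) (π (Fin r → ℂ) E)) [MemTrivializationAtlas e]
    [MemTrivializationAtlas e'] (he : ∀ σ ∈ N, (x, (chartAt VU t₀).symm σ) ∈ e.baseSet)
    (he' : ∀ σ ∈ N, (x, (chartAt VU t₀).symm σ) ∈ e'.baseSet) :
    MVOn (fun σ => logDet e g (x, (chartAt VU t₀).symm σ) -
      logDet e' g (x, (chartAt VU t₀).symm σ)) N := by
  have h1 : MVOn (fun σ => Real.log ‖(detChange e e' (x, (chartAt VU t₀).symm σ) : ℂ)‖) N := by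
    refine MVOn.log_norm (fun σ hσ => ?_) fun σ hσ => Units.ne_zero _
    have h2 := contMDiffAt_detChange (I := 𝓘(ℂ, VX).prod 𝓘(ℂ, VU)) (he σ hσ) (he' σ hσ)
    have h3 : ContMDiffAt 𝓘(ℂ, VU) (𝓘(ℂ, VX).prod 𝓘(ℂ, VU)) ω (fun t : U => (x, t))
        ((chartAt VU t₀).symm σ) := contMDiffAt_const.prodMk contMDiffAt_id
    exact (contDiffAt_comp_chart_symm (hN hσ)
      (f := fun t => (detChange e e' (x, t) : ℂ))
      (ContMDiffAt.comp ((chartAt VU t₀).symm σ)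
        (g := fun q : X × U => (detChange e e' q : ℂ)) h2 h3)).analyticAt
  refine (h1.const_mul 2).congr fun σ hσ => ?_
  rw [logDet_change g (he σ hσ) (he' σ hσ)]
  ring

variable [FiniteDimensional ℂ VX] [IsManifold 𝓘(ℂ, VX) ω X] [T2Space X] [CompactSpace X]
  [FiniteDimensional ℂ VU] [IsManifold 𝓘(ℂ, VU) ω U]

/-- The given solutions are arbitrary in `t`. Normalizing their values at the base points makes them
smooth in `t`, by `contDiffOn_of_normalized`. -/
theorem exists_smooth_isFlattening_local (g : HermitianMetric (𝓘(ℝ, VX).prod 𝓘(ℝ, VU)) r E)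
    (o t₀ : U) (h : ∀ t, ∃ u : X → ℝ, IsFlattening g o t u) :
    ∃ N : Set U, IsOpen N ∧ t₀ ∈ N ∧ ∃ u : X → U → ℝ,
      (∀ x, ∀ t ∈ N, ContMDiffAt (𝓘(ℝ, VX).prod 𝓘(ℝ, VU)) 𝓘(ℝ, ℝ) ∞
        (fun q : X × U => u q.1 q.2) (x, t)) ∧
      ∀ t ∈ N, IsFlattening g o t fun x => u x t := by
  have : LocallyConnectedSpace X := ChartedSpace.locallyConnectedSpace VX X
  have : IsManifold 𝓘(ℝ, VX) ω X := isManifold_real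
  have : IsManifold 𝓘(ℝ, VU) ω U := isManifold_real
  have : IsManifold 𝓘(ℝ, VX) ∞ X := IsManifold.of_le (n := ω) le_top
  have : IsManifold 𝓘(ℝ, VU) ∞ U := IsManifold.of_le (n := ω) le_top
  obtain ⟨p, hp, hpp, hpl⟩ := exists_basePoint X
  let e : X → Trivialization (Fin r → ℂ) (π (Fin r → ℂ) E) :=
    fun a => trivializationAt (Fin r → ℂ) E (a, t₀)
  let e' : X → Trivialization (Fin r → ℂ) (π (Fin r → ℂ) E) :=
    fun a => trivializationAt (Fin r → ℂ) E (a, o)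
  have hT : ∀ a : X, ∃ O : Set X, IsOpen O ∧ a ∈ O ∧ ∀ x ∈ closure O,
      x ∈ (chartAt VX a).source ∧ (x, t₀) ∈ (e a).baseSet ∧ (x, o) ∈ (e' a).baseSet := by
    intro a
    have h1 : {x : X | (x, t₀) ∈ (e a).baseSet} ∈ 𝓝 a :=
      (((e a).open_baseSet).preimage (by fun_prop : Continuous fun x : X => (x, t₀))).mem_nhds
        (FiberBundle.mem_baseSet_trivializationAt' (a, t₀))
    have h2 : {x : X | (x, o) ∈ (e' a).baseSet} ∈ 𝓝 a :=
      (((e' a).open_baseSet).preimage (by fun_prop : Continuous fun x : X => (x, o))).mem_nhds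
        (FiberBundle.mem_baseSet_trivializationAt' (a, o))
    obtain ⟨K, hK, hKc, hKs⟩ := exists_mem_nhds_isClosed_subset
      (inter_mem ((chartAt VX a).open_source.mem_nhds (mem_chart_source VX a)) (inter_mem h1 h2))
    refine ⟨interior K, isOpen_interior, mem_interior_iff_mem_nhds.2 hK, fun x hx => ?_⟩
    exact hKs (closure_minimal interior_subset hKc hx)
  choose O hO haO hT using hT
  obtain ⟨s, hs, C, hC⟩ := exists_estimate VX hO haO hp
  choose i hi using hs
  have hev : ∀ a ∈ s, ∀ᶠ t in 𝓝 t₀, ∀ x ∈ closure (O a), (x, t) ∈ (e a).baseSet := by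
    intro a _
    refine IsCompact.eventually_forall_of_forall_eventually isClosed_closure.isCompact
      fun x hx => ?_
    have hsw : ContinuousAt (fun q : U × X => (q.2, q.1)) (t₀, x) := by fun_prop
    exact hsw.eventually ((e a).open_baseSet.mem_nhds (hT a x hx).2.1)
  obtain ⟨N₀, hN₀, hN₀o, htN₀⟩ := eventually_nhds_iff.1 ((Filter.eventually_all_finset s).2 hev)
  let φ := chartAt VU t₀
  let N : Set VU := φ.target ∩ φ.symm ⁻¹' N₀
  have hN : IsOpen N := φ.isOpen_inter_preimage_symm hN₀o
  let R : X → X → VU → ℝ := fun a x σ =>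
    logDet (e a) g (x, φ.symm σ) - logDet (e' a) g (x, o)
  choose v hv using h
  -- The value of `v t` at the base point is replaced by minus the local datum there, so that `R +
  -- u` vanishes at base points. The correction is locally constant in `x`, hence harmless.
  let u : X → U → ℝ := fun x t =>
    v t x + (-v t (p x) + -(logDet (e (i (p x))) g (p x, t) - logDet (e' (i (p x))) g (p x, o)))
  have hflat : ∀ t, IsFlattening g o t fun x => u x t := fun t =>
    (hv t).add_isReHolomorphicAt fun a => by
      refine (IsReHolomorphicAt.const (V := VX) (-v t (p a) +
        -(logDet (e (i (p a))) g (p a, t) - logDet (e' (i (p a))) g (p a, o))) a).congr ?_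
      filter_upwards [hpl a] with y hy
      rw [hy]
  have hsm : ∀ a ∈ s, ∀ x ∈ closure (O a), ∀ t ∈ N₀,
      ContMDiffAt (𝓘(ℝ, VX).prod 𝓘(ℝ, VU)) 𝓘(ℝ, ℝ) ∞
        (fun q : X × U => logDet (e a) g q - logDet (e' a) g (q.1, o)) (x, t) := by
    intro a ha x hx t ht
    refine (contMDiffAt_logDet g (hN₀ t ht a ha x hx)).sub ?_
    exact ContMDiffAt.comp (x, t) (g := logDet (e' a) g) (f := fun q : X × U => (q.1, o))
      (contMDiffAt_logDet g (hT a x hx).2.2) (contMDiffAt_fst.prodMk contMDiffAt_const)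
  have key : ∀ a ∈ s, ContDiffOn ℝ ∞ (fun q : VX × VU => R a ((chartAt VX a).symm q.1) q.2 +
      u ((chartAt VX a).symm q.1) (φ.symm q.2))
      (((chartAt VX a).target ∩ (chartAt VX a).symm ⁻¹' O a) ×ˢ N) := by
    intro a ha
    refine contDiffOn_of_normalized (u := fun x σ => u x (φ.symm σ)) hO
      (fun a x hx => (hT a x (subset_closure hx)).1) (K := fun a => closure (O a))
      (fun a => isClosed_closure.isCompact) (fun a => subset_closure) hi hC hN ?_ ?_ ?_ ?_ ha
    · intro a ha x hx σ hσ
      have c1 : ContinuousAt (fun q : X × VU => (q.1, φ.symm q.2)) (x, σ) :=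
        continuousAt_fst.prodMk ((φ.continuousAt_symm hσ.1).comp continuousAt_snd)
      exact ContinuousAt.comp (f := fun q : X × VU => (q.1, φ.symm q.2))
        (g := fun q : X × U => logDet (e a) g q - logDet (e' a) g (q.1, o))
        (hsm a ha x hx _ hσ.2).continuousAt c1
    · intro a ha b hb x hxa hxb
      have h1 := mvOn_logDet_sub g (x := x) (N := N) (fun σ hσ => hσ.1) (e a) (e b)
        (fun σ hσ => hN₀ _ hσ.2 a ha x (subset_closure hxa))
        (fun σ hσ => hN₀ _ hσ.2 b hb x (subset_closure hxb))
      refine (h1.add (MVOn.const (logDet (e' b) g (x, o) - logDet (e' a) g (x, o)) N)).congr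
        fun σ _ => ?_
      simp only [R]
      ring
    · intro σ hσ a ha
      refine MVOn.of_isReHolomorphicAt (F := fun x => R a x σ + u x (φ.symm σ))
        (fun w hw => hw.1) fun w hw => ?_
      refine ((hflat (φ.symm σ)).isReHolomorphicAt_frame (e a) (e' a)
        (hN₀ _ hσ.2 a ha _ (subset_closure hw.2)) (hT a _ (subset_closure hw.2)).2.2).congr ?_
      refine Eventually.of_forall fun y => ?_
      simp only [R]
      ring
    · intro σ _ x
      simp only [u, R, hpp]
      ring
  refine ⟨N₀ ∩ φ.source, hN₀o.inter φ.open_source, ⟨htN₀, mem_chart_source VU t₀⟩, u, ?_,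
    fun t _ => hflat t⟩
  rintro x t ⟨ht, htφ⟩
  obtain ⟨ha, hx⟩ := hi x
  have hxs : x ∈ (chartAt VX (i x)).source := (hT _ _ (subset_closure hx)).1
  have h1 := (key _ ha).contDiffAt (x := (chartAt VX (i x) x, φ t))
    ((((chartAt VX (i x)).isOpen_inter_preimage_symm (hO _)).prod hN).mem_nhds
      ⟨⟨(chartAt VX (i x)).map_source hxs, by
        simpa only [mem_preimage, (chartAt VX (i x)).left_inv hxs] using hx⟩,
        φ.map_source htφ, by simpa only [mem_preimage, φ.left_inv htφ] using ht⟩)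
  have c1 : ContMDiffAt (𝓘(ℝ, VX).prod 𝓘(ℝ, VU)) 𝓘(ℝ, VX) ∞
      (fun q : X × U => chartAt VX (i x) q.1) (x, t) :=
    ContMDiffAt.comp (x, t) (g := chartAt VX (i x)) (f := fun q : X × U => q.1)
      (contMDiffAt_of_mem_maximalAtlas (IsManifold.chart_mem_maximalAtlas _) hxs) contMDiffAt_fst
  have c2 : ContMDiffAt (𝓘(ℝ, VX).prod 𝓘(ℝ, VU)) 𝓘(ℝ, VU) ∞
      (fun q : X × U => φ q.2) (x, t) :=
    ContMDiffAt.comp (x, t) (g := φ) (f := fun q : X × U => q.2)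
      (contMDiffAt_of_mem_maximalAtlas (IsManifold.chart_mem_maximalAtlas _) htφ) contMDiffAt_snd
  have c3 := ContMDiffAt.comp (x, t) (f := fun q : X × U => (chartAt VX (i x) q.1, φ q.2))
    h1.contMDiffAt (c1.prodMk_space c2)
  -- Smoothness was obtained for `R + u`; the metric gives smoothness of `R`, so their difference
  -- `u` is smooth.
  refine (c3.sub (hsm _ ha x (subset_closure hx) t ht)).congr_of_eventuallyEq ?_
  have n1 : ∀ᶠ q : X × U in 𝓝 (x, t), q.1 ∈ (chartAt VX (i x)).source :=
    continuousAt_fst.eventually ((chartAt VX (i x)).open_source.mem_nhds hxs)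
  have n2 : ∀ᶠ q : X × U in 𝓝 (x, t), q.2 ∈ φ.source :=
    continuousAt_snd.eventually (φ.open_source.mem_nhds htφ)
  filter_upwards [n1, n2] with q hq1 hq2
  simp only [Function.comp, R, (chartAt VX (i x)).left_inv hq1, φ.left_inv hq2]
  ring

/-- If the equation can be solved on all fibres, it has a smooth solution on `X × U` which vanishes
on the central fibre. -/
theorem exists_smooth_isFlattening [T2Space U] [SecondCountableTopology U]
    (g : HermitianMetric (𝓘(ℝ, VX).prod 𝓘(ℝ, VU)) r E)
    (o : U) (h : ∀ t, ∃ u : X → ℝ, IsFlattening g o t u) :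
    ∃ u : X × U → ℝ, ContMDiff (𝓘(ℝ, VX).prod 𝓘(ℝ, VU)) 𝓘(ℝ, ℝ) ∞ u ∧ (∀ x, u (x, o) = 0) ∧
      ∀ t, IsFlattening g o t fun x => u (x, t) := by
  have : IsManifold 𝓘(ℝ, VU) ω U := isManifold_real
  have : IsManifold 𝓘(ℝ, VU) ∞ U := IsManifold.of_le (n := ω) le_top
  have : FiniteDimensional ℝ VU := FiniteDimensional.complexToReal VU
  have : LocallyCompactSpace U := Manifold.locallyCompact_of_finiteDimensional 𝓘(ℝ, VU)
  choose N hN htN u hu hflat using fun t₀ => exists_smooth_isFlattening_local g o t₀ h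
  obtain ⟨ρ, hρ⟩ := SmoothPartitionOfUnity.exists_isSubordinate 𝓘(ℝ, VU) isClosed_univ N hN
    fun t _ => mem_iUnion.2 ⟨t, htN t⟩
  -- The weights depend on `t` only and sum to one, so on each fibre this is an affine combination
  -- of solutions.
  let w : X × U → ℝ := fun q => ∑ᶠ j, ρ j q.2 * u j q.1 q.2
  have hw : ContMDiff (𝓘(ℝ, VX).prod 𝓘(ℝ, VU)) 𝓘(ℝ, ℝ) ∞ w := by
    rintro ⟨x, t⟩
    refine contMDiffAt_finsum ?_ fun j => ?_
    · refine (ρ.locallyFinite.preimage_continuous (continuous_snd (X := X))).subset fun j q hq => ?_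
      exact fun h0 => hq (by simp only [h0, zero_mul])
    · by_cases ht : t ∈ tsupport (ρ j)
      · refine ContMDiffAt.mul ?_ (hu j x t (hρ j ht))
        exact ContMDiffAt.comp (x, t) (g := ρ j) (f := fun q : X × U => q.2)
          (ρ j).contMDiff.contMDiffAt contMDiffAt_snd
      · refine (contMDiffAt_const (c := (0 : ℝ))).congr_of_eventuallyEq ?_
        have h1 := notMem_tsupport_iff_eventuallyEq.1 ht
        filter_upwards [(continuousAt_snd (p := (x, t))).eventually h1] with q hq
        rw [hq]
        simp
  have hwf : ∀ t, IsFlattening g o t fun x => w (x, t) := fun t => by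
    have h1 := IsFlattening.sum (g := g) (o := o) (t := t) (ρ.finsupport t) (c := fun j => ρ j t)
      (u := fun j x => u j x t) (ρ.sum_finsupport t (mem_univ t)) fun j hj => by
        refine hflat j t (hρ j (subset_tsupport _ ?_))
        exact (ρ.mem_finsupport t).1 hj
    have h2 : (fun x => w (x, t)) = fun x => ∑ j ∈ ρ.finsupport t, ρ j t * u j x t := by
      funext x
      exact (ρ.sum_finsupport_smul_eq_finsum t (fun j t => u j x t)).symm
    rw [h2]
    exact h1
  -- On the central fibre the two log-determinants cancel, so the solution there is itself
  -- pluriharmonic and may be subtracted on every fibre.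
  refine ⟨fun q => w q - w (q.1, o), hw.sub ?_, fun x => sub_self _, fun t => ?_⟩
  · exact hw.comp (contMDiff_fst.prodMk contMDiff_const)
  · exact (hwf t).add_isReHolomorphicAt fun a => ((hwf o).isReHolomorphicAt a).neg

end Solutions

/-! ### Rescaling and gluing hermitian metrics. -/

section Scale

variable {V : Type*} [NormedAddCommGroup V] [NormedSpace ℝ V] {H : Type*} [TopologicalSpace H]
  {I : ModelWithCorners ℝ V H} {M : Type*} [TopologicalSpace M] [ChartedSpace H M]
  {r : ℕ} {E : M → Type*} [TopologicalSpace (TotalSpace (Fin r → ℂ) E)]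
  [∀ p, TopologicalSpace (E p)] [∀ p, AddCommMonoid (E p)] [∀ p, Module ℂ (E p)]
  [FiberBundle (Fin r → ℂ) E] [VectorBundle ℂ (Fin r → ℂ) E]

theorem contMDiffAt_ofReal_mul {f : M → ℝ} {h : M → ℂ} {p : M} {n : ℕ∞ω}
    (hf : ContMDiffAt I 𝓘(ℝ, ℝ) n f p) (hh : ContMDiffAt I 𝓘(ℝ, ℂ) n h p) :
    ContMDiffAt I 𝓘(ℝ, ℂ) n (fun q => (f q : ℂ) * h q) p := by
  refine (hf.smul hh).congr_of_eventuallyEq (Eventually.of_forall fun q => ?_)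
  exact (Complex.real_smul).symm

/-- The metric `ρ g`, for a positive function `ρ`. -/
def HermitianMetric.scale (g : HermitianMetric I r E) (ρ : M → ℝ) (hρ : ContMDiff I 𝓘(ℝ, ℝ) ∞ ρ)
    (h0 : ∀ p, 0 < ρ p) : HermitianMetric I r E where
  form p := (ρ p : ℂ) • g.form p
  conj_symm p v w := by simp [g.conj_symm p v w]
  pos p v hv := by
    simp only [LinearMap.smul_apply, smul_eq_mul, Complex.re_ofReal_mul]
    exact mul_pos (h0 p) (g.pos p v hv)
  smooth e _ v w p hp := (contMDiffAt_ofReal_mul hρ.contMDiffAt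
    ((g.smooth e v w).contMDiffAt (e.open_baseSet.mem_nhds hp))).contMDiffWithinAt

theorem logDet_scale (g : HermitianMetric I r E) {ρ : M → ℝ} (hρ : ContMDiff I 𝓘(ℝ, ℝ) ∞ ρ)
    (h0 : ∀ p, 0 < ρ p) (e : Trivialization (Fin r → ℂ) (π (Fin r → ℂ) E))
    [MemTrivializationAtlas e] {p : M} (hp : p ∈ e.baseSet) :
    logDet e (g.scale ρ hρ h0) p = logDet e g p + r * Real.log (ρ p) := by
  have h1 : (g.scale ρ hρ h0).gramDet e p = ((ρ p ^ r : ℝ) : ℂ) * g.gramDet e p := by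
    have : gramMatrix e (g.scale ρ hρ h0) p = (ρ p : ℂ) • gramMatrix e g p := rfl
    rw [gramDet_eq, this, Matrix.det_smul, Fintype.card_fin, gramDet_eq]
    push_cast
    rfl
  rw [logDet, logDet, h1, Complex.re_ofReal_mul,
    Real.log_mul (pow_pos (h0 p) r).ne' (gramDet_pos g hp).ne', Real.log_pow]
  ring

open scoped Classical in
/-- Local metrics on the members of an open cover are glued by a partition of unity. -/
def glue {ι : Type*} (ρ : SmoothPartitionOfUnity ι I M univ) (Ω : ι → Set M)
    (hρ : ρ.IsSubordinate Ω) (f : ι → ∀ p, E p →ₗ⋆[ℂ] E p →ₗ[ℂ] ℂ)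
    (hconj : ∀ j, ∀ p ∈ Ω j, ∀ v w, f j p w v = starRingEnd ℂ (f j p v w))
    (hpos : ∀ j, ∀ p ∈ Ω j, ∀ v, v ≠ 0 → 0 < (f j p v v).re)
    (hsmooth : ∀ (j) (e : Trivialization (Fin r → ℂ) (π (Fin r → ℂ) E)) [MemTrivializationAtlas e]
      (v w : Fin r → ℂ), ∀ p ∈ Ω j, p ∈ e.baseSet → ContMDiffAt I 𝓘(ℝ, ℂ) ∞
        (fun q => f j q (e.symm q v) (e.symm q w)) p) : HermitianMetric I r E where
  form p := ∑ j ∈ ρ.finsupport p, (ρ j p : ℂ) • f j p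
  conj_symm p v w := by
    simp only [LinearMap.sum_apply, LinearMap.smul_apply, map_sum, smul_eq_mul, map_mul,
      Complex.conj_ofReal]
    refine Finset.sum_congr rfl fun j hj => ?_
    rw [hconj j p (hρ j (subset_tsupport _ ((ρ.mem_finsupport p).1 hj)))]
  pos p v hv := by
    simp only [LinearMap.sum_apply, LinearMap.smul_apply, smul_eq_mul, Complex.re_sum,
      Complex.re_ofReal_mul]
    have h1 := ρ.sum_finsupport p (mem_univ p)
    refine Finset.sum_pos (fun j hj => ?_) ?_
    · have hj' := (ρ.mem_finsupport p).1 hj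
      exact mul_pos (lt_of_le_of_ne (ρ.nonneg j p) (Ne.symm hj'))
        (hpos j p (hρ j (subset_tsupport _ hj')) v hv)
    · by_contra hne
      rw [Finset.not_nonempty_iff_eq_empty] at hne
      rw [hne] at h1
      simp at h1
  smooth e _ v w p hp := by
    refine ContMDiffAt.contMDiffWithinAt ?_
    have h1 := ρ.contMDiffAt_finsum (n := (⊤ : ℕ∞)) (x₀ := p)
      (g := fun j q => f j q (e.symm q v) (e.symm q w))
      fun j hj => hsmooth j e v w p (hρ j hj) hp
    refine h1.congr_of_eventuallyEq (Eventually.of_forall fun q => ?_)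
    simp only [LinearMap.sum_apply, LinearMap.smul_apply]
    rw [← ρ.sum_finsupport_smul_eq_finsum q (fun j q => f j q (e.symm q v) (e.symm q w))]
    exact Finset.sum_congr rfl fun j _ => (Complex.real_smul).symm

/-- The weights sum to one and only pieces defined near `p` contribute, so a form on which they all
agree survives gluing. This preserves the prescribed metric on the central fibre. -/
theorem glue_form_eq {ι : Type*} {ρ : SmoothPartitionOfUnity ι I M univ} {Ω : ι → Set M}
    {hρ : ρ.IsSubordinate Ω} {f : ι → ∀ p, E p →ₗ⋆[ℂ] E p →ₗ[ℂ] ℂ}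
    {hconj : ∀ j, ∀ p ∈ Ω j, ∀ v w, f j p w v = starRingEnd ℂ (f j p v w)}
    {hpos : ∀ j, ∀ p ∈ Ω j, ∀ v, v ≠ 0 → 0 < (f j p v v).re}
    {hsmooth : ∀ (j) (e : Trivialization (Fin r → ℂ) (π (Fin r → ℂ) E)) [MemTrivializationAtlas e]
      (v w : Fin r → ℂ), ∀ p ∈ Ω j, p ∈ e.baseSet → ContMDiffAt I 𝓘(ℝ, ℂ) ∞
        (fun q => f j q (e.symm q v) (e.symm q w)) p}
    {p : M} {F : E p →ₗ⋆[ℂ] E p →ₗ[ℂ] ℂ} (h : ∀ j, p ∈ Ω j → f j p = F) :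
    (glue ρ Ω hρ f hconj hpos hsmooth).form p = F := by
  have h1 : ∀ j ∈ ρ.finsupport p, (ρ j p : ℂ) • f j p = (ρ j p : ℂ) • F := fun j hj => by
    rw [h j (hρ j (subset_tsupport _ ((ρ.mem_finsupport p).1 hj)))]
  change ∑ j ∈ ρ.finsupport p, (ρ j p : ℂ) • f j p = F
  rw [Finset.sum_congr rfl h1, ← Finset.sum_smul, ← Complex.ofReal_sum,
    ρ.sum_finsupport p (mem_univ p), Complex.ofReal_one, one_smul]

/-- The form on `E p` with the coefficients `B` in the frame `e`. -/
def frameForm (e : Trivialization (Fin r → ℂ) (π (Fin r → ℂ) E)) [MemTrivializationAtlas e]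
    (B : (Fin r → ℂ) →ₗ⋆[ℂ] (Fin r → ℂ) →ₗ[ℂ] ℂ) (p : M) : E p →ₗ⋆[ℂ] E p →ₗ[ℂ] ℂ :=
  (B.comp (e.linearMapAt ℂ p)).compl₂ (e.linearMapAt ℂ p)

theorem frameForm_apply (e : Trivialization (Fin r → ℂ) (π (Fin r → ℂ) E))
    [MemTrivializationAtlas e] (B : (Fin r → ℂ) →ₗ⋆[ℂ] (Fin r → ℂ) →ₗ[ℂ] ℂ) (p : M) (v w : E p) :
    frameForm e B p v w = B (e.linearMapAt ℂ p v) (e.linearMapAt ℂ p w) := rfl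

/-- The standard hermitian form. -/
def stdForm (r : ℕ) : (Fin r → ℂ) →ₗ⋆[ℂ] (Fin r → ℂ) →ₗ[ℂ] ℂ :=
  LinearMap.mk₂'ₛₗ (starRingEnd ℂ) (RingHom.id ℂ)
    (fun v w => ∑ i, starRingEnd ℂ (v i) * w i)
    (fun v v' w => by simp [add_mul, Finset.sum_add_distrib])
    (fun c v w => by simp [mul_assoc, Finset.mul_sum])
    (fun v w w' => by simp [mul_add, Finset.sum_add_distrib])
    (fun c v w => by simp [mul_left_comm, Finset.mul_sum])

theorem stdForm_apply (v w : Fin r → ℂ) :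
    stdForm r v w = ∑ i, starRingEnd ℂ (v i) * w i := rfl

theorem stdForm_conj_symm (v w : Fin r → ℂ) : stdForm r w v = starRingEnd ℂ (stdForm r v w) := by
  simp [stdForm_apply, mul_comm]

theorem stdForm_pos {v : Fin r → ℂ} (hv : v ≠ 0) : 0 < (stdForm r v v).re := by
  rw [stdForm_apply, Complex.re_sum]
  have h1 : ∀ i, (starRingEnd ℂ (v i) * v i).re = Complex.normSq (v i) := fun i => by
    rw [← Complex.normSq_eq_conj_mul_self, Complex.ofReal_re]
  simp only [h1]
  obtain ⟨i, hi⟩ := Function.ne_iff.1 hv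
  exact Finset.sum_pos' (fun i _ => Complex.normSq_nonneg _)
    ⟨i, Finset.mem_univ i, Complex.normSq_pos.2 hi⟩

end Scale

/-! ### Curvature in terms of pluriharmonic functions. -/

theorem mddbar_sub {V : Type*} [NormedAddCommGroup V] [NormedSpace ℂ V]
    {M : Type*} [TopologicalSpace M] [ChartedSpace V M] [IsManifold 𝓘(ℂ, V) ω M] {F G : M → ℝ} {x : M}
    (hF : ContMDiffAt 𝓘(ℝ, V) 𝓘(ℝ, ℝ) 2 F x) (hG : ContMDiffAt 𝓘(ℝ, V) 𝓘(ℝ, ℝ) 2 G x) (v w : V) :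
    mddbar (V := V) (fun y => ((F y - G y : ℝ) : ℂ)) x v w =
      mddbar (V := V) (fun y => (F y : ℂ)) x v w - mddbar (V := V) (fun y => (G y : ℂ)) x v w := by
  have : IsManifold 𝓘(ℝ, V) ω M := isManifold_real
  have : IsManifold 𝓘(ℝ, V) 2 M := IsManifold.of_le (n := ω) le_top
  have h1 : ∀ {F : M → ℝ}, ContMDiffAt 𝓘(ℝ, V) 𝓘(ℝ, ℝ) 2 F x →
      ContDiffAt ℝ 2 (fun y => (F ((chartAt V x).symm y) : ℂ)) (chartAt V x x) := fun hF => by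
    refine Complex.ofRealCLM.contDiff.contDiffAt.comp _
      (contDiffAt_comp_chart_symm (mem_chart_target V x) ?_)
    rwa [(chartAt V x).left_inv (mem_chart_source V x)]
  have h2 := ddbar_add (h1 (hF.sub hG)) (h1 hG) v w
  simp only [mddbar]
  rw [eq_sub_iff_add_eq, ← h2]
  refine ddbar_congr (Eventually.of_forall fun y => ?_) v w
  simp

section Curvature

variable {V : Type*} [NormedAddCommGroup V] [NormedSpace ℂ V] [FiniteDimensional ℂ V]
  {M : Type*} [TopologicalSpace M] [ChartedSpace V M] [IsManifold 𝓘(ℂ, V) ω M]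
  {r : ℕ} {E₀ E₁ : M → Type*}
  [TopologicalSpace (TotalSpace (Fin r → ℂ) E₀)]
  [∀ p, TopologicalSpace (E₀ p)] [∀ p, AddCommMonoid (E₀ p)] [∀ p, Module ℂ (E₀ p)]
  [FiberBundle (Fin r → ℂ) E₀] [VectorBundle ℂ (Fin r → ℂ) E₀]
  [ContMDiffVectorBundle ω (Fin r → ℂ) E₀ 𝓘(ℂ, V)]
  [TopologicalSpace (TotalSpace (Fin r → ℂ) E₁)]
  [∀ p, TopologicalSpace (E₁ p)] [∀ p, AddCommMonoid (E₁ p)] [∀ p, Module ℂ (E₁ p)]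
  [FiberBundle (Fin r → ℂ) E₁] [VectorBundle ℂ (Fin r → ℂ) E₁]
  [ContMDiffVectorBundle ω (Fin r → ℂ) E₁ 𝓘(ℂ, V)]

theorem contMDiffAt_logDet_two (g : HermitianMetric 𝓘(ℝ, V) r E₀) {a x : M}
    (hx : x ∈ (trivializationAt (Fin r → ℂ) E₀ a).baseSet) :
    ContMDiffAt 𝓘(ℝ, V) 𝓘(ℝ, ℝ) 2 (logDet (trivializationAt (Fin r → ℂ) E₀ a) g) x :=
  (contMDiffAt_logDet g hx).of_le (WithTop.coe_le_coe.2 (le_top : (2 : ℕ∞) ≤ ⊤))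

/-- The definition of curvature uses a different frame at each point. To apply `∂∂̄` on a
neighbourhood one frame must serve for all nearby points, and the change of frame only adds a
pluriharmonic term. -/
theorem mddbar_logDet (g : HermitianMetric 𝓘(ℝ, V) r E₀) {a x : M}
    (hx : x ∈ (trivializationAt (Fin r → ℂ) E₀ a).baseSet) (v w : V) :
    mddbar (V := V) (fun y => (logDet (trivializationAt (Fin r → ℂ) E₀ a) g y : ℂ)) x v w =
      g.curvature x v w := by
  have hx' := FiberBundle.mem_baseSet_trivializationAt (Fin r → ℂ) E₀ x
  have h1 : IsReHolomorphicAt V (fun y => logDet (trivializationAt (Fin r → ℂ) E₀ a) g y -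
      logDet (trivializationAt (Fin r → ℂ) E₀ x) g y) x := by
    refine ((IsReHolomorphicAt.log_norm (contMDiffAt_detChange (I := 𝓘(ℂ, V)) hx hx')
      (Units.ne_zero _)).const_mul 2).congr ?_
    filter_upwards [(trivializationAt (Fin r → ℂ) E₀ a).open_baseSet.mem_nhds hx,
      (trivializationAt (Fin r → ℂ) E₀ x).open_baseSet.mem_nhds hx'] with y hy hy'
    rw [logDet_change g hy hy']
    ring
  have h2 := mddbar_add_of_isReHolomorphicAt (contMDiffAt_logDet_two g hx') h1 v w
  simp only [add_sub_cancel] at h2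
  exact h2

/-- Two metrics have the same curvature if and only if the logarithms of their determinants differ
by pluriharmonic functions. -/
theorem curvature_eq_iff (g₀ : HermitianMetric 𝓘(ℝ, V) r E₀) (g₁ : HermitianMetric 𝓘(ℝ, V) r E₁) :
    (∀ (x : M) (v w : TangentSpace 𝓘(ℂ, V) x), g₁.curvature x v w = g₀.curvature x v w) ↔
      ∀ a, IsReHolomorphicAt V (fun x => logDet (trivializationAt (Fin r → ℂ) E₁ a) g₁ x -
        logDet (trivializationAt (Fin r → ℂ) E₀ a) g₀ x) a := by
  constructor
  · intro h a
    have hm : ∀ᶠ y in 𝓝 a, y ∈ (trivializationAt (Fin r → ℂ) E₁ a).baseSet ∧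
        y ∈ (trivializationAt (Fin r → ℂ) E₀ a).baseSet :=
      ((trivializationAt (Fin r → ℂ) E₁ a).open_baseSet.eventually_mem
        (FiberBundle.mem_baseSet_trivializationAt' a)).and
        ((trivializationAt (Fin r → ℂ) E₀ a).open_baseSet.eventually_mem
          (FiberBundle.mem_baseSet_trivializationAt' a))
    refine isReHolomorphicAt_of_mddbar_eq_zero ?_ ?_
    · filter_upwards [hm] with y hy
      exact (contMDiffAt_logDet_two g₁ hy.1).sub (contMDiffAt_logDet_two g₀ hy.2)
    · filter_upwards [hm] with y hy v w
      have h1 := mddbar_sub (contMDiffAt_logDet_two g₁ hy.1) (contMDiffAt_logDet_two g₀ hy.2) v w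
      rw [h1, mddbar_logDet g₁ hy.1, mddbar_logDet g₀ hy.2]
      exact sub_eq_zero.2 (h y v w)
  · intro h x v w
    have h2 := mddbar_add_of_isReHolomorphicAt (contMDiffAt_logDet_two g₀
      (FiberBundle.mem_baseSet_trivializationAt (Fin r → ℂ) E₀ x)) (h x) v w
    simp only [add_sub_cancel] at h2
    exact h2

end Curvature

/-! ### Extension of a metric from the central fibre. -/

section Extension

variable {VX : Type*} [NormedAddCommGroup VX] [NormedSpace ℂ VX]
  {VU : Type*} [NormedAddCommGroup VU] [NormedSpace ℂ VU]
  {X : Type*} [TopologicalSpace X] [ChartedSpace VX X]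
  {U : Type*} [TopologicalSpace U] [ChartedSpace VU U]
  {r : ℕ} {E : X × U → Type*} [TopologicalSpace (TotalSpace (Fin r → ℂ) E)]
  [∀ p, TopologicalSpace (E p)] [∀ p, AddCommGroup (E p)] [∀ p, Module ℂ (E p)]
  [FiberBundle (Fin r → ℂ) E] [VectorBundle ℂ (Fin r → ℂ) E]

/-- In the frame `e'` the coefficients are those of `B` multiplied by entries of the coordinate
change and their conjugates; the conjugates make this a statement about real smoothness. -/
theorem smooth_frameForm [ContMDiffVectorBundle ω (Fin r → ℂ) E (𝓘(ℂ, VX).prod 𝓘(ℂ, VU))]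
    (e e' : Trivialization (Fin r → ℂ) (π (Fin r → ℂ) E)) [MemTrivializationAtlas e]
    [MemTrivializationAtlas e'] {B : X × U → (Fin r → ℂ) →ₗ⋆[ℂ] (Fin r → ℂ) →ₗ[ℂ] ℂ} {p : X × U}
    (hB : ∀ v w, ContMDiffAt (𝓘(ℝ, VX).prod 𝓘(ℝ, VU)) 𝓘(ℝ, ℂ) ∞ (fun q => B q v w) p)
    (h : p ∈ e.baseSet) (h' : p ∈ e'.baseSet) (v w : Fin r → ℂ) :
    ContMDiffAt (𝓘(ℝ, VX).prod 𝓘(ℝ, VU)) 𝓘(ℝ, ℂ) ∞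
      (fun q => frameForm e (B q) q (e'.symm q v) (e'.symm q w)) p := by
  have hc : ∀ (v : Fin r → ℂ) (k : Fin r), ContMDiffAt (𝓘(ℝ, VX).prod 𝓘(ℝ, VU)) 𝓘(ℝ, ℂ) ∞
      (fun q => e'.coordChangeL ℂ e q v k) p := fun v k => by
    have h1 := contMDiffAt_coordChangeL (n := ω) (IB := 𝓘(ℂ, VX).prod 𝓘(ℂ, VU)) (e := e') (e' := e)
      h' h
    have h2 : ContDiff ℂ ω fun L : (Fin r → ℂ) →L[ℂ] (Fin r → ℂ) => L v k :=
      (contDiff_apply ℂ ℂ k).comp (contDiff_id.clm_apply contDiff_const)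
    exact (contMDiffAt_real_prod (h2.contMDiff.contMDiffAt.comp p h1)).of_le le_top
  have hconj : ∀ (v : Fin r → ℂ) (k : Fin r), ContMDiffAt (𝓘(ℝ, VX).prod 𝓘(ℝ, VU)) 𝓘(ℝ, ℂ) ∞
      (fun q => starRingEnd ℂ (e'.coordChangeL ℂ e q v k)) p := fun v k =>
    Complex.conjCLE.contDiff.contMDiff.contMDiffAt.comp p (hc v k)
  have hmul : ∀ {f h : X × U → ℂ}, ContMDiffAt (𝓘(ℝ, VX).prod 𝓘(ℝ, VU)) 𝓘(ℝ, ℂ) ∞ f p →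
      ContMDiffAt (𝓘(ℝ, VX).prod 𝓘(ℝ, VU)) 𝓘(ℝ, ℂ) ∞ h p →
      ContMDiffAt (𝓘(ℝ, VX).prod 𝓘(ℝ, VU)) 𝓘(ℝ, ℂ) ∞ (fun q => f q * h q) p := fun hf hh =>
    (contDiff_mul (𝕜 := ℝ) (𝔸 := ℂ) (n := ∞)).contMDiff.contMDiffAt.comp p (hf.prodMk_space hh)
  have hsum : ContMDiffAt (𝓘(ℝ, VX).prod 𝓘(ℝ, VU)) 𝓘(ℝ, ℂ) ∞ (fun q => ∑ k, ∑ l,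
      starRingEnd ℂ (e'.coordChangeL ℂ e q v k) * e'.coordChangeL ℂ e q w l *
        B q (Pi.single k 1) (Pi.single l 1)) p :=
    ContMDiffAt.sum fun k _ => ContMDiffAt.sum fun l _ => hmul (hmul (hconj v k) (hc w l)) (hB _ _)
  refine hsum.congr_of_eventuallyEq ?_
  filter_upwards [e.open_baseSet.mem_nhds h, e'.open_baseSet.mem_nhds h'] with q hq hq'
  have h3 : ∀ v : Fin r → ℂ, e.linearMapAt ℂ q (e'.symm q v) = e'.coordChangeL ℂ e q v := fun v => by
    rw [Trivialization.coordChangeL_apply _ _ ⟨hq', hq⟩, Trivialization.coe_linearMapAt_of_mem e hq]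
  have h4 : ∀ v : Fin r → ℂ, v = ∑ k, v k • Pi.single k (1 : ℂ) := fun v => by
    funext i
    simp [Finset.sum_apply, Pi.single_apply]
  rw [frameForm_apply, h3, h3]
  conv_lhs => rw [h4 (e'.coordChangeL ℂ e q v), h4 (e'.coordChangeL ℂ e q w)]
  simp only [map_sum, LinearMap.map_smulₛₗ, LinearMap.sum_apply, LinearMap.smul_apply,
    smul_eq_mul, RingHom.id_apply, Finset.mul_sum]
  rw [Finset.sum_comm]
  refine Finset.sum_congr rfl fun i _ => Finset.sum_congr rfl fun j _ => ?_
  ring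

/-- The coefficients of a metric on the central fibre, in a frame `e` of the family. -/
def centralForm {o : U} (g₀ : HermitianMetric 𝓘(ℝ, VX) r (Fibre VX VU E o))
    (e : Trivialization (Fin r → ℂ) (π (Fin r → ℂ) E)) [MemTrivializationAtlas e] (x : X) :
    (Fin r → ℂ) →ₗ⋆[ℂ] (Fin r → ℂ) →ₗ[ℂ] ℂ :=
  let L : (Fin r → ℂ) →ₗ[ℂ] Fibre VX VU E o x := e.symmₗ ℂ (x, o)
  ((g₀.form x).comp L).compl₂ L

theorem centralForm_apply {o : U} (g₀ : HermitianMetric 𝓘(ℝ, VX) r (Fibre VX VU E o))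
    (e : Trivialization (Fin r → ℂ) (π (Fin r → ℂ) E)) [MemTrivializationAtlas e] (x : X)
    (v w : Fin r → ℂ) : centralForm g₀ e x v w =
      g₀.form x (e.symmₗ ℂ (x, o) v) (e.symmₗ ℂ (x, o) w) := rfl

theorem smooth_centralForm {o : U} (g₀ : HermitianMetric 𝓘(ℝ, VX) r (Fibre VX VU E o))
    (e : Trivialization (Fin r → ℂ) (π (Fin r → ℂ) E)) [MemTrivializationAtlas e] {p : X × U}
    (hp : (p.1, o) ∈ e.baseSet) (v w : Fin r → ℂ) :
    ContMDiffAt (𝓘(ℝ, VX).prod 𝓘(ℝ, VU)) 𝓘(ℝ, ℂ) ∞ (fun q : X × U => centralForm g₀ e q.1 v w) p := by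
  have ho : IsOpen {x : X | (x, o) ∈ e.baseSet} :=
    e.open_baseSet.preimage (by fun_prop : Continuous fun x : X => (x, o))
  have h1 := (g₀.smooth (e.pullback (slice VX VU X o)) v w).contMDiffAt (ho.mem_nhds hp)
  refine (ContMDiffAt.comp p (f := fun q : X × U => q.1) h1
    contMDiffAt_fst).congr_of_eventuallyEq ?_
  filter_upwards [continuousAt_fst.eventually (ho.mem_nhds hp)] with q hq
  rw [centralForm_apply]
  simp only [Function.comp]
  rw [pullback_symm e hq, pullback_symm e hq, Trivialization.coe_symmₗ e hq]

/-- Every metric on the central fibre extends to the family. -/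
theorem exists_metric_restrict_eq [FiniteDimensional ℂ VX] [IsManifold 𝓘(ℂ, VX) ω X] [T2Space X]
    [CompactSpace X] [FiniteDimensional ℂ VU] [IsManifold 𝓘(ℂ, VU) ω U] [T2Space U]
    [SecondCountableTopology U]
    [ContMDiffVectorBundle ω (Fin r → ℂ) E (𝓘(ℂ, VX).prod 𝓘(ℂ, VU))] {o : U}
    (g₀ : HermitianMetric 𝓘(ℝ, VX) r (Fibre VX VU E o)) :
    ∃ g : HermitianMetric (𝓘(ℝ, VX).prod 𝓘(ℝ, VU)) r E, g.restrict o = g₀ := by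
  classical
  have : IsManifold 𝓘(ℝ, VX) ω X := isManifold_real
  have : IsManifold 𝓘(ℝ, VU) ω U := isManifold_real
  have : IsManifold 𝓘(ℝ, VX) ∞ X := IsManifold.of_le (n := ω) le_top
  have : IsManifold 𝓘(ℝ, VU) ∞ U := IsManifold.of_le (n := ω) le_top
  have : FiniteDimensional ℝ VX := FiniteDimensional.complexToReal VX
  have : FiniteDimensional ℝ VU := FiniteDimensional.complexToReal VU
  have : LocallyCompactSpace U := Manifold.locallyCompact_of_finiteDimensional 𝓘(ℝ, VU)
  let e : X × U → Trivialization (Fin r → ℂ) (π (Fin r → ℂ) E) :=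
    fun j => trivializationAt (Fin r → ℂ) E j
  -- Patches centred on the central fibre carry `g₀`, extended with coefficients constant in the
  -- parameter, and so must keep `(x, o)` in the domain of the frame. All other patches avoid the
  -- central fibre and carry a standard form.
  let Ω : X × U → Set (X × U) := fun j =>
    (e j).baseSet ∩ (if j.2 = o then {q | (q.1, o) ∈ (e j).baseSet} else {q | q.2 ≠ o})
  let B : X × U → X × U → (Fin r → ℂ) →ₗ⋆[ℂ] (Fin r → ℂ) →ₗ[ℂ] ℂ := fun j q =>
    if j.2 = o then centralForm g₀ (e j) q.1 else stdForm r
  have hΩ : ∀ j, IsOpen (Ω j) := fun j => by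
    refine (e j).open_baseSet.inter ?_
    split_ifs with h
    · exact (e j).open_baseSet.preimage (by fun_prop : Continuous fun q : X × U => (q.1, o))
    · exact isOpen_ne.preimage continuous_snd
  have hjΩ : ∀ j, j ∈ Ω j := fun j => by
    refine ⟨FiberBundle.mem_baseSet_trivializationAt' j, ?_⟩
    split_ifs with h
    · have := FiberBundle.mem_baseSet_trivializationAt (Fin r → ℂ) E j
      rw [mem_ofPred_eq, ← h]
      exact this
    · exact h
  have hinj : ∀ {j p}, p ∈ (e j).baseSet → ∀ {v : E p}, v ≠ 0 → (e j).linearMapAt ℂ p v ≠ 0 :=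
    fun {j p} hp v hv h0 => hv (by rw [← (e j).symmₗ_linearMapAt (R := ℂ) hp v, h0, map_zero])
  have hinj' : ∀ {j p}, p ∈ (e j).baseSet → ∀ {v : Fin r → ℂ}, v ≠ 0 → (e j).symmₗ ℂ p v ≠ 0 :=
    fun {j p} hp v hv h0 => hv (by rw [← (e j).linearMapAt_symmₗ (R := ℂ) hp v, h0, map_zero])
  obtain ⟨ρ, hρ⟩ := SmoothPartitionOfUnity.exists_isSubordinate (𝓘(ℝ, VX).prod 𝓘(ℝ, VU))
    isClosed_univ Ω hΩ fun p _ => mem_iUnion.2 ⟨p, hjΩ p⟩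
  have hconj : ∀ j, ∀ p ∈ Ω j, ∀ v w : E p, frameForm (e j) (B j p) p w v =
      starRingEnd ℂ (frameForm (e j) (B j p) p v w) := by
    intro j p hp v w
    simp only [frameForm_apply, B]
    split_ifs with h
    · exact g₀.conj_symm _ _ _
    · exact stdForm_conj_symm _ _
  have hpos : ∀ j, ∀ p ∈ Ω j, ∀ v : E p, v ≠ 0 → 0 < (frameForm (e j) (B j p) p v v).re := by
    intro j p hp v hv
    have h1 := hinj hp.1 hv
    simp only [frameForm_apply, B]
    have h2 := hp.2
    split_ifs at h2 ⊢ with h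
    · exact g₀.pos _ _ (hinj' h2 h1)
    · exact stdForm_pos h1
  have hsmooth : ∀ (j) (e' : Trivialization (Fin r → ℂ) (π (Fin r → ℂ) E))
      [MemTrivializationAtlas e'] (v w : Fin r → ℂ), ∀ p ∈ Ω j, p ∈ e'.baseSet →
      ContMDiffAt (𝓘(ℝ, VX).prod 𝓘(ℝ, VU)) 𝓘(ℝ, ℂ) ∞
        (fun q => frameForm (e j) (B j q) q (e'.symm q v) (e'.symm q w)) p := by
    intro j e' _ v w p hp hp'
    refine smooth_frameForm (e j) e' (fun v w => ?_) hp.1 hp' v w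
    have h2 := hp.2
    simp only [B]
    split_ifs at h2 ⊢ with h
    · exact smooth_centralForm g₀ (e j) h2 v w
    · exact contMDiffAt_const
  have hext : ∀ x, ∀ F : E (x, o) →ₗ⋆[ℂ] E (x, o) →ₗ[ℂ] ℂ, F = g₀.form x →
      ∀ j, (x, o) ∈ Ω j → frameForm (e j) (B j (x, o)) (x, o) = F := by
    intro x F hF j hp
    refine LinearMap.ext fun v => LinearMap.ext fun w => ?_
    have h2 := hp.2
    rw [frameForm_apply]
    simp only [B]
    split_ifs at h2 ⊢ with h
    · rw [centralForm_apply, (e j).symmₗ_linearMapAt (R := ℂ) hp.1 v,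
        (e j).symmₗ_linearMapAt (R := ℂ) hp.1 w, hF]
      rfl
    · exact absurd rfl h2
  refine ⟨glue ρ Ω hρ (fun j p => frameForm (e j) (B j p) p) hconj hpos hsmooth,
    HermitianMetric.ext (funext fun x => ?_)⟩
  have h1 := glue_form_eq (hρ := hρ) (f := fun j p => frameForm (e j) (B j p) p) (hconj := hconj)
    (hpos := hpos) (hsmooth := hsmooth) (hext x (g₀.form x) rfl)
  exact h1

end Extension

/-! ### The determinant criterion and the conformal correction. -/

section Main

variable {VX : Type*} [NormedAddCommGroup VX] [NormedSpace ℂ VX] [FiniteDimensional ℂ VX]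
  {VU : Type*} [NormedAddCommGroup VU] [NormedSpace ℂ VU] [FiniteDimensional ℂ VU]
  {X : Type*} [TopologicalSpace X] [ChartedSpace VX X] [IsManifold 𝓘(ℂ, VX) ω X]
  [T2Space X] [CompactSpace X]
  {U : Type*} [TopologicalSpace U] [ChartedSpace VU U] [IsManifold 𝓘(ℂ, VU) ω U]
  [T2Space U] [SecondCountableTopology U]
  {r : ℕ} {E : X × U → Type*} [TopologicalSpace (TotalSpace (Fin r → ℂ) E)]
  [∀ p, TopologicalSpace (E p)] [∀ p, AddCommGroup (E p)] [∀ p, Module ℂ (E p)]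
  [FiberBundle (Fin r → ℂ) E] [VectorBundle ℂ (Fin r → ℂ) E]
  [ContMDiffVectorBundle ω (Fin r → ℂ) E (𝓘(ℂ, VX).prod 𝓘(ℂ, VU))]

theorem ricciFlat_iff (g : HermitianMetric (𝓘(ℝ, VX).prod 𝓘(ℝ, VU)) r E) (o : U) :
    RicciFlat g o ↔ ∀ t, IsFlattening g o t fun _ => 0 := by
  refine forall_congr' fun t => (curvature_eq_iff (g.restrict o) (g.restrict t)).trans ?_
  simp only [IsFlattening, add_zero]

theorem mem_realPic0_of_ricciFlat {g : HermitianMetric (𝓘(ℝ, VX).prod 𝓘(ℝ, VU)) r E} {o : U}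
    (hg : RicciFlat g o) {η : U → Pic0 𝓘(ℂ, VX) X} (hη : IsDetMap VX VU r E o η) (t : U) :
    η t ∈ realPic0 𝓘(ℂ, VX) X :=
  (mem_realPic0_iff_logDet (g.restrict o) (g.restrict t) (hη t)).2
    ⟨fun _ => 0, (ricciFlat_iff g o).1 hg t⟩

/-- Empty Gram determinants equal one. The case is separate because the conformal factor `exp (u /
r)` requires `r ≠ 0`. -/
theorem ricciFlat_of_rank_zero (hr : r = 0) (g : HermitianMetric (𝓘(ℝ, VX).prod 𝓘(ℝ, VU)) r E)
    (o : U) : RicciFlat g o := by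
  subst hr
  refine (ricciFlat_iff g o).2 fun t a => ?_
  have h : ∀ (t : U) (e : Trivialization (Fin 0 → ℂ) (π (Fin 0 → ℂ) (Fibre VX VU E t))) (x : X),
      logDet e (g.restrict t) x = 0 := fun t e x => by
    simp [logDet, HermitianMetric.gramDet]
  simp only [h, add_zero, sub_zero]
  exact IsReHolomorphicAt.const 0 a

/-- Real classes provide fibrewise corrections to `log det g`, and these can be chosen smoothly.
Scaling by `exp (u / r)` adds exactly `u` to `log det g` and is trivial over `o`, where `u`
vanishes. -/
theorem exists_conformal_ricciFlat {o : U} {η : U → Pic0 𝓘(ℂ, VX) X}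
    (hη : IsDetMap VX VU r E o η) (h : ∀ t, η t ∈ realPic0 𝓘(ℂ, VX) X)
    (g : HermitianMetric (𝓘(ℝ, VX).prod 𝓘(ℝ, VU)) r E) :
    ∃ g' : HermitianMetric (𝓘(ℝ, VX).prod 𝓘(ℝ, VU)) r E,
      Conformal g g' ∧ g'.restrict o = g.restrict o ∧ RicciFlat g' o := by
  rcases eq_or_ne r 0 with hr | hr
  · exact ⟨g, ⟨fun _ => 1, contMDiff_const, fun _ => one_pos, fun _ _ _ => by simp⟩, rfl,
      ricciFlat_of_rank_zero hr g o⟩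
  have hr' : (r : ℝ) ≠ 0 := Nat.cast_ne_zero.2 hr
  obtain ⟨u, hu, hu0, hflat⟩ := exists_smooth_isFlattening g o fun t =>
    (mem_realPic0_iff_logDet (g.restrict o) (g.restrict t) (hη t)).1 (h t)
  have hρ : ContMDiff (𝓘(ℝ, VX).prod 𝓘(ℝ, VU)) 𝓘(ℝ, ℝ) ∞ fun p => Real.exp (u p / r) := by
    have h1 : ContDiff ℝ ∞ fun z : ℝ => Real.exp (z / r) := (contDiff_id.div_const _).exp
    exact h1.contMDiff.comp hu
  have hpos : ∀ p, 0 < Real.exp (u p / r) := fun p => Real.exp_pos _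
  have hres : (g.scale _ hρ hpos).restrict o = g.restrict o := by
    ext x v w
    change (((Real.exp (u (x, o) / r) : ℝ) : ℂ) • g.form (x, o)) v w = g.form (x, o) v w
    simp [hu0]
  refine ⟨g.scale _ hρ hpos, ⟨_, hρ, hpos, fun p v w => rfl⟩, hres, ?_⟩
  refine (ricciFlat_iff _ o).2 fun t a => (hflat t a).congr ?_
  rw [hres]
  have hm := FiberBundle.mem_baseSet_trivializationAt (Fin r → ℂ) (Fibre VX VU E t) a
  have hρt : ContMDiff 𝓘(ℝ, VX) 𝓘(ℝ, ℝ) ∞ fun x : X => Real.exp (u (x, t) / r) :=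
    hρ.comp (contMDiff_id.prodMk contMDiff_const)
  filter_upwards [(trivializationAt (Fin r → ℂ) (Fibre VX VU E t) a).open_baseSet.mem_nhds hm]
    with x hx
  have h1 := logDet_scale (g.restrict t) hρt (fun x => hpos (x, t))
    (trivializationAt (Fin r → ℂ) (Fibre VX VU E t) a) hx
  rw [Real.log_exp, mul_div_cancel₀ _ hr'] at h1
  have h2 : (g.scale _ hρ hpos).restrict t = (g.restrict t).scale _ hρt (fun x => hpos (x, t)) := rfl
  rw [h2, h1]
  ring

end Main

end RicciFlatDeformation

end

theorem theorem4p1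
    {VX : Type*} [NormedAddCommGroup VX] [NormedSpace ℂ VX] [FiniteDimensional ℂ VX]
    {X : Type*} [TopologicalSpace X] [ChartedSpace VX X] [IsManifold 𝓘(ℂ, VX) ω X]
    [T2Space X] [CompactSpace X]
    {VU : Type*} [NormedAddCommGroup VU] [NormedSpace ℂ VU] [FiniteDimensional ℂ VU]
    {U : Type*} [TopologicalSpace U] [ChartedSpace VU U] [IsManifold 𝓘(ℂ, VU) ω U]
    [T2Space U] [SecondCountableTopology U] [ConnectedSpace U]
    (hU : RicciFlatDeformation.HolomorphicBundlesTrivial VU U) (o : U) (r : ℕ)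
    (E : X × U → Type*) [TopologicalSpace (TotalSpace (Fin r → ℂ) E)]
    [∀ p, TopologicalSpace (E p)] [∀ p, AddCommGroup (E p)] [∀ p, Module ℂ (E p)]
    [FiberBundle (Fin r → ℂ) E] [VectorBundle ℂ (Fin r → ℂ) E]
    [ContMDiffVectorBundle ω (Fin r → ℂ) E (𝓘(ℂ, VX).prod 𝓘(ℂ, VU))]
    (g₀ : RicciFlatDeformation.HermitianMetric 𝓘(ℝ, VX) r
      (RicciFlatDeformation.Fibre VX VU E o)) :
    (∃! η : U → RicciFlatDeformation.Pic0 𝓘(ℂ, VX) X, RicciFlatDeformation.IsDetMap VX VU r E o η) ∧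
    ∀ η : U → RicciFlatDeformation.Pic0 𝓘(ℂ, VX) X, RicciFlatDeformation.IsDetMap VX VU r E o η →
      ((∃ g : RicciFlatDeformation.HermitianMetric (𝓘(ℝ, VX).prod 𝓘(ℝ, VU)) r E,
          g.restrict o = g₀ ∧ RicciFlatDeformation.RicciFlat g o) ↔
        ∀ t, η t ∈ RicciFlatDeformation.realPic0 𝓘(ℂ, VX) X) ∧
      ((∀ t, η t ∈ RicciFlatDeformation.realPic0 𝓘(ℂ, VX) X) →
        ∀ g' : RicciFlatDeformation.HermitianMetric (𝓘(ℝ, VX).prod 𝓘(ℝ, VU)) r E,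
          g'.restrict o = g₀ →
          ∃ g : RicciFlatDeformation.HermitianMetric (𝓘(ℝ, VX).prod 𝓘(ℝ, VU)) r E,
            RicciFlatDeformation.Conformal g' g ∧ g.restrict o = g₀ ∧
              RicciFlatDeformation.RicciFlat g o) := by
  refine ⟨RicciFlatDeformation.existsUnique_isDetMap o, fun η hη => ⟨⟨?_, fun h => ?_⟩,
    fun h g' hg' => ?_⟩⟩
  · rintro ⟨g, -, hg⟩ t
    exact RicciFlatDeformation.mem_realPic0_of_ricciFlat hg hη t
  -- Any extension will do, since the conformal correction leaves the central fibre unchanged.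
  · obtain ⟨g', hg'⟩ := RicciFlatDeformation.exists_metric_restrict_eq (E := E) g₀
    obtain ⟨g, -, hg, hflat⟩ := RicciFlatDeformation.exists_conformal_ricciFlat hη h g'
    exact ⟨g, hg.trans hg', hflat⟩
  · obtain ⟨g, hc, hg, hflat⟩ := RicciFlatDeformation.exists_conformal_ricciFlat hη h g'
    exact ⟨g, hc, hg.trans hg', hflat⟩
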